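/- Let $F,\beta\in\mathbb R$ with $F\beta\neq0$, and consider for real functions $\psi^-,\psi^+$ of $(t,x,y)$ the two-layer system in barotropic/baroclinic variables \[ Q^+_t+\tfrac12\bigl(\{\psi^+,Q^+\}+\{\psi^-,Q^-\}\bigr)=0,\qquad Q^-_t+\tfrac12\bigl(\{\psi^+,Q^-\}+\{\psi^-,Q^+\}\bigr)=0, \] where $Q^+=\psi^+_{xx}+\psi^+_{yy}+2\beta y$, $Q^-=\psi^-_{xx}+\psi^-_{yy}-2F\psi^-$ and $\{a,b\}=a_xb_y-a_yb_x$. A point symmetry of the system on an open set $\Omega$ of the space $\mathbb R^5$ of the variables $(t,x,y,\psi^-,\psi^+)$ is a smooth map $\Phi\colon(t,x,y,\psi^-,\psi^+)\mapsto(\tilde t,\tilde x,\tilde y,\tilde\psi^-,\tilde\psi^+)$ from $\Omega$ to $\mathbb R^5$ with nowhere vanishing Jacobian whose prolongation to derivatives (defined where the total Jacobian of $(\tilde t,\tilde x,\tilde y)$ with respect to $(t,x,y)$ does not vanish) maps the manifold defined by the system in the space of third-order jets over $\Omega$ into the manifold defined by the system: whenever smooth functions $(\psi^-,\psi^+)$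 satisfy the two equations at a point, the transformed functions $(\tilde\psi^-,\tilde\psi^+)$ satisfy them, in the variables $(\tilde t,\tilde x,\tilde y)$, at the transformed point. Let $\Omega\subseteq\mathbb R^5$ be an open connected set whose sections $\{t=\mathrm{const}\}$ are all connected or empty (for example $\Omega=\mathbb R^5$ or a box), and let $I\subseteq\mathbb R$ be the set of the values of $t$ on $\Omega$. Then the point symmetries of the system on $\Omega$, continuous and discrete, are exactly the maps of the form \[ \tilde t=\varepsilon_1t+T_0,\quad \tilde x=\varepsilon_1x+f(t),\quad \tilde y=\varepsilon_2y+Y_0,\quad \tilde\psi^-=\varepsilon_3\psi^-+\Psi^-_0,\quad \tilde\psi^+=\varepsilon_2\psi^+-2\varepsilon_1\varepsilon_2f'(t)\,y+g(t), \] where $\varepsilon_1,\varepsilon_2,\varepsilon_3\in\{1,-1\}$, $T_0,Y_0,\Psi^-_0\in\mathbb R$, and $f,g\colon I\to\mathbb R$ are arbitrary smooth functions. -/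

import Mathlib

open scoped ContDiff Topology

noncomputable section

namespace TwoLayer

/-- The space of independent variables `(t, x, y)`. -/
abbrev Base : Type := ℝ × ℝ × ℝ

/-- The space of dependent variables `(ψ⁻, ψ⁺)`. -/
abbrev Fiber : Type := ℝ × ℝ

/-- The space of independent and dependent variables `((t, x, y), (ψ⁻, ψ⁺))`. -/
abbrev Total : Type := Base × Fiber

/-- Partial derivative in `t`. -/
def Dt (w : Base → ℝ) (p : Base) : ℝ := fderiv ℝ w p (1, 0, 0)

/-- Partial derivative in `x`. -/
def Dx (w : Base → ℝ) (p : Base) : ℝ := fderiv ℝ w p (0, 1, 0)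

/-- Partial derivative in `y`. -/
def Dy (w : Base → ℝ) (p : Base) : ℝ := fderiv ℝ w p (0, 0, 1)

/-- The Laplacian in the space variables `x`, `y`. -/
def lap (w : Base → ℝ) (p : Base) : ℝ := Dx (Dx w) p + Dy (Dy w) p

/-- The Poisson bracket `{a, b} = a_x b_y - a_y b_x`. -/
def bracket (a b : Base → ℝ) (p : Base) : ℝ := Dx a p * Dy b p - Dy a p * Dx b p

/-- The barotropic potential vorticity `Q⁺ = ∇²ψ⁺ + 2βy`. -/
def Qplus (β : ℝ) (ψp : Base → ℝ) (p : Base) : ℝ := lap ψp p + 2 * β * p.2.2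

/-- The baroclinic potential vorticity `Q⁻ = ∇²ψ⁻ - 2Fψ⁻`. -/
def Qminus (F : ℝ) (ψm : Base → ℝ) (p : Base) : ℝ := lap ψm p - 2 * F * ψm p

/-- The two equations of the two-layer system hold for `(ψ⁻, ψ⁺)` at the point `p`. -/
def SystemAt (F β : ℝ) (ψm ψp : Base → ℝ) (p : Base) : Prop :=
  Dt (Qplus β ψp) p
      + (1 / 2) * (bracket ψp (Qplus β ψp) p + bracket ψm (Qminus F ψm) p) = 0 ∧
  Dt (Qminus F ψm) p
      + (1 / 2) * (bracket ψp (Qminus F ψm) p + bracket ψm (Qplus β ψp) p) = 0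

/-- A point transformation on `Ω`: a smooth map of `(t, x, y, ψ⁻, ψ⁺)` into the space of these
variables with nonvanishing Jacobian. -/
structure IsPointTransformation (Ω : Set Total) (Φ : Total → Total) : Prop where
  smooth : ContDiffOn ℝ ∞ Φ Ω
  jacobian : ∀ z ∈ Ω, (fderiv ℝ Φ z).det ≠ 0

/-- Near `p` the map `Φ` carries the graph of `u` to the graph of the function `v` of the new
independent variables. The new independent variables `(Φ (q, u q)).1` are required to be
independent along the graph of `u` at `p` (nonzero total Jacobian), so that `v` is determined
near `(Φ (p, u p)).1` by `Φ` and `u`, and its derivatives at that point by those of `u` at `p`. -/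
structure Transforms (Φ : Total → Total) (u v : Base → Fiber) (p : Base) : Prop where
  transversal : (fderiv ℝ (fun q => (Φ (q, u q)).1) p).det ≠ 0
  graph : ∀ᶠ q in 𝓝 p, v (Φ (q, u q)).1 = (Φ (q, u q)).2

/-- A point symmetry on `Ω` of the two-layer system: a point transformation whose prolongation to
derivatives maps the manifold that the system defines in the jet space over `Ω` into the
manifold that it defines. Jets are represented by smooth functions: whenever the values and the
derivatives of `u` at `p` satisfy the system, so do those of the transformed function `v` at the
transformed point. -/
structure IsPointSymmetry (F β : ℝ) (Ω : Set Total) (Φ : Total → Total) : Prop where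
  pointTransformation : IsPointTransformation Ω Φ
  preserves : ∀ (u v : Base → Fiber) (p : Base),
    ContDiffAt ℝ ∞ u p → (p, u p) ∈ Ω →
    ContDiffAt ℝ ∞ v (Φ (p, u p)).1 → Transforms Φ u v p →
    SystemAt F β (fun q => (u q).1) (fun q => (u q).2) p →
    SystemAt F β (fun q => (v q).1) (fun q => (v q).2) (Φ (p, u p)).1

/-- The set of the values that the time variable takes on `Ω`. -/
def times (Ω : Set Total) : Set ℝ := (fun z : Total => z.1.1) '' Ω

end TwoLayer

end

/-! Write T, X, Y, A, B for the components of Φ, that is, for the new t, x, y, ψ⁻, ψ⁺, let J be the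
spatial Jacobian of (X, Y), and let λ = |∇X|².

The symmetry is read off from third-order jets. At a fixed first-order jet the system is affine in
the first derivatives of Δψ⁻ and Δψ⁺ and can be solved for their t-derivatives, so every first-order
jet extends to a jet on the system (`exists_jet`). Adding to a solution a product of three linear
forms centred at p alters only derivatives of third order, and the system survives exactly when a
linear symbol condition holds (`systemAt_iff_symbolVanishes`). Up to o(‖·‖³), the transformed
function changes by the product of the corresponding forms in the new variables times the image of
the increment (`transform_cubic_difference`). Hence Φ sends increments annihilated by the symbol to
increments annihilated by the symbol, which is pure linear algebra at each nondegenerate first-order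
jet (`IsPointSymmetry.linear_symbol`).

Three kinds of cubics are tested. The cube of t has zero Laplacian and so admits every increment;
this forces T to depend on t alone (`IsPointSymmetry.time_eq_zero`). The products t·x·y and t(x² −
y²) are harmonic; they force (X, Y) to be conformal along all jets, which is impossible if X or Y
involves ψ (`IsPointSymmetry.fiber_conformal`). Cubes of characteristic covectors, for which the
symbol has kernel vector (±1, 1), then decouple ψ⁻ from ψ⁺, give T_t B_{ψ⁺} = J and A_{ψ⁻} =
±B_{ψ⁺}, and express B_x and B_y through the motion of X and Y (`IsPointSymmetry.firstOrderAt`).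

It follows that λ is constant in space, so X and Y are harmonic and the new potential vorticities
pull back to explicit expressions (`FirstOrderOn.systemAt_iff`). Evaluating these on free jets
gives, because F ≠ 0, that λ = 1 and A_t = 0, together with the derivatives of the forcing ΔB/λ +
2βY (`IsPointSymmetry.lower_order`). A harmonic function with gradient of unit length has zero
Hessian, so only rigid motions remain at each time, and β ≠ 0 excludes rotations and a moving Y
(`FirstOrderOn.determiningEquations`). In the integration, connectedness of Ω gives the constants
and connectedness of the time slices gives the functions of t. The converse uses
`FirstOrderOn.systemAt_iff` in the other direction. -/

open scoped ContDiff Topology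

noncomputable section

namespace TwoLayer

open Filter Asymptotics

/-! ### Directional derivatives and third-order Taylor remainders -/

section Partial

variable {E : Type*} [NormedAddCommGroup E] [NormedSpace ℝ E]

/-- The derivative of `f` in the constant direction `e`, as a function. -/
def pd (e : E) (f : E → ℝ) (z : E) : ℝ := fderiv ℝ f z e

variable {f g : E → ℝ} {z e e' : E}

theorem contDiffAt_pd (hf : ContDiffAt ℝ ∞ f z) (e : E) : ContDiffAt ℝ ∞ (pd e f) z :=
  (hf.fderiv_right (m := ∞) le_rfl).clm_apply contDiffAt_const

theorem differentiableAt_of_smooth (hf : ContDiffAt ℝ ∞ f z) : DifferentiableAt ℝ f z :=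
  hf.differentiableAt (by simp)

theorem eventually_differentiableAt (hf : ContDiffAt ℝ ∞ f z) :
    ∀ᶠ q in 𝓝 z, DifferentiableAt ℝ f q := by
  have h1 : ContDiffAt ℝ 1 f z := hf.of_le (by exact_mod_cast le_top)
  filter_upwards [h1.eventually (by simp)] with q hq
  exact hq.differentiableAt (by simp)

theorem pd_congr (h : f =ᶠ[𝓝 z] g) (e : E) : pd e f z = pd e g z := by
  simp only [pd, h.fderiv_eq]

theorem pd_congr_eventually (h : f =ᶠ[𝓝 z] g) (e : E) : pd e f =ᶠ[𝓝 z] pd e g := by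
  filter_upwards [h.fderiv (𝕜 := ℝ)] with q hq
  simp only [pd, hq]

theorem pd_add (hf : DifferentiableAt ℝ f z) (hg : DifferentiableAt ℝ g z) :
    pd e (fun q => f q + g q) z = pd e f z + pd e g z := by
  simp [pd, fderiv_fun_add hf hg]

theorem pd_sub (hf : DifferentiableAt ℝ f z) (hg : DifferentiableAt ℝ g z) :
    pd e (fun q => f q - g q) z = pd e f z - pd e g z := by
  simp [pd, fderiv_fun_sub hf hg]

theorem pd_mul (hf : DifferentiableAt ℝ f z) (hg : DifferentiableAt ℝ g z) :
    pd e (fun q => f q * g q) z = pd e f z * g z + f z * pd e g z := by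
  simp [pd, fderiv_fun_mul hf hg]; ring

theorem pd_const_mul (c : ℝ) (hg : DifferentiableAt ℝ g z) :
    pd e (fun q => c * g q) z = c * pd e g z := by
  simp [pd, fderiv_const_mul hg]

theorem pd_const (c : ℝ) : pd e (fun _ : E => c) z = 0 := by
  simp [pd]

theorem pd_clm (l : E →L[ℝ] ℝ) (p : E) : pd e (fun q => l (q - p)) z = l e := by
  have : HasFDerivAt (fun q => l (q - p)) l z :=
    l.hasFDerivAt.comp z ((hasFDerivAt_id z).sub_const p)
  rw [pd, this.fderiv]

theorem pd_add_dir (a b : E) : pd (a + b) f = fun q => pd a f q + pd b f q := by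
  funext q; simp [pd]

theorem pd_smul_dir (c : ℝ) (a : E) : pd (c • a) f = fun q => c * pd a f q := by
  funext q; simp [pd]

theorem two_le_smooth : (2 : WithTop ℕ∞) ≤ ∞ := by
  have : ((2 : ℕ∞) : WithTop ℕ∞) ≤ ((⊤ : ℕ∞) : WithTop ℕ∞) := WithTop.coe_le_coe.2 le_top
  exact this

theorem pd_comm_of_contDiffAt_two (hf : ContDiffAt ℝ 2 f z) :
    pd e (pd e' f) z = pd e' (pd e f) z := by
  have hs := hf.isSymmSndFDerivAt (by rw [minSmoothness_of_isRCLikeNormedField])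
  have hd : DifferentiableAt ℝ (fderiv ℝ f) z :=
    (hf.fderiv_right (m := 1) (by norm_num)).differentiableAt (by simp)
  have key : ∀ a b : E, pd a (pd b f) z = fderiv ℝ (fderiv ℝ f) z a b := by
    intro a b
    have : HasFDerivAt (pd b f) ((fderiv ℝ (fderiv ℝ f) z).flip b) z := by
      have h := hd.hasFDerivAt.clm_apply (hasFDerivAt_const b z)
      simp only [ContinuousLinearMap.comp_zero, zero_add] at h
      exact h
    rw [pd, this.fderiv, ContinuousLinearMap.flip_apply]
  rw [key, key]
  exact hs.eq _ _

theorem pd_comm (hf : ContDiffAt ℝ ∞ f z) : pd e (pd e' f) z = pd e' (pd e f) z :=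
  pd_comm_of_contDiffAt_two (hf.of_le two_le_smooth)

theorem pd_comm_eventually (hf : ContDiffAt ℝ ∞ f z) (e e' : E) :
    pd e (pd e' f) =ᶠ[𝓝 z] pd e' (pd e f) := by
  filter_upwards [(hf.of_le two_le_smooth).eventually (by decide)] with q hq
  exact pd_comm_of_contDiffAt_two hq

/-- A polynomial of degree three that is `o(s³)` at the origin vanishes. -/
theorem cubic_coeff_eq_zero {a b c d : ℝ}
    (h : (fun s : ℝ => a + b * s + c * s ^ 2 + d * s ^ 3) =o[𝓝 0] fun s => s ^ 3) :
    a = 0 ∧ b = 0 ∧ c = 0 ∧ d = 0 := by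
  have hne : 𝓝[≠] (0 : ℝ) ≤ 𝓝 0 := nhdsWithin_le_nhds
  have lim : ∀ k : ℝ → ℝ, ContinuousAt k 0 → k =o[𝓝[≠] 0] (fun _ => (1 : ℝ)) → k 0 = 0 := by
    intro k hk ho
    have h1 : Tendsto k (𝓝[≠] 0) (𝓝 0) := (isLittleO_one_iff ℝ).1 ho
    exact tendsto_nhds_unique (hk.tendsto.mono_left hne) h1
  have step : ∀ (n : ℕ) (k : ℝ → ℝ), n ≤ 3 → ContinuousAt k 0 →
      (fun s => s ^ n * k s) =o[𝓝[≠] 0] (fun s : ℝ => s ^ 3) → k 0 = 0 := by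
    intro n k hn hk ho
    refine lim k hk ?_
    have h1 : (fun s : ℝ => s ^ n * k s) =o[𝓝[≠] 0] (fun s : ℝ => s ^ n * 1) := by
      refine ho.trans_isBigO ?_
      obtain ⟨m, hm⟩ : ∃ m, 3 = n + m := ⟨3 - n, by omega⟩
      rw [hm]
      have h2 : (fun s : ℝ => s ^ m) =O[𝓝[≠] 0] fun _ => (1 : ℝ) := by
        apply Tendsto.isBigO_one ℝ (c := (0 : ℝ) ^ m)
        exact ((continuous_pow m).tendsto 0).mono_left hne
      simpa [pow_add] using (isBigO_refl (fun s : ℝ => s ^ n) (𝓝[≠] 0)).mul h2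
    refine isLittleO_iff.2 fun ε hε => ?_
    filter_upwards [isLittleO_iff.1 h1 hε, self_mem_nhdsWithin] with s hs hs0
    have hs0' : (0 : ℝ) < ‖s ^ n‖ := norm_pos_iff.2 (pow_ne_zero n hs0)
    rw [norm_mul, norm_mul, mul_left_comm] at hs
    exact le_of_mul_le_mul_left hs hs0'
  replace h := h.mono hne
  have ha : a = 0 := by
    have := step 0 (fun s => a + b * s + c * s ^ 2 + d * s ^ 3) (by norm_num) (by fun_prop)
      (by simpa using h)
    simpa using this
  subst ha
  have hb : b = 0 := by
    have := step 1 (fun s => b + c * s + d * s ^ 2) (by norm_num) (by fun_prop)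
      (by convert h using 2; ring)
    simpa using this
  subst hb
  have hc : c = 0 := by
    have := step 2 (fun s => c + d * s) (by norm_num) (by fun_prop)
      (by convert h using 2; ring)
    simpa using this
  subst hc
  have hd : d = 0 := by
    have := step 3 (fun s => d) (by norm_num) (by fun_prop)
      (by convert h using 2; ring)
    simpa using this
  exact ⟨rfl, rfl, rfl, hd⟩

theorem hasDerivAt_comp_line (p h : E) (s : ℝ) (hf : DifferentiableAt ℝ f (p + s • h)) :
    HasDerivAt (fun s : ℝ => f (p + s • h)) (pd h f (p + s • h)) s := by
  have h1 : HasDerivAt (fun s : ℝ => p + s • h) h s := by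
    simpa using ((hasDerivAt_id s).smul_const h).const_add p
  exact hf.hasFDerivAt.comp_hasDerivAt s h1

/-- Along the line s ↦ p + s h, f is its cubic Taylor polynomial up to o(s³), so that polynomial is
itself o(s³) and its coefficients vanish. The expansion starts from the definition of the derivative
of ∂_h²f, which has remainder o(s); each of two integrations raises the order of the remainder by
one. -/
theorem pd_line_eq_zero_of_isLittleO {p : E} (hf : ContDiffAt ℝ ∞ f p)
    (ho : f =o[𝓝 p] fun q => ‖q - p‖ ^ 3) (h : E) :
    f p = 0 ∧ pd h f p = 0 ∧ pd h (pd h f) p = 0 ∧ pd h (pd h (pd h f)) p = 0 := by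
  have hline : Tendsto (fun s : ℝ => p + s • h) (𝓝 0) (𝓝 p) := by
    have : ContinuousAt (fun s : ℝ => p + s • h) 0 := by fun_prop
    simpa [ContinuousAt] using this
  have hf1 := contDiffAt_pd hf h
  have hf2 := contDiffAt_pd hf1 h
  obtain ⟨r, hr, hball⟩ := Metric.eventually_nhds_iff_ball.1
    (hline.eventually ((eventually_differentiableAt hf).and (eventually_differentiableAt hf1)))
  have hconv : Convex ℝ (Metric.ball (0 : ℝ) r) := convex_ball 0 r
  have h0 : (0 : ℝ) ∈ Metric.ball (0 : ℝ) r := Metric.mem_ball_self hr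
  have hnhds : 𝓝[Metric.ball (0 : ℝ) r] 0 = 𝓝 0 :=
    nhdsWithin_eq_nhds.2 (Metric.ball_mem_nhds 0 hr)
  set a0 := f p
  set a1 := pd h f p with ha1
  set a2 := pd h (pd h f) p with ha2
  set a3 := pd h (pd h (pd h f)) p with ha3
  have e2 : (fun s : ℝ => pd h (pd h f) (p + s • h) - a2 - a3 * s) =o[𝓝 0]
      fun s => (s - 0) ^ 1 := by
    have hd := hasDerivAt_comp_line p h 0 (f := pd h (pd h f))
      (by simpa using differentiableAt_of_smooth hf2)
    have := hd.isLittleO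
    simp only [zero_smul, add_zero] at this
    refine (this.congr_left fun s => ?_).congr_right fun s => ?_
    · simp [ha2, ha3]; ring
    · simp
  have e1 : (fun s : ℝ => pd h f (p + s • h) - a1 - a2 * s - a3 / 2 * s ^ 2) =o[𝓝 0]
      fun s => (s - 0) ^ 2 := by
    have := hconv.isLittleO_pow_succ_real h0 (n := 1)
      (f := fun s : ℝ => pd h f (p + s • h) - a1 - a2 * s - a3 / 2 * s ^ 2)
      (f' := fun s : ℝ => pd h (pd h f) (p + s • h) - a2 - a3 * s) ?_ (by rwa [hnhds])
    · rw [hnhds] at this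
      simpa [ha1] using this
    · intro s hs
      have hd := hasDerivAt_comp_line p h s (hball s hs).2
      have := ((hd.sub_const a1).sub ((hasDerivAt_id s).const_mul a2)).sub
        (((hasDerivAt_id s).pow 2).const_mul (a3 / 2))
      refine (this.congr_deriv ?_).hasDerivWithinAt
      simp; ring
  have e0 : (fun s : ℝ => f (p + s • h) - a0 - a1 * s - a2 / 2 * s ^ 2 - a3 / 6 * s ^ 3)
      =o[𝓝 0] fun s => (s - 0) ^ 3 := by
    have := hconv.isLittleO_pow_succ_real h0 (n := 2)
      (f := fun s : ℝ => f (p + s • h) - a0 - a1 * s - a2 / 2 * s ^ 2 - a3 / 6 * s ^ 3)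
      (f' := fun s : ℝ => pd h f (p + s • h) - a1 - a2 * s - a3 / 2 * s ^ 2) ?_
      (by rwa [hnhds])
    · rw [hnhds] at this
      simpa [a0] using this
    · intro s hs
      have hd := hasDerivAt_comp_line p h s (hball s hs).1
      have := (((hd.sub_const a0).sub ((hasDerivAt_id s).const_mul a1)).sub
        (((hasDerivAt_id s).pow 2).const_mul (a2 / 2))).sub
        (((hasDerivAt_id s).pow 3).const_mul (a3 / 6))
      refine (this.congr_deriv ?_).hasDerivWithinAt
      simp; ring
  have e : (fun s : ℝ => f (p + s • h)) =o[𝓝 0] fun s : ℝ => s ^ 3 := by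
    have h1 := ho.comp_tendsto hline
    refine h1.trans_isBigO (IsBigO.of_bound (‖h‖ ^ 3) (Eventually.of_forall fun s => ?_))
    simp [norm_smul, mul_pow, mul_comm]
  have e' := e.sub (e0.congr_right fun s => by simp)
  obtain ⟨h1, h2, h3, h4⟩ := cubic_coeff_eq_zero (a := a0) (b := a1) (c := a2 / 2) (d := a3 / 6)
    (e'.congr_left fun s => by ring)
  exact ⟨h1, h2, by linarith, by linarith⟩

/-- A smooth function that is `o(‖q - p‖³)` has vanishing derivatives of third order at `p`. -/
theorem pd_pd_pd_eq_zero_of_isLittleO {p : E} (hf : ContDiffAt ℝ ∞ f p)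
    (ho : f =o[𝓝 p] fun q => ‖q - p‖ ^ 3) (e d : E) : pd e (pd d (pd d f)) p = 0 := by
  have h := fun k => (pd_line_eq_zero_of_isLittleO hf ho k).2.2.2
  have sm := fun a => contDiffAt_pd hf a
  have sm2 := fun a b => contDiffAt_pd (sm a) b
  have expand : ∀ (a b : E) (c : ℝ), pd (a + c • b) (pd (a + c • b) (pd (a + c • b) f)) p =
      pd a (pd a (pd a f)) p + 3 * c * pd b (pd a (pd a f)) p + 3 * c ^ 2 * pd a (pd b (pd b f)) p
        + c ^ 3 * pd b (pd b (pd b f)) p := by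
    intro a b c
    have dir : ∀ k : E → ℝ, pd (a + c • b) k = fun q => pd a k q + c * pd b k q := by
      intro k; rw [pd_add_dir, pd_smul_dir]
    have lin : ∀ (k l : E → ℝ), ContDiffAt ℝ ∞ k p → ContDiffAt ℝ ∞ l p → ∀ e : E,
        pd e (fun q => k q + c * l q) =ᶠ[𝓝 p] fun q => pd e k q + c * pd e l q := by
      intro k l hk hl e
      filter_upwards [eventually_differentiableAt hk, eventually_differentiableAt hl] with q h1 h2
      rw [pd_add h1 (h2.const_mul c), pd_const_mul c h2]
    have s1 := lin _ _ (sm a) (sm b) (a + c • b)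
    have s2 : pd (a + c • b) (fun q => pd a f q + c * pd b f q) =ᶠ[𝓝 p] fun q =>
        (pd a (pd a f) q + c * (2 * pd b (pd a f) q)) + c * (c * pd b (pd b f) q) := by
      filter_upwards [s1, pd_comm_eventually hf a b] with q h1 h2
      rw [h1, dir, dir]
      simp only [h2]
      ring
    have d1 := differentiableAt_of_smooth (sm2 a a)
    have d2 := differentiableAt_of_smooth (sm2 a b)
    have d3 := differentiableAt_of_smooth (sm2 b b)
    have out : ∀ k : E, pd k (fun q => (pd a (pd a f) q + c * (2 * pd b (pd a f) q))
        + c * (c * pd b (pd b f) q)) p = pd k (pd a (pd a f)) p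
          + c * (2 * pd k (pd b (pd a f)) p) + c * (c * pd k (pd b (pd b f)) p) := by
      intro k
      rw [pd_add (d1.fun_add ((d2.const_mul 2).const_mul c)) ((d3.const_mul c).const_mul c),
        pd_add d1 ((d2.const_mul 2).const_mul c), pd_const_mul c (d2.const_mul 2),
        pd_const_mul 2 d2, pd_const_mul c (d3.const_mul c), pd_const_mul c d3]
    have c1 : pd a (pd b (pd a f)) p = pd b (pd a (pd a f)) p := pd_comm (sm a)
    have c2 : pd b (pd b (pd a f)) p = pd a (pd b (pd b f)) p := by
      rw [pd_congr (pd_comm_eventually hf b a) b, pd_comm (sm b)]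
    rw [dir f, pd_congr s2, dir]
    simp only [out, c1, c2]
    ring
  -- Polarisation: the cubic form k ↦ ∂_k³f(p) vanishes identically, and adding its values at e + d
  -- and e − d isolates 6 ∂_e∂_d∂_d f(p).
  have h1 := expand e d 1
  have h2 := expand e d (-1)
  rw [h] at h1 h2
  rw [h e, h d] at h1 h2
  linarith

end Partial

theorem pd_et (f : Base → ℝ) : pd ((1, 0, 0) : Base) f = Dt f := rfl
theorem pd_ex (f : Base → ℝ) : pd ((0, 1, 0) : Base) f = Dx f := rfl
theorem pd_ey (f : Base → ℝ) : pd ((0, 0, 1) : Base) f = Dy f := rfl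

/-! ### The system at a point, cubic increments and the symbol -/

section System

variable {f g : Base → ℝ} {p : Base}

theorem contDiffAt_lap (hf : ContDiffAt ℝ ∞ f p) : ContDiffAt ℝ ∞ (lap f) p :=
  (contDiffAt_pd (contDiffAt_pd hf _) _).add (contDiffAt_pd (contDiffAt_pd hf _) _)

theorem pd_lap (hf : ContDiffAt ℝ ∞ f p) (e : Base) :
    pd e (lap f) p = pd e (Dx (Dx f)) p + pd e (Dy (Dy f)) p :=
  pd_add (differentiableAt_of_smooth (contDiffAt_pd (contDiffAt_pd hf _) _))
    (differentiableAt_of_smooth (contDiffAt_pd (contDiffAt_pd hf _) _))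

theorem pd_y_coord (c : ℝ) (e : Base) : pd e (fun q : Base => c * q.2.2) p = c * e.2.2 := by
  have h : HasFDerivAt (fun q : Base => q.2.2)
      ((ContinuousLinearMap.snd ℝ ℝ ℝ).comp (ContinuousLinearMap.snd ℝ ℝ (ℝ × ℝ))) p :=
    ((ContinuousLinearMap.snd ℝ ℝ ℝ).comp (ContinuousLinearMap.snd ℝ ℝ (ℝ × ℝ))).hasFDerivAt
  rw [pd_const_mul c h.differentiableAt, pd, h.fderiv]
  rfl

theorem pd_Qplus (β : ℝ) (hf : ContDiffAt ℝ ∞ f p) (e : Base) :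
    pd e (Qplus β f) p = pd e (lap f) p + 2 * β * e.2.2 := by
  rw [← pd_y_coord (p := p)]
  exact pd_add (differentiableAt_of_smooth (contDiffAt_lap hf)) (by fun_prop)

theorem pd_Qminus (F : ℝ) (hf : ContDiffAt ℝ ∞ f p) (e : Base) :
    pd e (Qminus F f) p = pd e (lap f) p - 2 * F * pd e f p := by
  have h := differentiableAt_of_smooth hf
  rw [← pd_const_mul (2 * F) h]
  exact pd_sub (differentiableAt_of_smooth (contDiffAt_lap hf)) (h.const_mul _)

/-- The system at a point in terms of the derivatives of the stream functions and of their
Laplacians. -/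
theorem systemAt_iff {F β : ℝ} {ψm ψp : Base → ℝ} (hm : ContDiffAt ℝ ∞ ψm p)
    (hp : ContDiffAt ℝ ∞ ψp p) :
    SystemAt F β ψm ψp p ↔
      Dt (lap ψp) p + (1 / 2) * (Dx ψp p * (Dy (lap ψp) p + 2 * β) - Dy ψp p * Dx (lap ψp) p
        + (Dx ψm p * Dy (lap ψm) p - Dy ψm p * Dx (lap ψm) p)) = 0 ∧
      Dt (lap ψm) p - 2 * F * Dt ψm p
        + (1 / 2) * (Dx ψp p * (Dy (lap ψm) p - 2 * F * Dy ψm p)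
          - Dy ψp p * (Dx (lap ψm) p - 2 * F * Dx ψm p)
          + (Dx ψm p * (Dy (lap ψp) p + 2 * β) - Dy ψm p * Dx (lap ψp) p)) = 0 := by
  have P := fun e => pd_Qplus β hp e
  have M := fun e => pd_Qminus F hm e
  have pt := P (1, 0, 0)
  have px := P (0, 1, 0)
  have py := P (0, 0, 1)
  have mt := M (1, 0, 0)
  have mx := M (0, 1, 0)
  have my := M (0, 0, 1)
  simp only [pd_et, pd_ex, pd_ey] at pt px py mt mx my
  simp only [SystemAt, bracket, pt, px, py, mt, mx, my]
  constructor <;> rintro ⟨h1, h2⟩ <;> constructor <;> linarith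

/-- The product of three linear forms, centred at `p`. -/
def cubic (l₁ l₂ l₃ : Base →L[ℝ] ℝ) (p q : Base) : ℝ := l₁ (q - p) * l₂ (q - p) * l₃ (q - p)

/-- The inner product of the spatial parts of two covectors. -/
def spatialDot (l m : Base →L[ℝ] ℝ) : ℝ := l (0, 1, 0) * m (0, 1, 0) + l (0, 0, 1) * m (0, 0, 1)

/-- The differential of the Laplacian of the product of three linear forms. -/
def cubicLap (l₁ l₂ l₃ : Base →L[ℝ] ℝ) : Base →L[ℝ] ℝ :=
  (2 * spatialDot l₁ l₂) • l₃ + (2 * spatialDot l₁ l₃) • l₂ + (2 * spatialDot l₂ l₃) • l₁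

theorem contDiff_cubic (l₁ l₂ l₃ : Base →L[ℝ] ℝ) (p : Base) :
    ContDiff ℝ ∞ (cubic l₁ l₂ l₃ p) := by
  unfold cubic; fun_prop

theorem pd_pd_pd_cubic (l₁ l₂ l₃ : Base →L[ℝ] ℝ) (p d e q : Base) :
    pd e (pd d (pd d (cubic l₁ l₂ l₃ p))) q =
      2 * (l₁ d * l₂ d * l₃ e + l₁ d * l₃ d * l₂ e + l₂ d * l₃ d * l₁ e) := by
  have lin : ∀ (l : Base →L[ℝ] ℝ) (q : Base), DifferentiableAt ℝ (fun q => l (q - p)) q :=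
    fun l q => by fun_prop
  have h1 : pd d (cubic l₁ l₂ l₃ p) = fun q => l₁ d * (l₂ (q - p) * l₃ (q - p))
      + (l₂ d * (l₁ (q - p) * l₃ (q - p)) + l₃ d * (l₁ (q - p) * l₂ (q - p))) := by
    funext q
    unfold cubic
    rw [pd_mul ((lin l₁ q).fun_mul (lin l₂ q)) (lin l₃ q), pd_mul (lin l₁ q) (lin l₂ q), pd_clm,
      pd_clm, pd_clm]
    ring
  have quad : ∀ (l m : Base →L[ℝ] ℝ) (c : ℝ) (d q : Base),
      pd d (fun q => c * (l (q - p) * m (q - p))) q = c * (l d * m (q - p) + l (q - p) * m d) := by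
    intro l m c d q
    rw [pd_const_mul c ((lin l q).fun_mul (lin m q)), pd_mul (lin l q) (lin m q), pd_clm, pd_clm]
  have h2 : pd d (pd d (cubic l₁ l₂ l₃ p)) = fun q => 2 * l₁ d * l₂ d * l₃ (q - p)
      + (2 * l₁ d * l₃ d * l₂ (q - p) + 2 * l₂ d * l₃ d * l₁ (q - p)) := by
    funext q
    rw [h1, pd_add (by fun_prop) (by fun_prop), pd_add (by fun_prop) (by fun_prop), quad, quad,
      quad]
    ring
  rw [h2, pd_add (by fun_prop) (by fun_prop), pd_add (by fun_prop) (by fun_prop),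
    pd_const_mul _ (lin _ _), pd_const_mul _ (lin _ _), pd_const_mul _ (lin _ _), pd_clm, pd_clm,
    pd_clm]
  ring

theorem pd_cubic_center (l₁ l₂ l₃ : Base →L[ℝ] ℝ) (p e : Base) :
    pd e (cubic l₁ l₂ l₃ p) p = 0 := by
  have lin : ∀ (l : Base →L[ℝ] ℝ) (q : Base), DifferentiableAt ℝ (fun q => l (q - p)) q :=
    fun l q => by fun_prop
  unfold cubic
  rw [pd_mul ((lin l₁ p).fun_mul (lin l₂ p)) (lin l₃ p), pd_mul (lin l₁ p) (lin l₂ p)]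
  simp

theorem pd_lap_cubic (l₁ l₂ l₃ : Base →L[ℝ] ℝ) (p e q : Base) :
    pd e (lap (cubic l₁ l₂ l₃ p)) q = cubicLap l₁ l₂ l₃ e := by
  rw [pd_lap (contDiff_cubic l₁ l₂ l₃ p).contDiffAt, ← pd_ex, ← pd_ex, ← pd_ey, ← pd_ey,
    pd_pd_pd_cubic, pd_pd_pd_cubic]
  simp only [cubicLap, spatialDot, add_apply, smul_apply,
    smul_eq_mul]
  ring

theorem lap_add_eventually (hf : ContDiffAt ℝ ∞ f p) (hg : ContDiffAt ℝ ∞ g p) (c : ℝ) :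
    lap (fun q => f q + c * g q) =ᶠ[𝓝 p] fun q => lap f q + c * lap g q := by
  have lin : ∀ {k l : Base → ℝ}, ContDiffAt ℝ ∞ k p → ContDiffAt ℝ ∞ l p → ∀ e : Base,
      pd e (fun q => k q + c * l q) =ᶠ[𝓝 p] fun q => pd e k q + c * pd e l q := by
    intro k l hk hl e
    filter_upwards [eventually_differentiableAt hk, eventually_differentiableAt hl] with q h1 h2
    rw [pd_add h1 (h2.const_mul c), pd_const_mul c h2]
  have two : ∀ e : Base, pd e (pd e (fun q => f q + c * g q)) =ᶠ[𝓝 p]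
      fun q => pd e (pd e f) q + c * pd e (pd e g) q := fun e =>
    (pd_congr_eventually (lin hf hg e) e).trans
      (lin (contDiffAt_pd hf e) (contDiffAt_pd hg e) e)
  filter_upwards [two (0, 1, 0), two (0, 0, 1)] with q h1 h2
  simp only [pd_ex, pd_ey] at h1 h2
  simp only [lap, h1, h2]
  ring

theorem pd_lap_add (hf : ContDiffAt ℝ ∞ f p) (hg : ContDiffAt ℝ ∞ g p) (c : ℝ) (e : Base) :
    pd e (lap (fun q => f q + c * g q)) p = pd e (lap f) p + c * pd e (lap g) p := by
  have h2 := differentiableAt_of_smooth (contDiffAt_lap hg)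
  rw [pd_congr (lap_add_eventually hf hg c),
    pd_add (differentiableAt_of_smooth (contDiffAt_lap hf)) (h2.const_mul c), pd_const_mul c h2]

/-- The derivatives entering the system of two functions that differ by a cubic form and a
remainder of higher order. -/
theorem jet_of_cubic_difference (hf : ContDiffAt ℝ ∞ f p) (hg : ContDiffAt ℝ ∞ g p)
    (l₁ l₂ l₃ : Base →L[ℝ] ℝ) (c : ℝ)
    (ho : (fun q => g q - (f q + c * cubic l₁ l₂ l₃ p q)) =o[𝓝 p] fun q => ‖q - p‖ ^ 3)
    (e : Base) :
    pd e g p = pd e f p ∧ pd e (lap g) p = pd e (lap f) p + c * cubicLap l₁ l₂ l₃ e := by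
  have hc : ContDiffAt ℝ ∞ (cubic l₁ l₂ l₃ p) p := (contDiff_cubic l₁ l₂ l₃ p).contDiffAt
  have hk : ContDiffAt ℝ ∞ (fun q => f q + c * cubic l₁ l₂ l₃ p q) p :=
    hf.add (contDiffAt_const.mul hc)
  have hr : ContDiffAt ℝ ∞ (fun q => g q - (f q + c * cubic l₁ l₂ l₃ p q)) p := hg.sub hk
  have hr1 := (pd_line_eq_zero_of_isLittleO hr ho e).2.1
  have hr3 : pd e (lap (fun q => g q - (f q + c * cubic l₁ l₂ l₃ p q))) p = 0 := by
    rw [pd_lap hr, ← pd_ex, ← pd_ex, ← pd_ey, ← pd_ey,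
      pd_pd_pd_eq_zero_of_isLittleO hr ho, pd_pd_pd_eq_zero_of_isLittleO hr ho, add_zero]
  rw [pd_sub (differentiableAt_of_smooth hg) (differentiableAt_of_smooth hk),
    pd_add (differentiableAt_of_smooth hf) ((differentiableAt_of_smooth hc).const_mul c),
    pd_const_mul c (differentiableAt_of_smooth hc), pd_cubic_center] at hr1
  have hsub : (fun q => g q - (f q + c * cubic l₁ l₂ l₃ p q)) =
      fun q => g q + (-1) * (f q + c * cubic l₁ l₂ l₃ p q) := by funext q; ring
  rw [hsub, pd_lap_add hg hk, pd_lap_add hf hc, pd_lap_cubic] at hr3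
  constructor <;> linarith

/-- The symbol of the system at the differentials `gm`, `gp` of the stream functions annihilates
the increment `μ` of the fiber variables in the direction of the covector `θ`. -/
def SymbolVanishes (gm gp θ : Base →L[ℝ] ℝ) (μ : Fiber) : Prop :=
  (θ (1, 0, 0) + 1 / 2 * (gp (0, 1, 0) * θ (0, 0, 1) - gp (0, 0, 1) * θ (0, 1, 0))) * μ.2
    + 1 / 2 * (gm (0, 1, 0) * θ (0, 0, 1) - gm (0, 0, 1) * θ (0, 1, 0)) * μ.1 = 0 ∧
  (θ (1, 0, 0) + 1 / 2 * (gp (0, 1, 0) * θ (0, 0, 1) - gp (0, 0, 1) * θ (0, 1, 0))) * μ.1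
    + 1 / 2 * (gm (0, 1, 0) * θ (0, 0, 1) - gm (0, 0, 1) * θ (0, 1, 0)) * μ.2 = 0

/-- Adding a cubic increment to a solution of the system at a point gives a solution there if and
only if the symbol annihilates the increment. -/
theorem systemAt_iff_symbolVanishes {F β : ℝ} {u v : Base → Fiber} (hu : ContDiffAt ℝ ∞ u p)
    (hv : ContDiffAt ℝ ∞ v p) (l₁ l₂ l₃ : Base →L[ℝ] ℝ) (μ : Fiber)
    (ho : (fun q => v q - (u q + cubic l₁ l₂ l₃ p q • μ)) =o[𝓝 p] fun q => ‖q - p‖ ^ 3)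
    (hsys : SystemAt F β (fun q => (u q).1) (fun q => (u q).2) p) :
    SystemAt F β (fun q => (v q).1) (fun q => (v q).2) p ↔
      SymbolVanishes (fderiv ℝ (fun q => (u q).1) p) (fderiv ℝ (fun q => (u q).2) p)
        (cubicLap l₁ l₂ l₃) μ := by
  have um : ContDiffAt ℝ ∞ (fun q => (u q).1) p := hu.fst
  have up : ContDiffAt ℝ ∞ (fun q => (u q).2) p := hu.snd
  have vm : ContDiffAt ℝ ∞ (fun q => (v q).1) p := hv.fst
  have vp : ContDiffAt ℝ ∞ (fun q => (v q).2) p := hv.snd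
  have om : (fun q => (v q).1 - ((u q).1 + μ.1 * cubic l₁ l₂ l₃ p q)) =o[𝓝 p]
      fun q => ‖q - p‖ ^ 3 := by
    refine (IsBigO.of_bound 1 (Eventually.of_forall fun q => ?_)).trans_isLittleO ho
    have := norm_fst_le (v q - (u q + cubic l₁ l₂ l₃ p q • μ))
    simpa [mul_comm] using this
  have op : (fun q => (v q).2 - ((u q).2 + μ.2 * cubic l₁ l₂ l₃ p q)) =o[𝓝 p]
      fun q => ‖q - p‖ ^ 3 := by
    refine (IsBigO.of_bound 1 (Eventually.of_forall fun q => ?_)).trans_isLittleO ho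
    have := norm_snd_le (v q - (u q + cubic l₁ l₂ l₃ p q • μ))
    simpa [mul_comm] using this
  -- The increment preserves the first derivatives of ψ⁻ and ψ⁺ and shifts the differentials of
  -- their Laplacians by multiples of `cubicLap`. The system is affine in those differentials, so
  -- the two systems differ exactly by the symbol.
  have jm := jet_of_cubic_difference um vm l₁ l₂ l₃ μ.1 om
  have jp := jet_of_cubic_difference up vp l₁ l₂ l₃ μ.2 op
  have mt := jm (1, 0, 0)
  have mx := jm (0, 1, 0)
  have my := jm (0, 0, 1)
  have pt := jp (1, 0, 0)
  have px := jp (0, 1, 0)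
  have py := jp (0, 0, 1)
  simp only [pd_et, pd_ex, pd_ey] at mt mx my pt px py
  rw [systemAt_iff um up] at hsys
  obtain ⟨s1, s2⟩ := hsys
  rw [systemAt_iff vm vp]
  simp only [mt, mx, my, pt, px, py, SymbolVanishes]
  change _ ↔ (_ + 1 / 2 * (Dx (fun q => (u q).2) p * _ - Dy (fun q => (u q).2) p * _)) * _
    + 1 / 2 * (Dx (fun q => (u q).1) p * _ - Dy (fun q => (u q).1) p * _) * _ = 0 ∧
    (_ + 1 / 2 * (Dx (fun q => (u q).2) p * _ - Dy (fun q => (u q).2) p * _)) * _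
    + 1 / 2 * (Dx (fun q => (u q).1) p * _ - Dy (fun q => (u q).1) p * _) * _ = 0
  constructor <;> rintro ⟨h1, h2⟩ <;> constructor <;> linarith

end System

/-! ### How a point transformation acts on cubic increments -/

section Transform

variable {Φ : Total → Total} {u v u' v' : Base → Fiber} {p : Base}

theorem contDiffAt_prolong (hΦ : ContDiffAt ℝ ∞ Φ (p, u p)) (hu : ContDiffAt ℝ ∞ u p) :
    ContDiffAt ℝ ∞ (fun q => Φ (q, u q)) p :=
  ContDiffAt.comp p hΦ (contDiffAt_id.prodMk hu)

/-- Where the new independent variables are independent along the graph of `u`, the transformed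
function exists. -/
theorem exists_transforms (hΦ : ContDiffAt ℝ ∞ Φ (p, u p)) (hu : ContDiffAt ℝ ∞ u p)
    (hdet : (fderiv ℝ (fun q => (Φ (q, u q)).1) p).det ≠ 0) :
    ∃ v, ContDiffAt ℝ ∞ v (Φ (p, u p)).1 ∧ Transforms Φ u v p := by
  have hw := contDiffAt_prolong hΦ hu
  have h1 : ContDiffAt ℝ ∞ (fun q => (Φ (q, u q)).1) p := hw.fst
  set L := (fderiv ℝ (fun q => (Φ (q, u q)).1) p).toContinuousLinearEquivOfDetNeZero hdet with hL
  have hd : HasFDerivAt (fun q => (Φ (q, u q)).1) (L : Base →L[ℝ] Base) p := by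
    rw [hL, ContinuousLinearMap.coe_toContinuousLinearEquivOfDetNeZero]
    exact (h1.differentiableAt (by simp)).hasFDerivAt
  have hs := h1.hasStrictFDerivAt' hd (by simp)
  have hinv : ContDiffAt ℝ ∞ (h1.localInverse hd (by simp)) ((Φ (p, u p)).1) :=
    h1.to_localInverse hd (by simp)
  have happ : h1.localInverse hd (by simp) ((Φ (p, u p)).1) = p :=
    h1.localInverse_apply_image hd (by simp)
  refine ⟨fun q => (Φ (h1.localInverse hd (by simp) q, u (h1.localInverse hd (by simp) q))).2,
    ?_, hdet, ?_⟩
  · have h2 : ContDiffAt ℝ ∞ (fun q => (Φ (q, u q)).2)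
        (h1.localInverse hd (by simp) ((Φ (p, u p)).1)) := by
      rw [happ]; exact hw.snd
    exact ContDiffAt.comp (g := fun q => (Φ (q, u q)).2) (Φ (p, u p)).1 h2 hinv
  · filter_upwards [hs.eventually_left_inverse] with q hq
    have : h1.localInverse hd (by simp) ((Φ (q, u q)).1) = q := hq
    rw [this]

theorem cubic_isBigO (l₁ l₂ l₃ : Base →L[ℝ] ℝ) (p : Base) :
    (fun q => cubic l₁ l₂ l₃ p q) =O[𝓝 p] fun q => ‖q - p‖ ^ 3 := by
  have h : ∀ l : Base →L[ℝ] ℝ, (fun q => l (q - p)) =O[𝓝 p] fun q => ‖q - p‖ :=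
    fun l => (l.isBigO_comp (fun q => q - p) (𝓝 p)).norm_right
  refine (((h l₁).mul (h l₂)).mul (h l₃)).congr_right fun q => ?_
  ring

theorem cubic_self (l₁ l₂ l₃ : Base →L[ℝ] ℝ) (p : Base) : cubic l₁ l₂ l₃ p p = 0 := by
  simp [cubic]

theorem hasFDerivAt_cubic (l₁ l₂ l₃ : Base →L[ℝ] ℝ) (p : Base) :
    HasFDerivAt (cubic l₁ l₂ l₃ p) (0 : Base →L[ℝ] ℝ) p := by
  have h := ((contDiff_cubic l₁ l₂ l₃ p).differentiable (by simp) p).hasFDerivAt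
  have h0 : fderiv ℝ (cubic l₁ l₂ l₃ p) p = 0 :=
    ContinuousLinearMap.ext fun e => pd_cubic_center l₁ l₂ l₃ p e
  rwa [h0] at h

/-- Telescoping: the three factors are replaced one at a time by their linearisations. Each
replacement costs o(‖q − p‖), while the other two factors are O(‖q − p‖). -/
theorem cubic_comp_isLittleO {φ : Base → Base} {A : Base →L[ℝ] Base} (hφ : HasFDerivAt φ A p)
    (m₁ m₂ m₃ : Base →L[ℝ] ℝ) :
    (fun q => cubic m₁ m₂ m₃ (φ p) (φ q) - cubic (m₁.comp A) (m₂.comp A) (m₃.comp A) p q)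
      =o[𝓝 p] fun q => ‖q - p‖ ^ 3 := by
  have hO : ∀ l : Base →L[ℝ] ℝ, (fun q => l (q - p)) =O[𝓝 p] fun q => ‖q - p‖ :=
    fun l => (l.isBigO_comp (fun q => q - p) (𝓝 p)).norm_right
  have hφO : ∀ m : Base →L[ℝ] ℝ, (fun q => m (φ q - φ p)) =O[𝓝 p] fun q => ‖q - p‖ :=
    fun m => ((m.isBigO_comp (fun q => φ q - φ p) (𝓝 p)).trans hφ.isBigO_sub).norm_right
  have ho : ∀ m : Base →L[ℝ] ℝ, (fun q => m (φ q - φ p) - (m.comp A) (q - p)) =o[𝓝 p]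
      fun q => ‖q - p‖ := by
    intro m
    have := (m.isBigO_comp (fun q => φ q - φ p - A (q - p)) (𝓝 p)).trans_isLittleO hφ.isLittleO
    refine this.norm_right.congr_left fun q => ?_
    simp
  have e1 := ((ho m₁).mul_isBigO (hφO m₂)).mul_isBigO (hφO m₃)
  have e2 := ((hO (m₁.comp A)).mul_isLittleO (ho m₂)).mul_isBigO (hφO m₃)
  have e3 := ((hO (m₁.comp A)).mul (hO (m₂.comp A))).mul_isLittleO (ho m₃)
  refine ((e1.add e2).add e3).congr (fun q => ?_) fun q => ?_
  · simp only [cubic]; ring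
  · ring

/-- The effect on the transformed function, up to terms of higher order, of adding a cubic
increment to a function. -/
theorem transform_cubic_difference (hΦ : ContDiffAt ℝ ∞ Φ (p, u p)) (hu : ContDiffAt ℝ ∞ u p)
    (hv : ContDiffAt ℝ ∞ v (Φ (p, u p)).1) (ht : Transforms Φ u v p)
    (m₁ m₂ m₃ : Base →L[ℝ] ℝ) (a : Fiber) (A : Base →L[ℝ] Base)
    (hA : A = fderiv ℝ (fun q => (Φ (q, u q)).1) p)
    (hu' : u' = fun q => u q + cubic (m₁.comp A) (m₂.comp A) (m₃.comp A) p q • a)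
    (ht' : Transforms Φ u' v' p) :
    (fun q => v' q - (v q + cubic m₁ m₂ m₃ (Φ (p, u p)).1 q •
      ((fderiv ℝ Φ (p, u p) (0, a)).2
        - fderiv ℝ v (Φ (p, u p)).1 (fderiv ℝ Φ (p, u p) (0, a)).1)))
      =o[𝓝 (Φ (p, u p)).1] fun q => ‖q - (Φ (p, u p)).1‖ ^ 3 := by
  set D := fderiv ℝ Φ (p, u p) with hD
  set c := cubic (m₁.comp A) (m₂.comp A) (m₃.comp A) p with hc
  set φ : Base → Base := fun q => (Φ (q, u q)).1 with hφdef
  set φ' : Base → Base := fun q => (Φ (q, u' q)).1 with hφ'def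
  have hcO : c =O[𝓝 p] fun q => ‖q - p‖ ^ 3 := cubic_isBigO _ _ _ p
  have hcp : c p = 0 := cubic_self _ _ _ p
  have hup : u' p = u p := by rw [hu']; simp [hcp]
  have hud : HasFDerivAt u (fderiv ℝ u p) p := (hu.differentiableAt (by simp)).hasFDerivAt
  have hud' : HasFDerivAt u' (fderiv ℝ u p) p := by
    have h := hud.add ((hasFDerivAt_cubic (m₁.comp A) (m₂.comp A) (m₃.comp A) p).smul_const a)
    rw [ContinuousLinearMap.zero_smulRight, add_zero] at h
    rw [hu']
    exact h
  have hus' : ContDiffAt ℝ ∞ u' p := by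
    rw [hu']
    exact hu.add ((contDiff_cubic _ _ _ p).contDiffAt.smul contDiffAt_const)
  have hΦs : HasStrictFDerivAt Φ D (p, u p) := hΦ.hasStrictFDerivAt (by simp)
  have hφA : HasFDerivAt φ A p := by
    rw [hA]; exact ((contDiffAt_prolong hΦ hu).fst.differentiableAt (by simp)).hasFDerivAt
  -- The cubic has zero derivative at p, so u and u' have the same first jet there and φ' has the
  -- same differential as φ.
  have hφ'A : HasFDerivAt φ' A p := by
    have hj : HasFDerivAt (fun q => (q, u q))
      ((ContinuousLinearMap.id ℝ Base).prod (fderiv ℝ u p)) p := (hasFDerivAt_id p).prodMk hud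
    have hj' : HasFDerivAt (fun q => (q, u' q))
      ((ContinuousLinearMap.id ℝ Base).prod (fderiv ℝ u p)) p := (hasFDerivAt_id p).prodMk hud'
    have h1 : HasFDerivAt Φ D (p, u p) := hΦs.hasFDerivAt
    have h1' : HasFDerivAt Φ D (p, u' p) := by rw [hup]; exact h1
    have k := (h1.comp p hj).fst
    have k' := (h1'.comp p hj').fst
    rw [hφA.unique k]
    exact k'
  have hφ'p : φ' p = φ p := by simp only [hφ'def, hφdef, hup]
  have hdetA : A.det ≠ 0 := by rw [hA]; exact ht.transversal
  set L := A.toContinuousLinearEquivOfDetNeZero hdetA with hL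
  have hLA : (L : Base →L[ℝ] Base) = A :=
    ContinuousLinearMap.coe_toContinuousLinearEquivOfDetNeZero _ _
  have hφ's : HasStrictFDerivAt φ' (L : Base →L[ℝ] Base) p := by
    rw [hLA]
    have : ContDiffAt ℝ ∞ Φ (p, u' p) := by rw [hup]; exact hΦ
    exact (contDiffAt_prolong this hus').fst.hasStrictFDerivAt' hφ'A (by simp)
  -- φ' is a local diffeomorphism, so an estimate near φ p may be checked after composition with φ'.
  -- The next bound then converts powers of ‖q − p‖ into powers of the displacement in the new
  -- variables.
  have hmap : map φ' (𝓝 p) = 𝓝 (φ p) := by rw [hφ's.map_nhds_eq_of_equiv, hφ'p]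
  have hrev : (fun q => q - p) =O[𝓝 p] fun q => φ' q - φ' p := by
    have h1 := L.isBigO_comp_rev (fun q => q - p) (𝓝 p)
    have h2 := hφ's.hasFDerivAt.isLittleO.trans_isBigO h1
    refine h1.trans (h2.right_isBigO_add.congr_right fun q => ?_)
    simp
  -- Strict differentiability is needed: both points vary with q, and the error must be small
  -- relative to their difference, which is O(‖q − p‖³).
  have hdiff : (fun q => Φ (q, u' q) - Φ (q, u q) - c q • D (0, a)) =o[𝓝 p]
      fun q => ‖q - p‖ ^ 3 := by
    have hlim : Tendsto (fun q => (((q, u' q), (q, u q)) : Total × Total)) (𝓝 p)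
        (𝓝 ((p, u p), (p, u p))) := by
      have h1 : ContinuousAt u' p := hus'.continuousAt
      have h2 : ContinuousAt u p := hu.continuousAt
      have h3 : ContinuousAt (fun q => (((q, u' q), (q, u q)) : Total × Total)) p := by fun_prop
      simpa [ContinuousAt, hup] using h3
    have hinc : ∀ q, ((q, u' q) : Total) - (q, u q) = c q • ((0 : Base), a) := by
      intro q; rw [hu']; simp
    have h := hΦs.isLittleO.comp_tendsto hlim
    refine (h.congr_left fun q => ?_).trans_isBigO ?_
    · simp only [Function.comp]
      rw [hinc, map_smul]
    · refine IsBigO.trans ?_ hcO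
      refine IsBigO.of_bound ‖((0 : Base), a)‖ (Eventually.of_forall fun q => ?_)
      simp only [Function.comp]
      rw [hinc, norm_smul, mul_comm]
  have hd1 : (fun q => φ' q - φ q - c q • (D (0, a)).1) =o[𝓝 p] fun q => ‖q - p‖ ^ 3 := by
    refine (IsBigO.of_bound 1 (Eventually.of_forall fun q => ?_)).trans_isLittleO hdiff
    simpa using norm_fst_le (Φ (q, u' q) - Φ (q, u q) - c q • D (0, a))
  have hd2 : (fun q => (Φ (q, u' q)).2 - (Φ (q, u q)).2 - c q • (D (0, a)).2) =o[𝓝 p]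
      fun q => ‖q - p‖ ^ 3 := by
    refine (IsBigO.of_bound 1 (Eventually.of_forall fun q => ?_)).trans_isLittleO hdiff
    simpa using norm_snd_le (Φ (q, u' q) - Φ (q, u q) - c q • D (0, a))
  set V := fderiv ℝ v (φ p) with hV
  have hvs : HasStrictFDerivAt v V (φ p) := hv.hasStrictFDerivAt (by simp)
  have hφc : ContinuousAt φ p := hφA.continuousAt
  have hφ'c : Tendsto φ' (𝓝 p) (𝓝 (φ p)) := by
    have := hφ'A.continuousAt.tendsto
    rwa [hφ'p] at this
  have hφO : (fun q => φ' q - φ q) =O[𝓝 p] fun q => ‖q - p‖ ^ 3 := by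
    have h1 : (fun q => c q • (D (0, a)).1) =O[𝓝 p] fun q => ‖q - p‖ ^ 3 := by
      refine IsBigO.trans (IsBigO.of_bound ‖(D (0, a)).1‖ (Eventually.of_forall fun q => ?_)) hcO
      rw [norm_smul, mul_comm]
    exact (hd1.isBigO.add h1).congr_left fun q => by abel
  have hv1 : (fun q => v (φ' q) - v (φ q) - c q • V (D (0, a)).1) =o[𝓝 p]
      fun q => ‖q - p‖ ^ 3 := by
    have h1 : (fun q => v (φ' q) - v (φ q) - V (φ' q - φ q)) =o[𝓝 p] fun q => ‖q - p‖ ^ 3 :=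
      (hvs.isLittleO.comp_tendsto (hφ'c.prodMk_nhds hφc.tendsto)).trans_isBigO hφO
    have h2 := (V.isBigO_comp (fun q => φ' q - φ q - c q • (D (0, a)).1) (𝓝 p)).trans_isLittleO hd1
    refine (h1.add h2).congr_left fun q => ?_
    simp only [map_sub, map_smul]
    abel
  have hcub : (fun q => (cubic m₁ m₂ m₃ (φ p) (φ' q) - c q) •
      ((D (0, a)).2 - V (D (0, a)).1)) =o[𝓝 p] fun q => ‖q - p‖ ^ 3 := by
    have h1 := cubic_comp_isLittleO hφ'A m₁ m₂ m₃
    rw [hφ'p] at h1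
    refine IsBigO.trans_isLittleO (IsBigO.of_bound ‖(D (0, a)).2 - V (D (0, a)).1‖
      (Eventually.of_forall fun q => ?_)) h1
    rw [norm_smul, mul_comm]
  rw [← hmap, isLittleO_map]
  have hsum : (fun q => v' (φ' q) - (v (φ' q) + cubic m₁ m₂ m₃ (φ p) (φ' q) •
      ((D (0, a)).2 - V (D (0, a)).1))) =o[𝓝 p] fun q => ‖q - p‖ ^ 3 := by
    refine ((hd2.sub hv1).sub hcub).congr' ?_ EventuallyEq.rfl
    filter_upwards [ht.graph, ht'.graph] with q h1 h2
    have h1' : v (φ q) = (Φ (q, u q)).2 := h1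
    have h2' : v' (φ' q) = (Φ (q, u' q)).2 := h2
    rw [h1', h2']
    module
  refine hsum.trans_isBigO ?_
  have := hrev.norm_norm.pow 3
  rwa [hφ'p] at this

/-- Since the cubic vanishes at p together with its differential, transversality of the graph of u
passes to the perturbed graph, and so the perturbed function also has a transform. -/
theorem transversal_of_cubic (hΦ : ContDiffAt ℝ ∞ Φ (p, u p)) (hu : ContDiffAt ℝ ∞ u p)
    (l₁ l₂ l₃ : Base →L[ℝ] ℝ) (a : Fiber) :
    fderiv ℝ (fun q => (Φ (q, u q + cubic l₁ l₂ l₃ p q • a)).1) p =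
      fderiv ℝ (fun q => (Φ (q, u q)).1) p := by
  have hud : HasFDerivAt u (fderiv ℝ u p) p := (hu.differentiableAt (by simp)).hasFDerivAt
  have hud' : HasFDerivAt (fun q => u q + cubic l₁ l₂ l₃ p q • a) (fderiv ℝ u p) p := by
    have h := hud.add ((hasFDerivAt_cubic l₁ l₂ l₃ p).smul_const a)
    rw [ContinuousLinearMap.zero_smulRight, add_zero] at h
    exact h
  have h1 : HasFDerivAt Φ (fderiv ℝ Φ (p, u p)) (p, u p) :=
    (hΦ.differentiableAt (by simp)).hasFDerivAt
  have h1' : HasFDerivAt Φ (fderiv ℝ Φ (p, u p)) (p, u p + cubic l₁ l₂ l₃ p p • a) := by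
    simpa [cubic_self] using h1
  have k := (h1.comp p ((hasFDerivAt_id p).prodMk hud)).fst
  have k' := (HasFDerivAt.comp p h1' ((hasFDerivAt_id p).prodMk hud')).fst
  exact k'.fderiv.trans k.fderiv.symm

/-- A point symmetry maps cubic increments annihilated by the symbol to cubic increments
annihilated by the symbol. -/
theorem IsPointSymmetry.symbolVanishes {F β : ℝ} {Ω : Set Total} (hΩ : IsOpen Ω)
    (hsym : IsPointSymmetry F β Ω Φ) (hu : ContDiffAt ℝ ∞ u p) (hmem : (p, u p) ∈ Ω)
    (hsys : SystemAt F β (fun q => (u q).1) (fun q => (u q).2) p)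
    (hv : ContDiffAt ℝ ∞ v (Φ (p, u p)).1) (ht : Transforms Φ u v p)
    (m₁ m₂ m₃ : Base →L[ℝ] ℝ) (a : Fiber) (A : Base →L[ℝ] Base)
    (hA : A = fderiv ℝ (fun q => (Φ (q, u q)).1) p)
    (hsymb : SymbolVanishes (fderiv ℝ (fun q => (u q).1) p) (fderiv ℝ (fun q => (u q).2) p)
      (cubicLap (m₁.comp A) (m₂.comp A) (m₃.comp A)) a) :
    SymbolVanishes (fderiv ℝ (fun q => (v q).1) (Φ (p, u p)).1)
      (fderiv ℝ (fun q => (v q).2) (Φ (p, u p)).1) (cubicLap m₁ m₂ m₃)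
      ((fderiv ℝ Φ (p, u p) (0, a)).2
        - fderiv ℝ v (Φ (p, u p)).1 (fderiv ℝ Φ (p, u p) (0, a)).1) := by
  have hΦ : ContDiffAt ℝ ∞ Φ (p, u p) :=
    hsym.pointTransformation.smooth.contDiffAt (hΩ.mem_nhds hmem)
  obtain ⟨u', hu'⟩ : ∃ u', u' = fun q => u q + cubic (m₁.comp A) (m₂.comp A) (m₃.comp A) p q • a :=
    ⟨_, rfl⟩
  have hup : u' p = u p := by rw [hu']; simp [cubic_self]
  have hus' : ContDiffAt ℝ ∞ u' p := by
    rw [hu']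
    exact hu.add ((contDiff_cubic _ _ _ p).contDiffAt.smul contDiffAt_const)
  have hdet' : (fderiv ℝ (fun q => (Φ (q, u' q)).1) p).det ≠ 0 := by
    rw [hu', transversal_of_cubic hΦ hu]
    exact ht.transversal
  obtain ⟨v', hv', ht'⟩ := exists_transforms (u := u') (by rw [hup]; exact hΦ) hus' hdet'
  have hsys' : SystemAt F β (fun q => (u' q).1) (fun q => (u' q).2) p := by
    refine (systemAt_iff_symbolVanishes hu hus' _ _ _ a ?_ hsys).2 hsymb
    refine (isLittleO_zero _ _).congr_left fun q => ?_
    rw [hu']; simp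
  have hmem' : (p, u' p) ∈ Ω := by rw [hup]; exact hmem
  have s := hsym.preserves u v p hu hmem hv ht hsys
  have s' := hsym.preserves u' v' p hus' hmem' hv' ht' hsys'
  rw [hup] at s' hv'
  exact (systemAt_iff_symbolVanishes hv hv' m₁ m₂ m₃ _
    (transform_cubic_difference hΦ hu hv ht m₁ m₂ m₃ a A hA hu' ht') s).1 s'

end Transform

/-! ### Realising first-order jets on the system -/

section Jets

theorem pd_eq_of_hasDerivAt {E : Type*} [NormedAddCommGroup E] [NormedSpace ℝ E] {f : E → ℝ}
    {q e : E} {d : ℝ} (hf : DifferentiableAt ℝ f q)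
    (h : HasDerivAt (fun s : ℝ => f (q + s • e)) d 0) : pd e f q = d := by
  have := hasDerivAt_comp_line q e 0 (f := f) (by simpa using hf)
  simpa using this.unique h

/-- A polynomial with prescribed value, gradient, second `x`-derivative and `t`-derivative of the
Laplacian at `p`. -/
def jetPoly (p : Base) (s a₁ a₂ a₃ a₄ c : ℝ) (q : Base) : ℝ :=
  s + a₁ * (q.1 - p.1) + a₂ * (q.2.1 - p.2.1) + a₃ * (q.2.2 - p.2.2)
    + a₄ / 2 * (q.2.1 - p.2.1) ^ 2 + c / 2 * (q.1 - p.1) * (q.2.1 - p.2.1) ^ 2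

variable (p : Base) (s a₁ a₂ a₃ a₄ c : ℝ)

theorem contDiff_jetPoly : ContDiff ℝ ∞ (jetPoly p s a₁ a₂ a₃ a₄ c) := by
  unfold jetPoly; fun_prop

theorem pd_jetPoly (e q : Base) : pd e (jetPoly p s a₁ a₂ a₃ a₄ c) q =
    (a₁ + c / 2 * (q.2.1 - p.2.1) ^ 2) * e.1
      + (a₂ + a₄ * (q.2.1 - p.2.1) + c * (q.1 - p.1) * (q.2.1 - p.2.1)) * e.2.1 + a₃ * e.2.2 := by
  refine pd_eq_of_hasDerivAt ((contDiff_jetPoly p s a₁ a₂ a₃ a₄ c).differentiable (by simp) q) ?_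
  have lin : ∀ x k y : ℝ, HasDerivAt (fun s : ℝ => x + s * k - y) k 0 := fun x k y => by
    simpa using (((hasDerivAt_id (0 : ℝ)).mul_const k).const_add x).sub_const y
  have ht := lin q.1 e.1 p.1
  have hx := lin q.2.1 e.2.1 p.2.1
  have hy := lin q.2.2 e.2.2 p.2.2
  have := ((((ht.const_mul a₁).const_add s).add (hx.const_mul a₂)).add (hy.const_mul a₃)).add
    ((hx.pow 2).const_mul (a₄ / 2)) |>.add ((ht.const_mul (c / 2)).mul (hx.pow 2))
  refine this.congr_deriv ?_
  simp
  ring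

theorem lap_jetPoly : lap (jetPoly p s a₁ a₂ a₃ a₄ c) = fun q => a₄ + c * (q.1 - p.1) := by
  have hx : Dx (jetPoly p s a₁ a₂ a₃ a₄ c) =
      fun q => a₂ + a₄ * (q.2.1 - p.2.1) + c * (q.1 - p.1) * (q.2.1 - p.2.1) := by
    funext q; rw [← pd_ex, pd_jetPoly]; simp
  have hy : Dy (jetPoly p s a₁ a₂ a₃ a₄ c) = fun q => a₃ := by
    funext q; rw [← pd_ey, pd_jetPoly]; simp
  funext q
  rw [lap, hx, hy]
  have h1 : Dx (fun q : Base => a₂ + a₄ * (q.2.1 - p.2.1) + c * (q.1 - p.1) * (q.2.1 - p.2.1)) q =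
      a₄ + c * (q.1 - p.1) := by
    rw [← pd_ex]
    refine pd_eq_of_hasDerivAt (by fun_prop) ?_
    have hx : HasDerivAt (fun s : ℝ => q.2.1 + s * 1 - p.2.1) 1 0 := by
      simpa using ((hasDerivAt_id (0 : ℝ)).const_add q.2.1).sub_const p.2.1
    have := ((hx.const_mul a₄).const_add a₂).add (hx.const_mul (c * (q.1 - p.1)))
    refine (this.congr_deriv (by ring)).congr_of_eventuallyEq (Eventually.of_forall fun s => ?_)
    simp
  have h2 : Dy (fun _ : Base => a₃) q = 0 := by rw [← pd_ey, pd_const]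
  rw [h1, h2, add_zero]

theorem pd_lap_jetPoly (e q : Base) : pd e (lap (jetPoly p s a₁ a₂ a₃ a₄ c)) q = c * e.1 := by
  rw [lap_jetPoly]
  refine pd_eq_of_hasDerivAt (by fun_prop) ?_
  have := ((((hasDerivAt_id (0 : ℝ)).mul_const e.1).const_add q.1).sub_const p.1).const_mul c
    |>.const_add a₄
  refine (this.congr_deriv (by ring)).congr_of_eventuallyEq (Eventually.of_forall fun s => ?_)
  simp

/-- Every first-order jet is the jet of a smooth function satisfying the system at the point, and
the Laplacians may be prescribed. -/
theorem exists_jet (F β : ℝ) (p : Base) (s : Fiber) (L : Base →L[ℝ] Fiber) (a₄ b₄ : ℝ) :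
    ∃ um up : Base → ℝ, ContDiff ℝ ∞ um ∧ ContDiff ℝ ∞ up ∧ um p = s.1 ∧ up p = s.2 ∧
      SystemAt F β um up p ∧ (∀ e, pd e um p = (L e).1) ∧ (∀ e, pd e up p = (L e).2) ∧
      lap um p = a₄ ∧ lap up p = b₄ ∧
      (∀ e, pd e (lap um) p = (2 * F * (L (1, 0, 0)).1 + F * ((L (0, 1, 0)).2 * (L (0, 0, 1)).1
        - (L (0, 0, 1)).2 * (L (0, 1, 0)).1) - β * (L (0, 1, 0)).1) * e.1) ∧
      (∀ e, pd e (lap up) p = -β * (L (0, 1, 0)).2 * e.1) := by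
  have hL : ∀ e : Base, L e = e.1 • L (1, 0, 0) + e.2.1 • L (0, 1, 0) + e.2.2 • L (0, 0, 1) := by
    intro e
    rw [← map_smul, ← map_smul, ← map_smul, ← map_add, ← map_add]
    simp
  -- `cm` and `cp` are the values of ∂_tΔψ⁻ and ∂_tΔψ⁺ that the two equations force when the spatial
  -- derivatives of both Laplacians vanish.
  set cm := 2 * F * (L (1, 0, 0)).1 + F * ((L (0, 1, 0)).2 * (L (0, 0, 1)).1
        - (L (0, 0, 1)).2 * (L (0, 1, 0)).1) - β * (L (0, 1, 0)).1 with hcm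
  set cp := -β * (L (0, 1, 0)).2 with hcp
  have hm := contDiff_jetPoly p s.1 (L (1, 0, 0)).1 (L (0, 1, 0)).1 (L (0, 0, 1)).1 a₄ cm
  have hp := contDiff_jetPoly p s.2 (L (1, 0, 0)).2 (L (0, 1, 0)).2 (L (0, 0, 1)).2 b₄ cp
  refine ⟨_, _, hm, hp, by simp [jetPoly], by simp [jetPoly], ?_, ?_, ?_, ?_, ?_, ?_, ?_⟩
  · rw [systemAt_iff hm.contDiffAt hp.contDiffAt]
    simp only [← pd_et, ← pd_ex, ← pd_ey, pd_lap_jetPoly, pd_jetPoly]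
    simp only [hcm, hcp, sub_self]
    constructor <;> ring
  · intro e; rw [pd_jetPoly, hL e]; simp; ring
  · intro e; rw [pd_jetPoly, hL e]; simp; ring
  · rw [lap_jetPoly]; simp
  · rw [lap_jetPoly]; simp
  · intro e; rw [pd_lap_jetPoly]
  · intro e; rw [pd_lap_jetPoly]

end Jets

/-! ### The symbol condition as linear algebra at a point -/

section LinearSymbol

variable {F β : ℝ} {Ω : Set Total} {Φ : Total → Total} {p : Base} {s : Fiber}

/-- The linear-algebraic content of the invariance of the top-order part of the system, at a point
`(p, s)` and for the first-order jet `L`; here `V` is the first-order jet of the transformed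
function. -/
theorem IsPointSymmetry.linear_symbol (hΩ : IsOpen Ω) (hsym : IsPointSymmetry F β Ω Φ)
    (hmem : (p, s) ∈ Ω) (L : Base →L[ℝ] Fiber) (A : Base →L[ℝ] Base)
    (hA : ∀ h, A h = (fderiv ℝ Φ (p, s) (h, L h)).1) (hdet : A.det ≠ 0) :
    ∃ V : Base →L[ℝ] Fiber, (∀ h, V (A h) = (fderiv ℝ Φ (p, s) (h, L h)).2) ∧
      ∀ (m₁ m₂ m₃ : Base →L[ℝ] ℝ) (a : Fiber),
        SymbolVanishes ((ContinuousLinearMap.fst ℝ ℝ ℝ).comp L)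
          ((ContinuousLinearMap.snd ℝ ℝ ℝ).comp L)
          (cubicLap (m₁.comp A) (m₂.comp A) (m₃.comp A)) a →
        SymbolVanishes ((ContinuousLinearMap.fst ℝ ℝ ℝ).comp V)
          ((ContinuousLinearMap.snd ℝ ℝ ℝ).comp V) (cubicLap m₁ m₂ m₃)
          ((fderiv ℝ Φ (p, s) (0, a)).2 - V (fderiv ℝ Φ (p, s) (0, a)).1) := by
  obtain ⟨um, up, hum, hup, hums, hups, hsys, hLm, hLp, -⟩ := exists_jet F β p s L 0 0
  obtain ⟨u, hu⟩ : ∃ u : Base → Fiber, u = fun q => (um q, up q) := ⟨_, rfl⟩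
  have hus : ContDiff ℝ ∞ u := by rw [hu]; exact hum.prodMk hup
  have hups : u p = s := by rw [hu]; exact Prod.ext hums hups
  subst hups
  have hdm : fderiv ℝ (fun q => (u q).1) p = (ContinuousLinearMap.fst ℝ ℝ ℝ).comp L := by
    rw [hu]; exact ContinuousLinearMap.ext hLm
  have hdp : fderiv ℝ (fun q => (u q).2) p = (ContinuousLinearMap.snd ℝ ℝ ℝ).comp L := by
    rw [hu]; exact ContinuousLinearMap.ext hLp
  have hud : HasFDerivAt u L p := by
    have h := (hus.differentiable (by simp) p).hasFDerivAt
    have e1 := h.fst.fderiv.symm.trans hdm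
    have e2 := h.snd.fderiv.symm.trans hdp
    have : fderiv ℝ u p = L := ContinuousLinearMap.ext fun e =>
      Prod.ext (DFunLike.congr_fun e1 e) (DFunLike.congr_fun e2 e)
    rwa [this] at h
  have hΦ : ContDiffAt ℝ ∞ Φ (p, u p) :=
    hsym.pointTransformation.smooth.contDiffAt (hΩ.mem_nhds hmem)
  have hw : HasFDerivAt (fun q => Φ (q, u q))
      ((fderiv ℝ Φ (p, u p)).comp ((ContinuousLinearMap.id ℝ Base).prod L)) p :=
    (hΦ.differentiableAt (by simp)).hasFDerivAt.comp p ((hasFDerivAt_id p).prodMk hud)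
  have hAd : HasFDerivAt (fun q => (Φ (q, u q)).1) A p := by
    have : A = (ContinuousLinearMap.fst ℝ Base Fiber).comp
        ((fderiv ℝ Φ (p, u p)).comp ((ContinuousLinearMap.id ℝ Base).prod L)) :=
      ContinuousLinearMap.ext hA
    rw [this]
    exact hw.fst
  obtain ⟨v, hv, ht⟩ := exists_transforms hΦ hus.contDiffAt (by rw [hAd.fderiv]; exact hdet)
  have hvd : HasFDerivAt v (fderiv ℝ v (Φ (p, u p)).1) (Φ (p, u p)).1 :=
    (hv.differentiableAt (by simp)).hasFDerivAt
  refine ⟨fderiv ℝ v (Φ (p, u p)).1, fun h => ?_, fun m₁ m₂ m₃ a hs => ?_⟩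
  · have h1 : HasFDerivAt (fun q => v (Φ (q, u q)).1) _ p :=
      HasFDerivAt.comp (f := fun q => (Φ (q, u q)).1) p hvd hAd
    have h2 := h1.congr_of_eventuallyEq (ht.graph.mono fun q hq => hq.symm)
    exact DFunLike.congr_fun (h2.unique hw.snd) h
  · have key := hsym.symbolVanishes hΩ hus.contDiffAt hmem (by rw [hu]; exact hsys) hv ht m₁ m₂ m₃ a
      A hAd.fderiv.symm (by rw [hdm, hdp]; exact hs)
    rwa [hvd.fst.fderiv, hvd.snd.fderiv] at key

theorem det_ne_zero_of_injective {E : Type*} [NormedAddCommGroup E] [NormedSpace ℝ E]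
    [FiniteDimensional ℝ E] {A : E →L[ℝ] E} (h : ∀ x, A x = 0 → x = 0) : A.det ≠ 0 := by
  intro h0
  have := LinearMap.bot_lt_ker_of_det_eq_zero h0
  rw [bot_lt_iff_ne_bot, Ne, LinearMap.ker_eq_bot'] at this
  exact this h

/-- The effect of a point transformation on cubic increments is surjective. -/
theorem exists_increment {D : Total →L[ℝ] Total} (hD : D.det ≠ 0) {L V : Base →L[ℝ] Fiber}
    (hV : ∀ h, V (D (h, L h)).1 = (D (h, L h)).2) (μ : Fiber) :
    ∃ a : Fiber, (D (0, a)).2 - V (D (0, a)).1 = μ := by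
  obtain ⟨⟨h, s⟩, hh⟩ := (D.toContinuousLinearEquivOfDetNeZero hD).surjective (0, μ)
  rw [ContinuousLinearMap.toContinuousLinearEquivOfDetNeZero_apply] at hh
  -- (h, s) is the preimage of (0, μ). Subtracting the graph vector (h, L h) leaves a vertical
  -- vector and costs nothing, because V sends the base part of D (h, L h) to its fiber part.
  refine ⟨s - L h, ?_⟩
  have e : D (0, s - L h) = (0, μ) - D (h, L h) := by
    rw [← hh, ← map_sub]; simp
  rw [e]
  simp [hV]

end LinearSymbol

/-! ### The alternative for the new time at a nondegenerate jet -/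

section TimeVariable

variable {F β : ℝ} {Ω : Set Total} {Φ : Total → Total} {p : Base} {s : Fiber}

theorem clm_base_apply {G : Type*} [NormedAddCommGroup G] [NormedSpace ℝ G] (m : Base →L[ℝ] G)
    (e : Base) : m e = e.1 • m (1, 0, 0) + e.2.1 • m (0, 1, 0) + e.2.2 • m (0, 0, 1) := by
  rw [← map_smul, ← map_smul, ← map_smul, ← map_add, ← map_add]
  simp

theorem clm_total_apply {G : Type*} [NormedAddCommGroup G] [NormedSpace ℝ G] (m : Total →L[ℝ] G)
    (e : Base) (f : Fiber) : m (e, f) = e.1 • m ((1, 0, 0), (0, 0)) + e.2.1 • m ((0, 1, 0), (0, 0))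
      + e.2.2 • m ((0, 0, 1), (0, 0)) + f.1 • m ((0, 0, 0), (1, 0))
      + f.2 • m ((0, 0, 0), (0, 1)) := by
  rw [← map_smul, ← map_smul, ← map_smul, ← map_smul, ← map_smul, ← map_add, ← map_add, ← map_add,
    ← map_add]
  congr 1
  ext <;> simp

/-- The Jacobian determinant of three vectors in the base. -/
def jac (a b c : Base) : ℝ :=
  a.1 * (b.2.1 * c.2.2 - b.2.2 * c.2.1) + a.2.1 * (b.2.2 * c.1 - b.1 * c.2.2)
    + a.2.2 * (b.1 * c.2.1 - b.2.1 * c.1)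

theorem det_ne_zero_of_jac {A : Base →L[ℝ] Base}
    (h : jac (A (1, 0, 0)) (A (0, 1, 0)) (A (0, 0, 1)) ≠ 0) : A.det ≠ 0 := by
  refine det_ne_zero_of_injective fun x hx => ?_
  rw [clm_base_apply] at hx
  simp only [Prod.ext_iff, Prod.fst_add, Prod.snd_add, Prod.smul_fst, Prod.smul_snd, smul_eq_mul,
    Prod.fst_zero, Prod.snd_zero] at hx
  obtain ⟨h1, h2, h3⟩ := hx
  unfold jac at h
  set a := A (1, 0, 0)
  set b := A (0, 1, 0)
  set c := A (0, 0, 1)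
  have k1 : x.1 = 0 := by
    refine (mul_eq_zero.1 ?_).resolve_left h
    linear_combination (b.2.1 * c.2.2 - b.2.2 * c.2.1) * h1 + (b.2.2 * c.1 - b.1 * c.2.2) * h2
      + (b.1 * c.2.1 - b.2.1 * c.1) * h3
  have k2 : x.2.1 = 0 := by
    refine (mul_eq_zero.1 ?_).resolve_left h
    linear_combination (a.2.2 * c.2.1 - a.2.1 * c.2.2) * h1 + (a.1 * c.2.2 - a.2.2 * c.1) * h2
      + (a.2.1 * c.1 - a.1 * c.2.1) * h3
  have k3 : x.2.2 = 0 := by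
    refine (mul_eq_zero.1 ?_).resolve_left h
    linear_combination (a.2.1 * b.2.2 - a.2.2 * b.2.1) * h1 + (a.2.2 * b.1 - a.1 * b.2.2) * h2
      + (a.1 * b.2.1 - a.2.1 * b.1) * h3
  exact Prod.ext k1 (Prod.ext k2 k3)

/-- The linear map `Base → Fiber` with the given values on the coordinate vectors. -/
def jetMap (f₁ f₂ f₃ : Fiber) : Base →L[ℝ] Fiber :=
  (ContinuousLinearMap.fst ℝ ℝ (ℝ × ℝ)).smulRight f₁
    + ((ContinuousLinearMap.fst ℝ ℝ ℝ).comp (ContinuousLinearMap.snd ℝ ℝ (ℝ × ℝ))).smulRight f₂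
    + ((ContinuousLinearMap.snd ℝ ℝ ℝ).comp (ContinuousLinearMap.snd ℝ ℝ (ℝ × ℝ))).smulRight f₃

theorem jetMap_apply (f₁ f₂ f₃ : Fiber) (e : Base) :
    jetMap f₁ f₂ f₃ e = e.1 • f₁ + e.2.1 • f₂ + e.2.2 • f₃ := rfl

/-- The restriction to the graph of `L` of the base component of a linear map. -/
def graphBase (D : Total →L[ℝ] Total) (L : Base →L[ℝ] Fiber) : Base →L[ℝ] Base :=
  (ContinuousLinearMap.fst ℝ Base Fiber).comp (D.comp ((ContinuousLinearMap.id ℝ Base).prod L))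

theorem graphBase_apply (D : Total →L[ℝ] Total) (L : Base →L[ℝ] Fiber) (h : Base) :
    graphBase D L h = (D (h, L h)).1 := rfl

theorem cubicLap_self (m : Base →L[ℝ] ℝ) : cubicLap m m m = (6 * spatialDot m m) • m := by
  unfold cubicLap
  module

/-- Here (α, b, c) is the covector m in the new variables that pulls back to dt, and g, h are the
gradients of the transformed ψ⁻, ψ⁺. The symbol of m³ carries the factor 6(b² + c²). If it vanishes,
dt is a multiple of the differential of the new time, so the new time has no spatial total
derivatives. Otherwise it cancels, and the remaining transport conditions on m turn into brackets.
-/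
theorem time_alternative_algebra {dt dx dy : Base} {xA xB yA yB α b c g₁ g₂ g₃ h₁ h₂ h₃ : ℝ}
    (hjac : jac dt dx dy ≠ 0)
    (mt : dt.1 * α + dt.2.1 * b + dt.2.2 * c = 1)
    (mx : dx.1 * α + dx.2.1 * b + dx.2.2 * c = 0)
    (my : dy.1 * α + dy.2.1 * b + dy.2.2 * c = 0)
    (VxA : dx.1 * g₁ + dx.2.1 * g₂ + dx.2.2 * g₃ = xA)
    (VxB : dx.1 * h₁ + dx.2.1 * h₂ + dx.2.2 * h₃ = xB)
    (VyA : dy.1 * g₁ + dy.2.1 * g₂ + dy.2.2 * g₃ = yA)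
    (VyB : dy.1 * h₁ + dy.2.1 * h₂ + dy.2.2 * h₃ = yB)
    (k1 : (6 * (b * b + c * c) * α + 1 / 2 * (h₂ * (6 * (b * b + c * c) * c)
        - h₃ * (6 * (b * b + c * c) * b))) * 1
      + 1 / 2 * (g₂ * (6 * (b * b + c * c) * c) - g₃ * (6 * (b * b + c * c) * b)) * 0 = 0)
    (k2 : (6 * (b * b + c * c) * α + 1 / 2 * (h₂ * (6 * (b * b + c * c) * c)
        - h₃ * (6 * (b * b + c * c) * b))) * 0
      + 1 / 2 * (g₂ * (6 * (b * b + c * c) * c) - g₃ * (6 * (b * b + c * c) * b)) * 1 = 0) :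
    (dx.1 = 0 ∧ dy.1 = 0) ∨
      (dx.2.1 * dy.2.2 - dx.2.2 * dy.2.1 + 1 / 2 * (dx.1 * yB - xB * dy.1) = 0 ∧
        dx.1 * yA - xA * dy.1 = 0) := by
  obtain ⟨tT, tX, tY⟩ := dt
  obtain ⟨xT, xX, xY⟩ := dx
  obtain ⟨yT, yX, yY⟩ := dy
  simp only [jac] at *
  by_cases hk : b * b + c * c = 0
  · left
    have hb : b = 0 := by nlinarith [mul_self_nonneg b, mul_self_nonneg c]
    have hc : c = 0 := by nlinarith [mul_self_nonneg b, mul_self_nonneg c]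
    subst hb hc
    have hα : α ≠ 0 := by rintro rfl; simp at mt
    constructor
    · exact (mul_eq_zero.1 (by linarith : xT * α = 0)).resolve_right hα
    · exact (mul_eq_zero.1 (by linarith : yT * α = 0)).resolve_right hα
  · right
    have n0 : α + 1 / 2 * (h₂ * c - h₃ * b) = 0 := by
      refine (mul_eq_zero.1 ?_).resolve_left hk
      linear_combination 1 / 6 * k1
    have n1 : g₂ * c - g₃ * b = 0 := by
      refine (mul_eq_zero.1 ?_).resolve_left hk
      linear_combination 1 / 3 * k2
    have hJ : ∃ J, J = tT * (xX * yY - xY * yX) + tX * (xY * yT - xT * yY)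
      + tY * (xT * yX - xX * yT) := ⟨_, rfl⟩
    obtain ⟨J, hJ⟩ := hJ
    -- Cramer's rule for `mt`, `mx`, `my`: J times m is the vector of cofactors formed from dx and
    -- dy.
    have c1 : J * α = xX * yY - xY * yX := by
      rw [hJ]
      linear_combination (xX * yY - xY * yX) * mt - (tX * yY - tY * yX) * mx
        + (tX * xY - tY * xX) * my
    have c2 : J * b = xY * yT - xT * yY := by
      rw [hJ]
      linear_combination (xY * yT - xT * yY) * mt - (tY * yT - tT * yY) * mx
        + (tY * xT - tT * xY) * my
    have c3 : J * c = xT * yX - xX * yT := by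
      rw [hJ]
      linear_combination (xT * yX - xX * yT) * mt - (tT * yX - tX * yT) * mx
        + (tT * xX - tX * xT) * my
    constructor
    · linear_combination J * n0 - c1 - 1 / 2 * h₂ * c3 + 1 / 2 * h₃ * c2
        + 1 / 2 * yT * VxB - 1 / 2 * xT * VyB
    · linear_combination J * n1 - g₂ * c3 + g₃ * c2 + yT * VxA - xT * VyA

/-- At each nondegenerate jet either the spatial total derivatives of the new time vanish or two
total Poisson brackets do. -/
theorem IsPointSymmetry.time_alternative (hΩ : IsOpen Ω) (hsym : IsPointSymmetry F β Ω Φ)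
    (hmem : (p, s) ∈ Ω) {D : Total →L[ℝ] Total} (hD : D = fderiv ℝ Φ (p, s))
    {f₁ f₂ f₃ : Fiber} {dt dx dy : Total} (hdt : dt = D ((1, 0, 0), f₁))
    (hdx : dx = D ((0, 1, 0), f₂)) (hdy : dy = D ((0, 0, 1), f₃))
    (hjac : jac dt.1 dx.1 dy.1 ≠ 0) :
    (dx.1.1 = 0 ∧ dy.1.1 = 0) ∨
      (dx.1.2.1 * dy.1.2.2 - dx.1.2.2 * dy.1.2.1
          + 1 / 2 * (dx.1.1 * dy.2.2 - dx.2.2 * dy.1.1) = 0 ∧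
        dx.1.1 * dy.2.1 - dx.2.1 * dy.1.1 = 0) := by
  have hDdet : D.det ≠ 0 := by rw [hD]; exact hsym.pointTransformation.jacobian _ hmem
  set L := jetMap f₁ f₂ f₃ with hL
  have Lt : L (1, 0, 0) = f₁ := by simp [hL, jetMap_apply]
  have Lx : L (0, 1, 0) = f₂ := by simp [hL, jetMap_apply]
  have Ly : L (0, 0, 1) = f₃ := by simp [hL, jetMap_apply]
  have At : graphBase D L (1, 0, 0) = dt.1 := by rw [graphBase_apply, Lt, hdt]
  have Ax : graphBase D L (0, 1, 0) = dx.1 := by rw [graphBase_apply, Lx, hdx]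
  have Ay : graphBase D L (0, 0, 1) = dy.1 := by rw [graphBase_apply, Ly, hdy]
  have hdet : (graphBase D L).det ≠ 0 := det_ne_zero_of_jac (by rwa [At, Ax, Ay])
  obtain ⟨V, hV, hsymb⟩ := hsym.linear_symbol hΩ hmem L (graphBase D L)
    (fun h => by rw [graphBase_apply, hD]) hdet
  rw [← hD] at hV hsymb
  set E := (graphBase D L).toContinuousLinearEquivOfDetNeZero hdet with hE
  -- m pulls back to dt, whose cube has zero Laplacian, so the hypothesis of `hsymb` holds for every
  -- a. Since the increments μ fill the whole fiber, the symbol of m³ on the new side must vanish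
  -- identically.
  set m : Base →L[ℝ] ℝ := (ContinuousLinearMap.fst ℝ ℝ (ℝ × ℝ)).comp (E.symm : Base →L[ℝ] Base)
    with hm
  have hmA : m.comp (graphBase D L) = ContinuousLinearMap.fst ℝ ℝ (ℝ × ℝ) := by
    refine ContinuousLinearMap.ext fun h => ?_
    have : E.symm (graphBase D L h) = h := by
      rw [← ContinuousLinearMap.toContinuousLinearEquivOfDetNeZero_apply _ hdet]
      exact E.symm_apply_apply h
    simp [hm, this]
  have key : ∀ μ : Fiber, SymbolVanishes ((ContinuousLinearMap.fst ℝ ℝ ℝ).comp V)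
      ((ContinuousLinearMap.snd ℝ ℝ ℝ).comp V) (cubicLap m m m) μ := by
    intro μ
    obtain ⟨a, ha⟩ := exists_increment hDdet (L := L) (V := V) (fun h => hV h) μ
    rw [← ha]
    refine hsymb m m m a ?_
    rw [hmA, cubicLap_self]
    simp [SymbolVanishes, spatialDot]
  obtain ⟨k1, k2⟩ := key (0, 1)
  have Vx := hV (0, 1, 0)
  have Vy := hV (0, 0, 1)
  rw [Ax, Lx, ← hdx, clm_base_apply] at Vx
  rw [Ay, Ly, ← hdy, clm_base_apply] at Vy
  simp only [Prod.ext_iff, Prod.fst_add, Prod.snd_add, Prod.smul_fst, Prod.smul_snd,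
    smul_eq_mul] at Vx Vy
  have mt : m dt.1 = 1 := by rw [← At]; exact DFunLike.congr_fun hmA (1, 0, 0)
  have mx : m dx.1 = 0 := by rw [← Ax]; exact DFunLike.congr_fun hmA (0, 1, 0)
  have my : m dy.1 = 0 := by rw [← Ay]; exact DFunLike.congr_fun hmA (0, 0, 1)
  rw [clm_base_apply] at mt mx my
  simp only [smul_eq_mul] at mt mx my
  rw [cubicLap_self] at k1 k2
  exact time_alternative_algebra hjac mt mx my Vx.1 Vx.2 Vy.1 Vy.2 k1 k2

end TimeVariable

/-! ### The new time depends on the old time only -/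

section TimeVariable

/-- The ring of real analytic functions has no zero divisors. -/
theorem eq_zero_or_eq_zero_of_mul_eq_zero {E : Type*} [NormedAddCommGroup E] [NormedSpace ℝ E]
    {f g : E → ℝ} (hf : ContDiff ℝ ω f) (hg : ContDiff ℝ ω g) (h : ∀ w, f w * g w = 0) :
    (∀ w, f w = 0) ∨ ∀ w, g w = 0 := by
  by_cases hz : ∀ w, f w = 0
  · exact Or.inl hz
  · right
    push Not at hz
    obtain ⟨w, hw⟩ := hz
    have hne : ∀ᶠ q in 𝓝 w, f q ≠ 0 := hf.continuous.continuousAt.eventually_ne hw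
    have hgz : g =ᶠ[𝓝 w] fun _ => 0 := by
      filter_upwards [hne] with q hq
      exact (mul_eq_zero.1 (h q)).resolve_left hq
    have := (hg.analyticOnNhd (s := Set.univ)).eq_of_eventuallyEq
      ((contDiff_const (c := (0 : ℝ))).analyticOnNhd) hgz
    exact fun q => congrFun this q

/-- The base part of D has five columns. By multilinearity in the fiber arguments, the vanishing of
the determinant on all graphs makes each of the ten 3×3 minors vanish, so the determinant is zero on
arbitrary triples of vectors. -/
theorem jac_total_apply (D : Total →L[ℝ] Total) (e₁ e₂ e₃ : Base) (g₁ g₂ g₃ : Fiber)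
    (h : ∀ f₁ f₂ f₃ : Fiber, jac (D ((1, 0, 0), f₁)).1 (D ((0, 1, 0), f₂)).1
      (D ((0, 0, 1), f₃)).1 = 0) :
    jac (D (e₁, g₁)).1 (D (e₂, g₂)).1 (D (e₃, g₃)).1 = 0 := by
  have expand : ∀ (e : Base) (f : Fiber), (D (e, f)).1 =
      e.1 • (D ((1, 0, 0), (0, 0))).1 + e.2.1 • (D ((0, 1, 0), (0, 0))).1
      + e.2.2 • (D ((0, 0, 1), (0, 0))).1 + f.1 • (D ((0, 0, 0), (1, 0))).1
      + f.2 • (D ((0, 0, 0), (0, 1))).1 := by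
    intro e f
    rw [clm_total_apply D e f]; rfl
  generalize (D ((1, 0, 0), (0, 0))).1 = t at expand
  generalize (D ((0, 1, 0), (0, 0))).1 = x at expand
  generalize (D ((0, 0, 1), (0, 0))).1 = y at expand
  generalize (D ((0, 0, 0), (1, 0))).1 = m at expand
  generalize (D ((0, 0, 0), (0, 1))).1 = n at expand
  have add₁ : ∀ a b c d : Base, jac (a + b) c d = jac a c d + jac b c d := by
    intro a b c d; simp only [jac, Prod.fst_add, Prod.snd_add]; ring
  have add₂ : ∀ a b c d : Base, jac c (a + b) d = jac c a d + jac c b d := by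
    intro a b c d; simp only [jac, Prod.fst_add, Prod.snd_add]; ring
  have add₃ : ∀ a b c d : Base, jac c d (a + b) = jac c d a + jac c d b := by
    intro a b c d; simp only [jac, Prod.fst_add, Prod.snd_add]; ring
  have smul₁ : ∀ (r : ℝ) (a b c : Base), jac (r • a) b c = r * jac a b c := by
    intro r a b c; simp only [jac, Prod.smul_fst, Prod.smul_snd, smul_eq_mul]; ring
  have smul₂ : ∀ (r : ℝ) (a b c : Base), jac a (r • b) c = r * jac a b c := by
    intro r a b c; simp only [jac, Prod.smul_fst, Prod.smul_snd, smul_eq_mul]; ring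
  have smul₃ : ∀ (r : ℝ) (a b c : Base), jac a b (r • c) = r * jac a b c := by
    intro r a b c; simp only [jac, Prod.smul_fst, Prod.smul_snd, smul_eq_mul]; ring
  have swap₁ : ∀ a b c : Base, jac a b c = -jac b a c := by
    intro a b c; simp only [jac]; ring
  have swap₂ : ∀ a b c : Base, jac a b c = -jac a c b := by
    intro a b c; simp only [jac]; ring
  have alt₁ : ∀ a b : Base, jac a a b = 0 := by intro a b; simp only [jac]; ring
  have alt₂ : ∀ a b : Base, jac a b b = 0 := by intro a b; simp only [jac]; ring
  have alt₃ : ∀ a b : Base, jac a b a = 0 := by intro a b; simp only [jac]; ring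
  simp only [expand, one_smul, zero_smul, add_zero, zero_add, add₁, add₂, add₃, smul₁, smul₂,
    smul₃] at h
  have txy : jac t x y = 0 := by simpa using h 0 0 0
  have txm : jac t x m = 0 := by simpa [txy] using h 0 0 (1, 0)
  have txn : jac t x n = 0 := by simpa [txy] using h 0 0 (0, 1)
  have tmy : jac t m y = 0 := by simpa [txy] using h 0 (1, 0) 0
  have tny : jac t n y = 0 := by simpa [txy] using h 0 (0, 1) 0
  have mxy : jac m x y = 0 := by simpa [txy] using h (1, 0) 0 0
  have nxy : jac n x y = 0 := by simpa [txy] using h (0, 1) 0 0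
  have tmn : jac t m n = 0 := by simpa [txy, txm, txn, tmy, tny] using h 0 (1, 0) (0, 1)
  have mxn : jac m x n = 0 := by simpa [txy, txm, txn, mxy, nxy] using h (1, 0) 0 (0, 1)
  have mny : jac m n y = 0 := by simpa [txy, tmy, tny, mxy, nxy] using h (1, 0) (0, 1) 0
  have p1 : ∀ {a b c : Base}, jac a b c = 0 → jac b a c = 0 ∧ jac a c b = 0 ∧ jac c b a = 0 ∧
      jac b c a = 0 ∧ jac c a b = 0 := by
    intro a b c h
    simp only [jac] at *
    refine ⟨?_, ?_, ?_, ?_, ?_⟩ <;> linarith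
  simp only [expand, add₁, add₂, add₃, smul₁, smul₂, smul₃, alt₁, alt₂, alt₃, txy, p1 txy, txm,
    p1 txm, txn, p1 txn, tmy, p1 tmy, tny, p1 tny, mxy, p1 mxy, nxy, p1 nxy, tmn, p1 tmn, mxn,
    p1 mxn, mny, p1 mny, mul_zero, add_zero]

/-- An invertible D attains the three coordinate vectors of the base, whose determinant is 1.
Nondegenerate first-order jets therefore exist at every point. -/
theorem exists_jac_ne_zero {D : Total →L[ℝ] Total} (hD : D.det ≠ 0) :
    ∃ f₁ f₂ f₃ : Fiber, jac (D ((1, 0, 0), f₁)).1 (D ((0, 1, 0), f₂)).1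
      (D ((0, 0, 1), f₃)).1 ≠ 0 := by
  by_contra! h
  have hs : ∀ e : Total, ∃ z, D z = e := fun e => by
    obtain ⟨z, hz⟩ := (D.toContinuousLinearEquivOfDetNeZero hD).surjective e
    exact ⟨z, hz⟩
  obtain ⟨⟨a, a'⟩, ha⟩ := hs ((1, 0, 0), 0)
  obtain ⟨⟨b, b'⟩, hb⟩ := hs ((0, 1, 0), 0)
  obtain ⟨⟨c, c'⟩, hc⟩ := hs ((0, 0, 1), 0)
  have := jac_total_apply D a b c a' b' c' h
  rw [ha, hb, hc] at this
  simp [jac] at this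

/-- A bilinear alternating form that vanishes on spatial graphs vanishes on spatial vectors. -/
theorem wedge_eq_zero {wd : Total → Total → ℝ} (hadd : ∀ a b c, wd (a + b) c = wd a c + wd b c)
    (hsmul : ∀ (r : ℝ) a b, wd (r • a) b = r * wd a b) (hswap : ∀ a b, wd a b = -wd b a)
    (h : ∀ f g : Fiber, wd ((0, 1, 0), f) ((0, 0, 1), g) = 0) {a b : Total} (ha : a.1.1 = 0)
    (hb : b.1.1 = 0) : wd a b = 0 := by
  have hadd' : ∀ a b c, wd c (a + b) = wd c a + wd c b := by
    intro a b c; rw [hswap, hadd, hswap a, hswap b]; ring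
  have hsmul' : ∀ (r : ℝ) a b, wd b (r • a) = r * wd b a := by
    intro r a b; rw [hswap, hsmul, hswap a]; ring
  have halt : ∀ a, wd a a = 0 := fun a => by have := hswap a a; linarith
  have hf : ∀ f : Fiber, (((0, 1, 0), f) : Total) = ((0, 1, 0), 0) + ((0, 0, 0), f) := by
    intro f; simp
  have hg : ∀ f : Fiber, (((0, 0, 1), f) : Total) = ((0, 0, 1), 0) + ((0, 0, 0), f) := by
    intro f; simp
  have xy := h 0 0
  have xg : ∀ g : Fiber, wd ((0, 1, 0), 0) ((0, 0, 0), g) = 0 := by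
    intro g
    have := h 0 g
    rw [hg g, hadd', xy, zero_add] at this
    exact this
  have fy : ∀ f : Fiber, wd ((0, 0, 0), f) ((0, 0, 1), 0) = 0 := by
    intro f
    have := h f 0
    rw [hf f, hadd, xy, zero_add] at this
    exact this
  have fg : ∀ f g : Fiber, wd ((0, 0, 0), f) ((0, 0, 0), g) = 0 := by
    intro f g
    have := h f g
    rw [hf f, hg g, hadd, hadd', hadd', xy, xg, fy] at this
    linarith
  have expand : ∀ a : Total, a.1.1 = 0 → a = a.1.2.1 • (((0, 1, 0), 0) : Total)
      + a.1.2.2 • (((0, 0, 1), 0) : Total) + (((0, 0, 0), a.2) : Total) := by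
    rintro ⟨⟨t, x, y⟩, f⟩ rfl
    ext <;> simp
  rw [expand a ha, expand b hb]
  simp only [hadd, hadd', hsmul, hsmul', xy, xg, fy, fg, halt, hswap ((0, 0, 1), 0) _,
    hswap ((0, 0, 0), _) ((0, 1, 0), 0)]
  simp

variable {F β : ℝ} {Ω : Set Total} {Φ : Total → Total} {z : Total}

/-- Under a point symmetry the new time depends on the old time only. -/
theorem IsPointSymmetry.time_eq_zero (hΩ : IsOpen Ω) (hsym : IsPointSymmetry F β Ω Φ)
    (hz : z ∈ Ω) {e : Total} (he : e.1.1 = 0) : (fderiv ℝ Φ z e).1.1 = 0 := by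
  obtain ⟨p, s⟩ := z
  have hDdet := hsym.pointTransformation.jacobian _ hz
  have alt := fun f₁ f₂ f₃ => hsym.time_alternative hΩ hz rfl (f₁ := f₁) (f₂ := f₂) (f₃ := f₃)
    rfl rfl rfl
  set D := fderiv ℝ Φ (p, s) with hD
  set J : Fiber × Fiber × Fiber → ℝ := fun w => jac (D ((1, 0, 0), w.1)).1
    (D ((0, 1, 0), w.2.1)).1 (D ((0, 0, 1), w.2.2)).1 with hJ
  set P : Fiber × Fiber × Fiber → ℝ := fun w =>
    (D ((0, 1, 0), w.2.1)).1.2.1 * (D ((0, 0, 1), w.2.2)).1.2.2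
      - (D ((0, 1, 0), w.2.1)).1.2.2 * (D ((0, 0, 1), w.2.2)).1.2.1
      + 1 / 2 * ((D ((0, 1, 0), w.2.1)).1.1 * (D ((0, 0, 1), w.2.2)).2.2
        - (D ((0, 1, 0), w.2.1)).2.2 * (D ((0, 0, 1), w.2.2)).1.1) with hP
  set Q : Fiber × Fiber × Fiber → ℝ := fun w =>
    (D ((0, 1, 0), w.2.1)).1.1 * (D ((0, 0, 1), w.2.2)).2.1
        - (D ((0, 1, 0), w.2.1)).2.1 * (D ((0, 0, 1), w.2.2)).1.1 with hQ
  set X : Fiber × Fiber × Fiber → ℝ := fun w => (D ((0, 1, 0), w.2.1)).1.1 with hX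
  set Y : Fiber × Fiber × Fiber → ℝ := fun w => (D ((0, 0, 1), w.2.2)).1.1 with hY
  have sJ : ContDiff ℝ ω J := by simp only [hJ, jac]; fun_prop
  have sP : ContDiff ℝ ω P := by simp only [hP]; fun_prop
  have sQ : ContDiff ℝ ω Q := by simp only [hQ]; fun_prop
  have sX : ContDiff ℝ ω X := by simp only [hX]; fun_prop
  have sY : ContDiff ℝ ω Y := by simp only [hY]; fun_prop
  have alt' : ∀ w, J w = 0 ∨ (X w = 0 ∧ Y w = 0) ∨ (P w = 0 ∧ Q w = 0) := by
    intro w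
    by_cases h : J w = 0
    · exact Or.inl h
    · exact Or.inr (alt w.1 w.2.1 w.2.2 h)
  have hJ0 : ¬ ∀ w, J w = 0 := by
    obtain ⟨f₁, f₂, f₃, h⟩ := exists_jac_ne_zero hDdet
    exact fun h' => h (h' (f₁, f₂, f₃))
  -- The alternative may depend on the jet, but all expressions are polynomial in the jet
  -- coordinates and J is not identically zero. Absence of zero divisors makes one branch hold for
  -- all jets at once.
  have prod : ∀ {f g : Fiber × Fiber × Fiber → ℝ}, ContDiff ℝ ω f → ContDiff ℝ ω g →
      (∀ w, J w * (f w * g w) = 0) → (∀ w, f w = 0) ∨ ∀ w, g w = 0 := by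
    intro f g hf hg h
    exact eq_zero_or_eq_zero_of_mul_eq_zero hf hg
      ((eq_zero_or_eq_zero_of_mul_eq_zero sJ (hf.mul hg) h).resolve_left hJ0)
  have XP := prod sX sP fun w => by rcases alt' w with h | ⟨h, -⟩ | ⟨h, -⟩ <;> simp [h]
  have XQ := prod sX sQ fun w => by rcases alt' w with h | ⟨h, -⟩ | ⟨-, h⟩ <;> simp [h]
  have YP := prod sY sP fun w => by rcases alt' w with h | ⟨-, h⟩ | ⟨h, -⟩ <;> simp [h]
  have YQ := prod sY sQ fun w => by rcases alt' w with h | ⟨-, h⟩ | ⟨-, h⟩ <;> simp [h]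
  have cases : ((∀ w, X w = 0) ∧ ∀ w, Y w = 0) ∨ ((∀ w, P w = 0) ∧ ∀ w, Q w = 0) := by tauto
  rcases cases with ⟨hx, hy⟩ | ⟨hp, hq⟩
  · have x0 := hx 0
    have xf : ∀ f : Fiber, (D ((0, 0, 0), f)).1.1 = 0 := by
      intro f
      have h1 := hx (0, f, 0)
      have e1 : (((0, 1, 0), f) : Total) = ((0, 1, 0), 0) + ((0, 0, 0), f) := by simp
      simp only [hX] at x0 h1
      rw [e1, map_add] at h1
      have : (D ((0, 1, 0), 0)).1.1 + (D ((0, 0, 0), f)).1.1 = 0 := h1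
      have x0' : (D ((0, 1, 0), 0)).1.1 = 0 := x0
      linarith
    have y0 := hy 0
    have e1 : e = e.1.2.1 • (((0, 1, 0), 0) : Total) + e.1.2.2 • (((0, 0, 1), 0) : Total)
        + (((0, 0, 0), e.2) : Total) := by
      obtain ⟨⟨t, x, y⟩, f⟩ := e
      have : t = 0 := he
      subst this
      ext <;> simp
    have x0' : (D ((0, 1, 0), 0)).1.1 = 0 := x0
    have y0' : (D ((0, 0, 1), 0)).1.1 = 0 := y0
    rw [e1, map_add, map_add, map_smul, map_smul]
    simp only [Prod.fst_add, Prod.smul_fst, x0', y0', xf, smul_zero, add_zero]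
  -- In this branch both alternating forms vanish on the hyperplane of vectors without t-component.
  · have wP : ∀ a b : Total, a.1.1 = 0 → b.1.1 = 0 →
        (D a).1.2.1 * (D b).1.2.2 - (D a).1.2.2 * (D b).1.2.1
          + 1 / 2 * ((D a).1.1 * (D b).2.2 - (D a).2.2 * (D b).1.1) = 0 := by
      intro a b ha hb
      refine wedge_eq_zero (wd := fun a b => (D a).1.2.1 * (D b).1.2.2 - (D a).1.2.2 * (D b).1.2.1
          + 1 / 2 * ((D a).1.1 * (D b).2.2 - (D a).2.2 * (D b).1.1)) ?_ ?_ ?_ ?_ ha hb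
      · intro a b c; simp only [map_add, Prod.fst_add, Prod.snd_add]; ring
      · intro r a b; simp only [map_smul, Prod.smul_fst, Prod.smul_snd, smul_eq_mul]; ring
      · intro a b; ring
      · intro f g; exact hp (0, f, g)
    have wQ : ∀ a b : Total, a.1.1 = 0 → b.1.1 = 0 →
        (D a).1.1 * (D b).2.1 - (D a).2.1 * (D b).1.1 = 0 := by
      intro a b ha hb
      refine wedge_eq_zero (wd := fun a b => (D a).1.1 * (D b).2.1 - (D a).2.1 * (D b).1.1)
        ?_ ?_ ?_ ?_ ha hb
      · intro a b c; simp only [map_add, Prod.fst_add, Prod.snd_add]; ring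
      · intro r a b; simp only [map_smul, Prod.smul_fst, Prod.smul_snd, smul_eq_mul]; ring
      · intro a b; ring
      · intro f g; exact hq (0, f, g)
    have hs : ∀ e : Total, ∃ z, D z = e := fun e => by
      obtain ⟨z, hz⟩ := (D.toContinuousLinearEquivOfDetNeZero hDdet).surjective e
      exact ⟨z, hz⟩
    by_contra hne
    set τ : Total := ((1, 0, 0), 0) with hτ
    have split : ∀ z : Total, ∃ b : Total, b.1.1 = 0 ∧ z = z.1.1 • τ + b := by
      intro z
      refine ⟨z - z.1.1 • τ, by simp [hτ], by abel⟩
    have r1 : ∀ z : Total, (D e).1.1 * (D z).2.1 - (D e).2.1 * (D z).1.1 =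
        z.1.1 * ((D e).1.1 * (D τ).2.1 - (D e).2.1 * (D τ).1.1) := by
      intro z
      obtain ⟨b, hb, hz⟩ := split z
      have h := wQ e b he hb
      have hDz : D z = z.1.1 • D τ + D b := by rw [← map_smul, ← map_add, ← hz]
      rw [hDz]
      simp only [Prod.fst_add, Prod.snd_add, Prod.smul_fst, Prod.smul_snd, smul_eq_mul]
      linear_combination h
    have r2 : ∀ z : Total, (D e).1.2.1 * (D z).1.2.2 - (D e).1.2.2 * (D z).1.2.1
          + 1 / 2 * ((D e).1.1 * (D z).2.2 - (D e).2.2 * (D z).1.1) =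
        z.1.1 * ((D e).1.2.1 * (D τ).1.2.2 - (D e).1.2.2 * (D τ).1.2.1
          + 1 / 2 * ((D e).1.1 * (D τ).2.2 - (D e).2.2 * (D τ).1.1)) := by
      intro z
      obtain ⟨b, hb, hz⟩ := split z
      have h := wP e b he hb
      have hDz : D z = z.1.1 • D τ + D b := by rw [← map_smul, ← map_add, ← hz]
      rw [hDz]
      simp only [Prod.fst_add, Prod.snd_add, Prod.smul_fst, Prod.smul_snd, smul_eq_mul]
      linear_combination h
    -- By `r1` and `r2`, both forms contracted with e are multiples of dt. On the preimages a, b of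
    -- the two fiber coordinate vectors they take the values (T_e, 0) and (0, T_e/2), where T_e is
    -- the time component of D e. For T_e ≠ 0 these are independent covectors, so they cannot both
    -- be multiples of dt.
    obtain ⟨a, ha⟩ := hs (0, (1, 0))
    obtain ⟨b, hb⟩ := hs (0, (0, 1))
    have a1 := r1 a
    have a2 := r2 a
    have b1 := r1 b
    rw [ha] at a1 a2
    rw [hb] at b1
    simp only [Prod.fst_zero, Prod.snd_zero, mul_zero, mul_one, sub_zero, add_zero] at a1 a2 b1
    have b2 := r2 b
    rw [hb] at b2
    simp only [Prod.fst_zero, Prod.snd_zero, mul_zero, mul_one, sub_zero,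
      zero_add] at b2
    generalize (D e).1.2.1 * (D τ).1.2.2 - (D e).1.2.2 * (D τ).1.2.1
          + 1 / 2 * ((D e).1.1 * (D τ).2.2 - (D e).2.2 * (D τ).1.1) = c2 at a2 b2
    generalize (D e).1.1 * (D τ).2.1 - (D e).2.1 * (D τ).1.1 = c1 at a1 b1
    rcases mul_eq_zero.1 b1.symm with h | h
    · rw [h, zero_mul] at b2
      exact hne (by linarith)
    · rw [h, mul_zero] at a1
      exact hne a1

end TimeVariable

/-! ### Conformality, and independence of the new base variables from ψ⁻ and ψ⁺ -/

section FirstOrder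

variable {F β : ℝ} {Ω : Set Total} {Φ : Total → Total} {p : Base} {s : Fiber}

theorem exists_comp_eq {A : Base →L[ℝ] Base} (hA : A.det ≠ 0) (l : Base →L[ℝ] ℝ) :
    ∃ m : Base →L[ℝ] ℝ, m.comp A = l := by
  refine ⟨l.comp ((A.toContinuousLinearEquivOfDetNeZero hA).symm : Base →L[ℝ] Base), ?_⟩
  refine ContinuousLinearMap.ext fun h => ?_
  have : (A.toContinuousLinearEquivOfDetNeZero hA).symm (A h) = h := by
    conv_lhs => rw [← ContinuousLinearMap.toContinuousLinearEquivOfDetNeZero_apply A hA]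
    exact (A.toContinuousLinearEquivOfDetNeZero hA).symm_apply_apply h
  simp [this]

/-- The covector on the base with the given coefficients. -/
def covec (a b c : ℝ) : Base →L[ℝ] ℝ :=
  a • ContinuousLinearMap.fst ℝ ℝ (ℝ × ℝ)
    + b • (ContinuousLinearMap.fst ℝ ℝ ℝ).comp (ContinuousLinearMap.snd ℝ ℝ (ℝ × ℝ))
    + c • (ContinuousLinearMap.snd ℝ ℝ ℝ).comp (ContinuousLinearMap.snd ℝ ℝ (ℝ × ℝ))

theorem covec_apply (a b c : ℝ) (e : Base) :
    covec a b c e = a * e.1 + b * e.2.1 + c * e.2.2 := rfl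

/-- (α_i, b_i, c_i) are the covectors that pull back to dt, dx, dy. As the new time depends on t
alone, b₁ = c₁ = 0 and α₁ ≠ 0, so the two symbol conditions reduce to orthogonality and equal length
of (b₂, c₂) and (b₃, c₃). This is conformality of the inverse matrix and passes to the matrix
through its cofactors. -/
theorem conformal_algebra
    {tT tX tY xX xY yX yY α₁ b₁ c₁ α₂ b₂ c₂ α₃ b₃ c₃ k₁ k₂ : ℝ}
    (hjac : tT * (xX * yY - xY * yX) ≠ 0)
    (t1 : tT * α₁ + tX * b₁ + tY * c₁ = 1) (x1 : xX * b₁ + xY * c₁ = 0)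
    (y1 : yX * b₁ + yY * c₁ = 0) (x2 : xX * b₂ + xY * c₂ = 1) (y2 : yX * b₂ + yY * c₂ = 0)
    (x3 : xX * b₃ + xY * c₃ = 0) (y3 : yX * b₃ + yY * c₃ = 1)
    (h1 : 2 * (b₁ * b₂ + c₁ * c₂) * α₃ + 2 * (b₁ * b₃ + c₁ * c₃) * α₂
        + 2 * (b₂ * b₃ + c₂ * c₃) * α₁
      + 1 / 2 * (k₁ * (2 * (b₁ * b₂ + c₁ * c₂) * c₃ + 2 * (b₁ * b₃ + c₁ * c₃) * c₂
          + 2 * (b₂ * b₃ + c₂ * c₃) * c₁)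
        - k₂ * (2 * (b₁ * b₂ + c₁ * c₂) * b₃ + 2 * (b₁ * b₃ + c₁ * c₃) * b₂
          + 2 * (b₂ * b₃ + c₂ * c₃) * b₁)) = 0)
    (h2 : 2 * (b₁ * (b₂ - b₃) + c₁ * (c₂ - c₃)) * (α₂ + α₃)
        + 2 * (b₁ * (b₂ + b₃) + c₁ * (c₂ + c₃)) * (α₂ - α₃)
        + 2 * ((b₂ - b₃) * (b₂ + b₃) + (c₂ - c₃) * (c₂ + c₃)) * α₁
      + 1 / 2 * (k₁ * (2 * (b₁ * (b₂ - b₃) + c₁ * (c₂ - c₃)) * (c₂ + c₃)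
          + 2 * (b₁ * (b₂ + b₃) + c₁ * (c₂ + c₃)) * (c₂ - c₃)
          + 2 * ((b₂ - b₃) * (b₂ + b₃) + (c₂ - c₃) * (c₂ + c₃)) * c₁)
        - k₂ * (2 * (b₁ * (b₂ - b₃) + c₁ * (c₂ - c₃)) * (b₂ + b₃)
          + 2 * (b₁ * (b₂ + b₃) + c₁ * (c₂ + c₃)) * (b₂ - b₃)
          + 2 * ((b₂ - b₃) * (b₂ + b₃) + (c₂ - c₃) * (c₂ + c₃)) * b₁)) = 0) :
    xX * yX + xY * yY = 0 ∧ xX ^ 2 + xY ^ 2 = yX ^ 2 + yY ^ 2 := by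
  have hδ : xX * yY - xY * yX ≠ 0 := fun h => hjac (by rw [h, mul_zero])
  have hb : b₁ = 0 := by
    refine (mul_eq_zero.1 ?_).resolve_left hδ
    linear_combination yY * x1 - xY * y1
  have hc : c₁ = 0 := by
    refine (mul_eq_zero.1 ?_).resolve_left hδ
    linear_combination xX * y1 - yX * x1
  subst hb hc
  have hα : α₁ ≠ 0 := by rintro rfl; simp at t1
  have d1 : b₂ * b₃ + c₂ * c₃ = 0 := by
    refine (mul_eq_zero.1 ?_).resolve_left hα
    linear_combination 1 / 2 * h1
  have d2 : b₂ * b₂ + c₂ * c₂ - (b₃ * b₃ + c₃ * c₃) = 0 := by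
    refine (mul_eq_zero.1 ?_).resolve_left hα
    linear_combination 1 / 2 * h2
  obtain ⟨δ, hδ'⟩ : ∃ δ, δ = xX * yY - xY * yX := ⟨_, rfl⟩
  have e1 : yY = δ * b₂ := by rw [hδ']; linear_combination xY * y2 - yY * x2
  have e2 : yX = -(δ * c₂) := by rw [hδ']; linear_combination xX * y2 - yX * x2
  have e3 : xY = -(δ * b₃) := by rw [hδ']; linear_combination yY * x3 - xY * y3
  have e4 : xX = δ * c₃ := by rw [hδ']; linear_combination yX * x3 - xX * y3
  constructor
  · rw [e1, e2, e3, e4]; linear_combination -δ ^ 2 * d1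
  · rw [e1, e2, e3, e4]; linear_combination -δ ^ 2 * d2

/-- Along nondegenerate jets the new space variables are conformal. -/
theorem IsPointSymmetry.conformal_jet (hΩ : IsOpen Ω) (hsym : IsPointSymmetry F β Ω Φ)
    (hmem : (p, s) ∈ Ω) {D : Total →L[ℝ] Total} (hD : D = fderiv ℝ Φ (p, s))
    {f₁ f₂ f₃ : Fiber} {dt dx dy : Total} (hdt : dt = D ((1, 0, 0), f₁))
    (hdx : dx = D ((0, 1, 0), f₂)) (hdy : dy = D ((0, 0, 1), f₃))
    (hjac : jac dt.1 dx.1 dy.1 ≠ 0) :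
    dx.1.2.1 * dy.1.2.1 + dx.1.2.2 * dy.1.2.2 = 0 ∧
      dx.1.2.1 ^ 2 + dx.1.2.2 ^ 2 = dy.1.2.1 ^ 2 + dy.1.2.2 ^ 2 := by
  have hDdet : D.det ≠ 0 := by rw [hD]; exact hsym.pointTransformation.jacobian _ hmem
  have xT : dx.1.1 = 0 := by rw [hdx, hD]; exact hsym.time_eq_zero hΩ hmem rfl
  have yT : dy.1.1 = 0 := by rw [hdy, hD]; exact hsym.time_eq_zero hΩ hmem rfl
  set L := jetMap f₁ f₂ f₃ with hL
  have Lt : L (1, 0, 0) = f₁ := by simp [hL, jetMap_apply]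
  have Lx : L (0, 1, 0) = f₂ := by simp [hL, jetMap_apply]
  have Ly : L (0, 0, 1) = f₃ := by simp [hL, jetMap_apply]
  have At : graphBase D L (1, 0, 0) = dt.1 := by rw [graphBase_apply, Lt, hdt]
  have Ax : graphBase D L (0, 1, 0) = dx.1 := by rw [graphBase_apply, Lx, hdx]
  have Ay : graphBase D L (0, 0, 1) = dy.1 := by rw [graphBase_apply, Ly, hdy]
  have hdet : (graphBase D L).det ≠ 0 := det_ne_zero_of_jac (by rwa [At, Ax, Ay])
  obtain ⟨V, hV, hsymb⟩ := hsym.linear_symbol hΩ hmem L (graphBase D L)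
    (fun h => by rw [graphBase_apply, hD]) hdet
  rw [← hD] at hV hsymb
  obtain ⟨m₁, hm₁⟩ := exists_comp_eq hdet (covec 1 0 0)
  obtain ⟨m₂, hm₂⟩ := exists_comp_eq hdet (covec 0 1 0)
  obtain ⟨m₃, hm₃⟩ := exists_comp_eq hdet (covec 0 0 1)
  obtain ⟨a, ha⟩ := exists_increment hDdet (L := L) (V := V) (fun h => hV h) (0, 1)
  -- The pulled-back products are t·x·y and t(x − y)(x + y), both harmonic in x and y, so the symbol
  -- condition on the old side is empty.
  have h1 := (hsymb m₁ m₂ m₃ a (by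
    rw [hm₁, hm₂, hm₃]
    simp [SymbolVanishes, cubicLap, spatialDot, covec_apply])).1
  have h2 := (hsymb m₁ (m₂ - m₃) (m₂ + m₃) a (by
    rw [ContinuousLinearMap.sub_comp, ContinuousLinearMap.add_comp, hm₁, hm₂, hm₃]
    simp [SymbolVanishes, cubicLap, spatialDot, covec_apply])).1
  rw [ha] at h1 h2
  have val : ∀ {m l : Base →L[ℝ] ℝ}, m.comp (graphBase D L) = l →
      (dt.1.1 * m (1, 0, 0) + dt.1.2.1 * m (0, 1, 0) + dt.1.2.2 * m (0, 0, 1) = l (1, 0, 0)) ∧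
      (dx.1.2.1 * m (0, 1, 0) + dx.1.2.2 * m (0, 0, 1) = l (0, 1, 0)) ∧
      (dy.1.2.1 * m (0, 1, 0) + dy.1.2.2 * m (0, 0, 1) = l (0, 0, 1)) := by
    intro m l h
    subst h
    refine ⟨?_, ?_, ?_⟩
    · rw [ContinuousLinearMap.comp_apply, At, clm_base_apply m dt.1]; rfl
    · rw [ContinuousLinearMap.comp_apply, Ax, clm_base_apply m dx.1, xT]; simp
    · rw [ContinuousLinearMap.comp_apply, Ay, clm_base_apply m dy.1, yT]; simp
  obtain ⟨t1, x1, y1⟩ := val hm₁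
  obtain ⟨-, x2, y2⟩ := val hm₂
  obtain ⟨-, x3, y3⟩ := val hm₃
  simp only [covec_apply, mul_zero, mul_one, add_zero, zero_add] at t1 x1 y1 x2 y2 x3 y3
  simp only [jac, xT, yT, mul_zero, zero_mul, sub_zero, add_zero] at hjac
  simp only [cubicLap, spatialDot, add_apply, sub_apply, smul_apply, smul_eq_mul, mul_zero,
    mul_one, add_zero] at h1 h2
  exact conformal_algebra hjac t1 x1 y1 x2 y2 x3 y3 h1 h2

theorem jac_of_time_eq_zero {a b c : Base} (hb : b.1 = 0) (hc : c.1 = 0) :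
    jac a b c = a.1 * (b.2.1 * c.2.2 - b.2.2 * c.2.1) := by
  simp [jac, hb, hc]

/-- The coefficient of r² in a constant polynomial is c² + d². -/
theorem coeff_eq_zero_of_sq_sum {a b c d k : ℝ}
    (h : ∀ r : ℝ, (a + r * c) ^ 2 + (b + r * d) ^ 2 = k) : c = 0 ∧ d = 0 := by
  have h0 := h 0
  have h1 := h 1
  have h2 := h (-1)
  constructor <;> nlinarith [sq_nonneg c, sq_nonneg d]

/-- Under a point symmetry the new independent variables do not depend on the old dependent
variables, and the new space variables are conformal in the old ones. -/
theorem IsPointSymmetry.fiber_conformal (hΩ : IsOpen Ω) (hsym : IsPointSymmetry F β Ω Φ)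
    {z : Total} (hz : z ∈ Ω) {D : Total →L[ℝ] Total} (hD : D = fderiv ℝ Φ z) :
    (∀ f : Fiber, (D (0, f)).1 = 0) ∧
      (D ((0, 1, 0), 0)).1.2.1 * (D ((0, 0, 1), 0)).1.2.1
        + (D ((0, 1, 0), 0)).1.2.2 * (D ((0, 0, 1), 0)).1.2.2 = 0 ∧
      (D ((0, 1, 0), 0)).1.2.1 ^ 2 + (D ((0, 1, 0), 0)).1.2.2 ^ 2
        = (D ((0, 0, 1), 0)).1.2.1 ^ 2 + (D ((0, 0, 1), 0)).1.2.2 ^ 2 ∧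
      (D ((1, 0, 0), 0)).1.1 * ((D ((0, 1, 0), 0)).1.2.1 * (D ((0, 0, 1), 0)).1.2.2
        - (D ((0, 1, 0), 0)).1.2.2 * (D ((0, 0, 1), 0)).1.2.1) ≠ 0 := by
  obtain ⟨p, s⟩ := z
  have hDdet : D.det ≠ 0 := by rw [hD]; exact hsym.pointTransformation.jacobian _ hz
  have conf := fun f₁ f₂ f₃ => hsym.conformal_jet hΩ hz hD (f₁ := f₁) (f₂ := f₂) (f₃ := f₃)
    rfl rfl rfl
  have hT : ∀ e : Total, e.1.1 = 0 → (D e).1.1 = 0 := fun e he => by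
    rw [hD]; exact hsym.time_eq_zero hΩ hz he
  set J : Fiber × Fiber × Fiber → ℝ := fun w => jac (D ((1, 0, 0), w.1)).1
    (D ((0, 1, 0), w.2.1)).1 (D ((0, 0, 1), w.2.2)).1 with hJ
  set P : Fiber × Fiber × Fiber → ℝ := fun w =>
    (D ((0, 1, 0), w.2.1)).1.2.1 * (D ((0, 0, 1), w.2.2)).1.2.1
      + (D ((0, 1, 0), w.2.1)).1.2.2 * (D ((0, 0, 1), w.2.2)).1.2.2 with hP
  set Q : Fiber × Fiber × Fiber → ℝ := fun w =>
    (D ((0, 1, 0), w.2.1)).1.2.1 ^ 2 + (D ((0, 1, 0), w.2.1)).1.2.2 ^ 2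
      - ((D ((0, 0, 1), w.2.2)).1.2.1 ^ 2 + (D ((0, 0, 1), w.2.2)).1.2.2 ^ 2) with hQ
  have sJ : ContDiff ℝ ω J := by simp only [hJ, jac]; fun_prop
  have sP : ContDiff ℝ ω P := by simp only [hP]; fun_prop
  have sQ : ContDiff ℝ ω Q := by simp only [hQ]; fun_prop
  have hJ0 : ¬ ∀ w, J w = 0 := by
    obtain ⟨f₁, f₂, f₃, h⟩ := exists_jac_ne_zero hDdet
    exact fun h' => h (h' (f₁, f₂, f₃))
  have P0 := (eq_zero_or_eq_zero_of_mul_eq_zero sJ sP fun w => by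
    by_cases h : J w = 0
    · rw [h, zero_mul]
    · rw [show P w = 0 from (conf w.1 w.2.1 w.2.2 h).1, mul_zero]).resolve_left hJ0
  have Q0 := (eq_zero_or_eq_zero_of_mul_eq_zero sJ sQ fun w => by
    by_cases h : J w = 0
    · rw [h, zero_mul]
    · rw [show Q w = 0 from sub_eq_zero.2 (conf w.1 w.2.1 w.2.2 h).2, mul_zero]).resolve_left hJ0
  have split : ∀ (e : Base) (f : Fiber), D (e, f) = D (e, 0) + D (0, f) := by
    intro e f; rw [← map_add]; simp
  have hf : ∀ f : Fiber, (D (0, f)).1 = 0 := by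
    intro f
    -- The equality of lengths holds for all jets. With the y-jet fixed and the x-jet moved along r
    -- • f, one side stays constant, so the fiber derivatives of the new space variables vanish.
    have key := coeff_eq_zero_of_sq_sum (a := (D ((0, 1, 0), 0)).1.2.1)
      (b := (D ((0, 1, 0), 0)).1.2.2) (c := (D (0, f)).1.2.1) (d := (D (0, f)).1.2.2)
      (k := (D ((0, 0, 1), 0)).1.2.1 ^ 2 + (D ((0, 0, 1), 0)).1.2.2 ^ 2) (by
        intro r
        have h := Q0 (0, r • f, 0)
        have e : D ((0, 1, 0), r • f) = D ((0, 1, 0), 0) + r • D (0, f) := by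
          rw [split, ← map_smul]; simp
        simp only [hQ, e] at h
        exact sub_eq_zero.1 h)
    exact Prod.ext (hT _ rfl) (Prod.ext key.1 key.2)
  refine ⟨hf, P0 0, sub_eq_zero.1 (Q0 0), fun h0 => hJ0 fun w => ?_⟩
  have hJw : J w = jac (D ((1, 0, 0), 0)).1 (D ((0, 1, 0), 0)).1 (D ((0, 0, 1), 0)).1 := by
    simp only [hJ]
    rw [split (1, 0, 0), split (0, 1, 0), split (0, 0, 1), Prod.fst_add, Prod.fst_add,
      Prod.fst_add, hf, hf, hf, add_zero, add_zero, add_zero]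
  rw [hJw, jac_of_time_eq_zero (hT _ rfl) (hT _ rfl), h0]

end FirstOrder

/-! ### Characteristic covectors and the first derivatives of the new stream functions -/

section FirstOrder

variable {F β : ℝ} {Ω : Set Total} {Φ : Total → Total}

/-- The factor 6(b² + c²) cancels, since b = c = 0 would force ξ = η = 0. Multiplying by T_t times
the spatial Jacobian then expresses the rest through the values τ, ξ, η of the covector on the
images of the coordinate directions. -/
theorem symbol_algebra {tT tX tY xX xY yX yY α b c τ ξ η g₂ g₃ h₂ h₃ xA xB yA yB μ₁ μ₂ : ℝ}
    (hk : ξ ≠ 0 ∨ η ≠ 0)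
    (t : tT * α + tX * b + tY * c = τ) (x : xX * b + xY * c = ξ) (y : yX * b + yY * c = η)
    (VxA : xX * g₂ + xY * g₃ = xA) (VyA : yX * g₂ + yY * g₃ = yA)
    (VxB : xX * h₂ + xY * h₃ = xB) (VyB : yX * h₂ + yY * h₃ = yB)
    (k1 : (6 * (b * b + c * c) * α + 1 / 2 * (h₂ * (6 * (b * b + c * c) * c)
        - h₃ * (6 * (b * b + c * c) * b))) * μ₂
      + 1 / 2 * (g₂ * (6 * (b * b + c * c) * c) - g₃ * (6 * (b * b + c * c) * b)) * μ₁ = 0)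
    (k2 : (6 * (b * b + c * c) * α + 1 / 2 * (h₂ * (6 * (b * b + c * c) * c)
        - h₃ * (6 * (b * b + c * c) * b))) * μ₁
      + 1 / 2 * (g₂ * (6 * (b * b + c * c) * c) - g₃ * (6 * (b * b + c * c) * b)) * μ₂ = 0) :
    ((xX * yY - xY * yX) * τ - (ξ * (yY * tX - yX * tY) + η * (xX * tY - xY * tX))
        + 1 / 2 * tT * (xB * η - yB * ξ)) * μ₂ + 1 / 2 * tT * (xA * η - yA * ξ) * μ₁ = 0 ∧
    ((xX * yY - xY * yX) * τ - (ξ * (yY * tX - yX * tY) + η * (xX * tY - xY * tX))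
        + 1 / 2 * tT * (xB * η - yB * ξ)) * μ₁ + 1 / 2 * tT * (xA * η - yA * ξ) * μ₂ = 0 := by
  have hk' : b * b + c * c ≠ 0 := by
    intro h
    have hb : b = 0 := by nlinarith [mul_self_nonneg b, mul_self_nonneg c]
    have hc : c = 0 := by nlinarith [mul_self_nonneg b, mul_self_nonneg c]
    subst hb hc
    rcases hk with h | h
    · exact h (by linarith)
    · exact h (by linarith)
  have n1 : (α + 1 / 2 * (h₂ * c - h₃ * b)) * μ₂ + 1 / 2 * (g₂ * c - g₃ * b) * μ₁ = 0 := by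
    refine (mul_eq_zero.1 ?_).resolve_left hk'
    linear_combination 1 / 6 * k1
  have n2 : (α + 1 / 2 * (h₂ * c - h₃ * b)) * μ₁ + 1 / 2 * (g₂ * c - g₃ * b) * μ₂ = 0 := by
    refine (mul_eq_zero.1 ?_).resolve_left hk'
    linear_combination 1 / 6 * k2
  have e0 : (xX * yY - xY * yX) * τ - (ξ * (yY * tX - yX * tY) + η * (xX * tY - xY * tX))
        + 1 / 2 * tT * (xB * η - yB * ξ)
      = tT * (xX * yY - xY * yX) * (α + 1 / 2 * (h₂ * c - h₃ * b)) := by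
    subst t x y VxB VyB; ring
  have e1 : 1 / 2 * tT * (xA * η - yA * ξ)
      = tT * (xX * yY - xY * yX) * (1 / 2 * (g₂ * c - g₃ * b)) := by
    subst t x y VxA VyA; ring
  rw [e0, e1]
  constructor
  · linear_combination tT * (xX * yY - xY * yX) * n1
  · linear_combination tT * (xX * yY - xY * yX) * n2

/-- The symbol relation at a point for a characteristic covector of a jet. -/
theorem IsPointSymmetry.characteristic_relation (hΩ : IsOpen Ω) (hsym : IsPointSymmetry F β Ω Φ)
    {z : Total} (hz : z ∈ Ω) {D : Total →L[ℝ] Total} (hD : D = fderiv ℝ Φ z)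
    {dt dx dy dxf dyf μ : Total} {f₂ f₃ : Fiber} {ξ η σ τ : ℝ}
    (hdt : dt = D ((1, 0, 0), 0)) (hdx : dx = D ((0, 1, 0), 0)) (hdy : dy = D ((0, 0, 1), 0))
    (hdxf : dxf = D ((0, 1, 0), f₂)) (hdyf : dyf = D ((0, 0, 1), f₃)) (hμ : μ = D (0, (σ, 1)))
    (hσ : σ ^ 2 = 1) (hk : ξ ≠ 0 ∨ η ≠ 0)
    (hτ : τ = -(1 / 2) * ((f₂.2 * η - f₃.2 * ξ) + σ * (f₂.1 * η - f₃.1 * ξ))) :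
    ((dx.1.2.1 * dy.1.2.2 - dx.1.2.2 * dy.1.2.1) * τ
        - (ξ * (dy.1.2.2 * dt.1.2.1 - dy.1.2.1 * dt.1.2.2)
          + η * (dx.1.2.1 * dt.1.2.2 - dx.1.2.2 * dt.1.2.1))
        + 1 / 2 * dt.1.1 * (dxf.2.2 * η - dyf.2.2 * ξ)) * μ.2.2
      + 1 / 2 * dt.1.1 * (dxf.2.1 * η - dyf.2.1 * ξ) * μ.2.1 = 0 ∧
    ((dx.1.2.1 * dy.1.2.2 - dx.1.2.2 * dy.1.2.1) * τ
        - (ξ * (dy.1.2.2 * dt.1.2.1 - dy.1.2.1 * dt.1.2.2)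
          + η * (dx.1.2.1 * dt.1.2.2 - dx.1.2.2 * dt.1.2.1))
        + 1 / 2 * dt.1.1 * (dxf.2.2 * η - dyf.2.2 * ξ)) * μ.2.1
      + 1 / 2 * dt.1.1 * (dxf.2.1 * η - dyf.2.1 * ξ) * μ.2.2 = 0 := by
  obtain ⟨hf, -, -, hJ⟩ := hsym.fiber_conformal hΩ hz hD
  have hT : ∀ e : Total, e.1.1 = 0 → (D e).1.1 = 0 := fun e he => by
    rw [hD]; exact hsym.time_eq_zero hΩ hz he
  have xT : dx.1.1 = 0 := by rw [hdx]; exact hT _ rfl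
  have yT : dy.1.1 = 0 := by rw [hdy]; exact hT _ rfl
  have split : ∀ (e : Base) (f : Fiber), (D (e, f)).1 = (D (e, 0)).1 := by
    intro e f
    have : D (e, f) = D (e, 0) + D (0, f) := by rw [← map_add]; simp
    rw [this, Prod.fst_add, hf, add_zero]
  set L := jetMap 0 f₂ f₃ with hL
  have Lx : L (0, 1, 0) = f₂ := by simp [hL, jetMap_apply]
  have Ly : L (0, 0, 1) = f₃ := by simp [hL, jetMap_apply]
  have At : graphBase D L (1, 0, 0) = dt.1 := by rw [graphBase_apply, split, hdt]
  have Ax : graphBase D L (0, 1, 0) = dx.1 := by rw [graphBase_apply, split, hdx]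
  have Ay : graphBase D L (0, 0, 1) = dy.1 := by rw [graphBase_apply, split, hdy]
  have hdet : (graphBase D L).det ≠ 0 := det_ne_zero_of_jac (by
    rw [At, Ax, Ay, jac_of_time_eq_zero xT yT, hdt, hdx, hdy]; exact hJ)
  obtain ⟨p, s⟩ := z
  obtain ⟨V, hV, hsymb⟩ := hsym.linear_symbol hΩ hz L (graphBase D L)
    (fun h => by rw [graphBase_apply, hD]) hdet
  rw [← hD] at hV hsymb
  obtain ⟨m, hm⟩ := exists_comp_eq hdet (covec τ ξ η)
  -- The symbol acts on the fiber by a diagonal and an off-diagonal coefficient, symmetrically in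
  -- the two layers, so (1, 1) and (−1, 1) are its eigenvectors. The value of τ makes the eigenvalue
  -- for (σ, 1) zero.
  have key := hsymb m m m (σ, 1) (by
    rw [hm, cubicLap_self]
    simp only [SymbolVanishes, smul_apply, smul_eq_mul, covec_apply,
      ContinuousLinearMap.comp_apply, Lx, Ly, ContinuousLinearMap.coe_fst',
      ContinuousLinearMap.coe_snd', mul_zero, mul_one, add_zero, zero_add, hτ]
    constructor
    · ring
    · linear_combination (-1 / 2) * (6 * spatialDot (covec _ ξ η) (covec _ ξ η))
        * (f₂.1 * η - f₃.1 * ξ) * hσ)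
  rw [hf, map_zero, sub_zero, ← hμ, cubicLap_self] at key
  have Vx := hV (0, 1, 0)
  have Vy := hV (0, 0, 1)
  rw [Ax, Lx, ← hdxf, clm_base_apply V dx.1, xT] at Vx
  rw [Ay, Ly, ← hdyf, clm_base_apply V dy.1, yT] at Vy
  simp only [Prod.ext_iff, Prod.fst_add, Prod.snd_add, Prod.smul_fst, Prod.smul_snd,
    smul_eq_mul, zero_mul, zero_add] at Vx Vy
  have mt : m dt.1 = τ := by
    rw [← At, ← ContinuousLinearMap.comp_apply, hm]; simp [covec_apply]
  have mx : m dx.1 = ξ := by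
    rw [← Ax, ← ContinuousLinearMap.comp_apply, hm]; simp [covec_apply]
  have my : m dy.1 = η := by
    rw [← Ay, ← ContinuousLinearMap.comp_apply, hm]; simp [covec_apply]
  rw [clm_base_apply m dt.1] at mt
  rw [clm_base_apply m dx.1, xT] at mx
  rw [clm_base_apply m dy.1, yT] at my
  simp only [smul_eq_mul, zero_mul, zero_add] at mt mx my
  exact symbol_algebra hk mt mx my Vx.1 Vy.1 Vx.2 Vy.2 key.1 key.2

/-- The directions (1, 1) and (−1, 1) span the fiber. At (rm, rp) = (0, 0) and (0, 1) the
coefficients do not depend on σ, so half-sums and half-differences over σ give relations on both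
columns of the fiber Jacobian, which is invertible by `hdet`. The values at (1, 0) with σ = 1 then
give bm = 0 and the square of am. -/
theorem characteristic_algebra {δ tT K₀ K₁ am ap bm bp : ℝ} (ht : tT ≠ 0)
    (hdet : am * bp - ap * bm ≠ 0)
    (h : ∀ rm rp σ : ℝ, σ ^ 2 = 1 →
      (δ * (-(1 / 2) * (rp + σ * rm)) + K₀ + 1 / 2 * tT * (bm * rm + bp * rp)) * (σ * bm + bp)
        + (K₁ + 1 / 2 * tT * (am * rm + ap * rp)) * (σ * am + ap) = 0 ∧
      (δ * (-(1 / 2) * (rp + σ * rm)) + K₀ + 1 / 2 * tT * (bm * rm + bp * rp)) * (σ * am + ap)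
        + (K₁ + 1 / 2 * tT * (am * rm + ap * rp)) * (σ * bm + bp) = 0) :
    K₀ = 0 ∧ K₁ = 0 ∧ ap = 0 ∧ bm = 0 ∧ tT * bp = δ ∧ (tT * am) ^ 2 = δ ^ 2 := by
  obtain ⟨a1, a2⟩ := h 0 0 1 (by norm_num)
  obtain ⟨b1, b2⟩ := h 0 0 (-1) (by norm_num)
  obtain ⟨c1, c2⟩ := h 0 1 1 (by norm_num)
  obtain ⟨d1, d2⟩ := h 0 1 (-1) (by norm_num)
  obtain ⟨e1, e2⟩ := h 1 0 1 (by norm_num)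
  have k0 : K₀ = 0 := by
    refine (mul_eq_zero.1 ?_).resolve_left hdet
    linear_combination 1 / 2 * am * (a1 + b1) - 1 / 2 * ap * (a1 - b1)
  have k1 : K₁ = 0 := by
    refine (mul_eq_zero.1 ?_).resolve_left hdet
    linear_combination 1 / 2 * am * (a2 + b2) - 1 / 2 * ap * (a2 - b2)
  subst k0 k1
  have p0 : δ * (-(1 / 2)) + 1 / 2 * tT * bp = 0 := by
    refine (mul_eq_zero.1 ?_).resolve_left hdet
    linear_combination 1 / 2 * am * (c1 + d1) - 1 / 2 * ap * (c1 - d1)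
  have p1 : 1 / 2 * tT * ap = 0 := by
    refine (mul_eq_zero.1 ?_).resolve_left hdet
    linear_combination 1 / 2 * am * (c2 + d2) - 1 / 2 * ap * (c2 - d2)
  have hap : ap = 0 := (mul_eq_zero.1 p1).resolve_left (by simpa using ht)
  subst hap
  have hδ : tT * bp = δ := by linarith
  subst hδ
  have ham : am ≠ 0 := by rintro rfl; simp at hdet
  have hbm : bm = 0 := by
    refine (mul_eq_zero.1 (?_ : tT * am * bm = 0)).resolve_left (mul_ne_zero ht ham)
    linear_combination e2
  subst hbm
  refine ⟨rfl, rfl, rfl, rfl, rfl, ?_⟩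
  linear_combination 2 * tT * e1

end FirstOrder

/-! ### First-order conditions on the components T, X, Y, A, B -/

section Components

/-- The coordinate vectors of the space of independent and dependent variables. -/
def eT : Total := ((1, 0, 0), 0)
/-- The coordinate vector of `x`. -/
def eX : Total := ((0, 1, 0), 0)
/-- The coordinate vector of `y`. -/
def eY : Total := ((0, 0, 1), 0)
/-- The coordinate vector of `ψ⁻`. -/
def eM : Total := (0, (1, 0))
/-- The coordinate vector of `ψ⁺`. -/
def eP : Total := (0, (0, 1))

/-- The restrictions on the first derivatives of the components of a point symmetry that follow
from the invariance of the top-order part of the system. -/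
structure FirstOrderAt (T X Y A B : Total → ℝ) (z : Total) : Prop where
  Tx : pd eX T z = 0
  Ty : pd eY T z = 0
  Tm : pd eM T z = 0
  Tp : pd eP T z = 0
  Xm : pd eM X z = 0
  Xp : pd eP X z = 0
  Ym : pd eM Y z = 0
  Yp : pd eP Y z = 0
  conformal : pd eX X z * pd eY X z + pd eX Y z * pd eY Y z = 0
  conformal_sq : pd eX X z ^ 2 + pd eX Y z ^ 2 = pd eY X z ^ 2 + pd eY Y z ^ 2
  Tt_ne : pd eT T z ≠ 0
  jac_ne : pd eX X z * pd eY Y z - pd eX Y z * pd eY X z ≠ 0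
  Ax : pd eX A z = 0
  Ay : pd eY A z = 0
  Ap : pd eP A z = 0
  Am : (pd eT T z * pd eM A z) ^ 2 = (pd eX X z * pd eY Y z - pd eX Y z * pd eY X z) ^ 2
  Bm : pd eM B z = 0
  Bp : pd eT T z * pd eP B z = pd eX X z * pd eY Y z - pd eX Y z * pd eY X z
  Bx : pd eT T z * pd eX B z = 2 * (pd eX X z * pd eT Y z - pd eX Y z * pd eT X z)
  By : pd eT T z * pd eY B z = -2 * (pd eY Y z * pd eT X z - pd eY X z * pd eT Y z)

variable {F β : ℝ} {Ω : Set Total} {Φ : Total → Total} {z : Total}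

theorem pd_components (hΦ : DifferentiableAt ℝ Φ z) (e : Total) :
    pd e (fun z => (Φ z).1.1) z = (fderiv ℝ Φ z e).1.1 ∧
      pd e (fun z => (Φ z).1.2.1) z = (fderiv ℝ Φ z e).1.2.1 ∧
      pd e (fun z => (Φ z).1.2.2) z = (fderiv ℝ Φ z e).1.2.2 ∧
      pd e (fun z => (Φ z).2.1) z = (fderiv ℝ Φ z e).2.1 ∧
      pd e (fun z => (Φ z).2.2) z = (fderiv ℝ Φ z e).2.2 := by
  have h := hΦ.hasFDerivAt
  refine ⟨?_, ?_, ?_, ?_, ?_⟩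
  · rw [pd, h.fst.fst.fderiv]; rfl
  · rw [pd, h.fst.snd.fst.fderiv]; rfl
  · rw [pd, h.fst.snd.snd.fderiv]; rfl
  · rw [pd, h.snd.fst.fderiv]; rfl
  · rw [pd, h.snd.snd.fderiv]; rfl

/-- D is injective and maps vertical vectors to vertical vectors, so its vertical 2×2 block is
injective; a zero determinant would put a row of cofactors into the kernel. -/
theorem fiber_det_ne_zero {D : Total →L[ℝ] Total} (hD : D.det ≠ 0)
    (hf : ∀ f : Fiber, (D (0, f)).1 = 0) :
    (D eM).2.1 * (D eP).2.2 - (D eP).2.1 * (D eM).2.2 ≠ 0 := by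
  intro h
  have hinj : ∀ f : Fiber, (D (0, f)).2 = 0 → f = 0 := by
    intro f h2
    have h3 : D (0, f) = D 0 := by rw [map_zero]; exact Prod.ext (hf f) h2
    have h4 := (D.toContinuousLinearEquivOfDetNeZero hD).injective h3
    exact (Prod.ext_iff.1 h4).2
  have expand : ∀ a b : ℝ, (D (0, (a, b))).2 = a • (D eM).2 + b • (D eP).2 := by
    intro a b
    have : (((0 : Base), (a, b)) : Total) = a • eM + b • eP := by simp [eM, eP]
    rw [this, map_add, map_smul, map_smul]; rfl
  have h1 := hinj ((D eP).2.2, -(D eM).2.2) (by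
    rw [expand]
    refine Prod.ext ?_ ?_ <;> simp <;> linarith)
  have h2 := hinj ((D eP).2.1, -(D eM).2.1) (by
    rw [expand]
    refine Prod.ext ?_ ?_ <;> simp <;> linarith)
  have h3 := hinj (1, 0) (by
    rw [expand]
    simp only [Prod.mk_eq_zero, neg_eq_zero] at h1 h2
    refine Prod.ext ?_ ?_ <;> simp [h1.2, h2.2])
  simp at h3

theorem IsPointSymmetry.firstOrderAt (hΩ : IsOpen Ω) (hsym : IsPointSymmetry F β Ω Φ)
    (hz : z ∈ Ω) :
    FirstOrderAt (fun z => (Φ z).1.1) (fun z => (Φ z).1.2.1) (fun z => (Φ z).1.2.2)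
      (fun z => (Φ z).2.1) (fun z => (Φ z).2.2) z := by
  have hΦ : DifferentiableAt ℝ Φ z :=
    (hsym.pointTransformation.smooth.contDiffAt (hΩ.mem_nhds hz)).differentiableAt (by simp)
  have c := pd_components hΦ
  have hdet := hsym.pointTransformation.jacobian z hz
  obtain ⟨hf, conf1, conf2, hJ⟩ := hsym.fiber_conformal hΩ hz rfl
  have hT : ∀ e : Total, e.1.1 = 0 → (fderiv ℝ Φ z e).1.1 = 0 :=
    fun e he => hsym.time_eq_zero hΩ hz he
  have hfd := fiber_det_ne_zero hdet hf
  set D := fderiv ℝ Φ z with hD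
  have ht : (D eT).1.1 ≠ 0 := left_ne_zero_of_mul hJ
  have expand : ∀ (e : Base) (a b : ℝ), D (e, (a, b)) = D (e, 0) + (a • D eM + b • D eP) := by
    intro e a b
    rw [← map_smul, ← map_smul, ← map_add, ← map_add]
    congr 1
    simp [eM, eP]
  have hσμ : ∀ σ : ℝ, D (0, (σ, 1)) = σ • D eM + D eP := by
    intro σ
    have h0 : D ((0 : Base), (0 : Fiber)) = 0 := D.map_zero
    rw [expand, h0, zero_add, one_smul]
  have hx : ∀ a b : ℝ, D ((0, 1, 0), (a, b)) = D eX + (a • D eM + b • D eP) := expand _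
  have hy : ∀ a b : ℝ, D ((0, 0, 1), (a, b)) = D eY + (a • D eM + b • D eP) := expand _
  -- Covectors with spatial part dy test the x-derivatives of the stream functions and give A_x and
  -- B_x; those with spatial part dx give A_y and B_y. The minus signs in the second family bring it
  -- to the shape of `characteristic_algebra`.
  have rx := fun (rm rp σ : ℝ) (hσ : σ ^ 2 = 1) =>
    hsym.characteristic_relation hΩ hz hD (dt := D eT) (dx := D eX) (dy := D eY)
      (dxf := D eX + (rm • D eM + rp • D eP)) (dyf := D eY) (μ := σ • D eM + D eP)
      (f₂ := (rm, rp)) (f₃ := 0) (ξ := 0) (η := 1) rfl rfl rfl (hx rm rp).symm rfl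
      (hσμ σ).symm hσ (Or.inr one_ne_zero) rfl
  have ry := fun (rm rp σ : ℝ) (hσ : σ ^ 2 = 1) =>
    hsym.characteristic_relation hΩ hz hD (dt := D eT) (dx := D eX) (dy := D eY)
      (dxf := D eX) (dyf := D eY + ((-rm) • D eM + (-rp) • D eP)) (μ := σ • D eM + D eP)
      (f₂ := 0) (f₃ := (-rm, -rp)) (ξ := 1) (η := 0) rfl rfl rfl rfl (hy (-rm) (-rp)).symm
      (hσμ σ).symm hσ (Or.inl one_ne_zero) rfl
  simp only [Prod.fst_add, Prod.snd_add, Prod.smul_fst, Prod.smul_snd, smul_eq_mul,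
    Prod.fst_zero, Prod.snd_zero] at rx ry
  have X := characteristic_algebra (δ := (D eX).1.2.1 * (D eY).1.2.2 - (D eX).1.2.2 * (D eY).1.2.1)
    (K₀ := -((D eX).1.2.1 * (D eT).1.2.2 - (D eX).1.2.2 * (D eT).1.2.1)
      + 1 / 2 * (D eT).1.1 * (D eX).2.2) (K₁ := 1 / 2 * (D eT).1.1 * (D eX).2.1) ht hfd (by
      intro rm rp σ hσ
      obtain ⟨h1, h2⟩ := rx rm rp σ hσ
      constructor
      · linear_combination h1
      · linear_combination h2)
  have Y := characteristic_algebra (δ := (D eX).1.2.1 * (D eY).1.2.2 - (D eX).1.2.2 * (D eY).1.2.1)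
    (K₀ := -((D eY).1.2.2 * (D eT).1.2.1 - (D eY).1.2.1 * (D eT).1.2.2)
      - 1 / 2 * (D eT).1.1 * (D eY).2.2) (K₁ := -(1 / 2 * (D eT).1.1 * (D eY).2.1)) ht hfd (by
      intro rm rp σ hσ
      obtain ⟨h1, h2⟩ := ry rm rp σ hσ
      constructor
      · linear_combination h1
      · linear_combination h2)
  obtain ⟨X0, X1, hap, hbm, hbp, ham⟩ := X
  obtain ⟨Y0, Y1, -⟩ := Y
  have half : (1 / 2 : ℝ) * (D eT).1.1 ≠ 0 := mul_ne_zero (by norm_num) ht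
  have hM : (D eM).1 = 0 := hf _
  have hP : (D eP).1 = 0 := hf _
  constructor
  · rw [(c _).1]; exact hT _ rfl
  · rw [(c _).1]; exact hT _ rfl
  · rw [(c _).1]; exact hT _ rfl
  · rw [(c _).1]; exact hT _ rfl
  · rw [(c _).2.1, hM]; rfl
  · rw [(c _).2.1, hP]; rfl
  · rw [(c _).2.2.1, hM]; rfl
  · rw [(c _).2.2.1, hP]; rfl
  · rw [(c _).2.1, (c _).2.1, (c _).2.2.1, (c _).2.2.1]; exact conf1
  · rw [(c _).2.1, (c _).2.1, (c _).2.2.1, (c _).2.2.1]; exact conf2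
  · rw [(c _).1]; exact ht
  · rw [(c _).2.1, (c _).2.1, (c _).2.2.1, (c _).2.2.1]; exact right_ne_zero_of_mul hJ
  · rw [(c _).2.2.2.1]; exact (mul_eq_zero.1 X1).resolve_left half
  · rw [(c _).2.2.2.1]; exact (mul_eq_zero.1 (neg_eq_zero.1 Y1)).resolve_left half
  · rw [(c _).2.2.2.1]; exact hap
  · rw [(c _).1, (c _).2.1, (c _).2.1, (c _).2.2.1, (c _).2.2.1, (c _).2.2.2.1]; exact ham
  · rw [(c _).2.2.2.2]; exact hbm
  · rw [(c _).1, (c _).2.1, (c _).2.1, (c _).2.2.1, (c _).2.2.1, (c _).2.2.2.2]; exact hbp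
  · rw [(c _).1, (c _).2.1, (c _).2.1, (c _).2.2.1, (c _).2.2.1, (c _).2.2.2.2]
    linear_combination 2 * X0
  · rw [(c _).1, (c _).2.1, (c _).2.1, (c _).2.2.1, (c _).2.2.1, (c _).2.2.2.2]
    linear_combination -2 * Y0

end Components

/-! ### Differentiating identities that hold on an open set -/

section OpenSet

variable {E : Type*} [NormedAddCommGroup E] [NormedSpace ℝ E] {Ω : Set E} {f g : E → ℝ} {z : E}

theorem pd_eq_of_eqOn (hΩ : IsOpen Ω) (h : ∀ z ∈ Ω, f z = g z) (e : E) (hz : z ∈ Ω) :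
    pd e f z = pd e g z :=
  pd_congr (by filter_upwards [hΩ.mem_nhds hz] with q hq using h q hq) e

theorem pd_eq_zero_of_eqOn_const (hΩ : IsOpen Ω) {c : ℝ} (h : ∀ z ∈ Ω, f z = c) (e : E)
    (hz : z ∈ Ω) : pd e f z = 0 := by
  rw [pd_eq_of_eqOn hΩ (g := fun _ => c) h e hz, pd_const]

theorem pd_pd_eq_zero (hΩ : IsOpen Ω) (hf : ∀ z ∈ Ω, ContDiffAt ℝ ∞ f z) {e : E}
    (h : ∀ z ∈ Ω, pd e f z = 0) (e' : E) (hz : z ∈ Ω) : pd e (pd e' f) z = 0 := by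
  rw [pd_comm (hf z hz)]
  exact pd_eq_zero_of_eqOn_const hΩ h e' hz

/-- From f ∂f = g ∂g. This passes constancy from g to f without choosing the sign in f = ±g. -/
theorem pd_eq_zero_of_sq_eq (hΩ : IsOpen Ω) (hf : ∀ z ∈ Ω, ContDiffAt ℝ ∞ f z)
    (hg : ∀ z ∈ Ω, ContDiffAt ℝ ∞ g z) (h : ∀ z ∈ Ω, f z ^ 2 = g z ^ 2) {e : E} (hz : z ∈ Ω)
    (hne : f z ≠ 0) (hge : pd e g z = 0) : pd e f z = 0 := by
  have df := differentiableAt_of_smooth (hf z hz)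
  have dg := differentiableAt_of_smooth (hg z hz)
  have h1 := pd_eq_of_eqOn hΩ (f := fun z => f z * f z) (g := fun z => g z * g z)
    (fun z hz => by rw [← sq, ← sq, h z hz]) e hz
  rw [pd_mul df df, pd_mul dg dg, hge] at h1
  refine (mul_eq_zero.1 (?_ : f z * pd e f z = 0)).resolve_left hne
  linarith

end OpenSet

/-! ### Coefficients that are constant in space, and harmonicity of X and Y -/

section FirstOrderOn

/-- Smooth functions on an open set that satisfy there the first-order conditions on the
components of a point symmetry. -/
structure FirstOrderOn (Ω : Set Total) (T X Y A B : Total → ℝ) : Prop where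
  isOpen : IsOpen Ω
  smoothT : ∀ z ∈ Ω, ContDiffAt ℝ ∞ T z
  smoothX : ∀ z ∈ Ω, ContDiffAt ℝ ∞ X z
  smoothY : ∀ z ∈ Ω, ContDiffAt ℝ ∞ Y z
  smoothA : ∀ z ∈ Ω, ContDiffAt ℝ ∞ A z
  smoothB : ∀ z ∈ Ω, ContDiffAt ℝ ∞ B z
  first : ∀ z ∈ Ω, FirstOrderAt T X Y A B z

/-- The squared length of the spatial gradient of `X`. -/
def gradSq (X : Total → ℝ) (z : Total) : ℝ := pd eX X z ^ 2 + pd eY X z ^ 2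

/-- A real 2×2 matrix with rows (a, b), (c, d) and orthogonal columns of equal nonzero length is a
multiple of an orthogonal matrix. Its rows are then orthogonal of the same length, and it is
proportional to its cofactor matrix; the last two identities are the Cauchy–Riemann equations up to
orientation. -/
theorem conformal_rows {a b c d : ℝ} (h1 : a * b + c * d = 0) (h2 : a ^ 2 + c ^ 2 = b ^ 2 + d ^ 2)
    (h3 : a * d - c * b ≠ 0) :
    a * c + b * d = 0 ∧ c ^ 2 + d ^ 2 = a ^ 2 + b ^ 2 ∧ (a ^ 2 + b ^ 2) ^ 2 = (a * d - c * b) ^ 2 ∧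
      0 < a ^ 2 + b ^ 2 ∧ (a ^ 2 + b ^ 2) * a = (a * d - c * b) * d ∧
      (a ^ 2 + b ^ 2) * b = -((a * d - c * b) * c) := by
  have e1 : (a * d - c * b) * a = (a ^ 2 + c ^ 2) * d := by linear_combination (-c) * h1
  have e2 : (a * d - c * b) * c = -((a ^ 2 + c ^ 2) * b) := by linear_combination a * h1
  have e3 : (a * d - c * b) ^ 2 = (a ^ 2 + c ^ 2) ^ 2 := by
    linear_combination (-(a * b + c * d)) * h1 - (a ^ 2 + c ^ 2) * h2
  have hpos : a ^ 2 + c ^ 2 ≠ 0 := by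
    intro h; rw [h] at e3; exact h3 (pow_eq_zero_iff (two_ne_zero) |>.1 (by simpa using e3))
  have e4 : b ^ 2 = c ^ 2 := by
    have h4 : (a ^ 2 + c ^ 2) ^ 2 * b ^ 2 = (a ^ 2 + c ^ 2) ^ 2 * c ^ 2 := by
      linear_combination (-((a * d - c * b) * c) + (a ^ 2 + c ^ 2) * b) * e2 + c ^ 2 * e3
    exact mul_left_cancel₀ (pow_ne_zero 2 hpos) h4
  have e5 : a * c + b * d = 0 := by
    have h5 : (a * d - c * b) ^ 2 * (a * c + b * d) = 0 := by
      linear_combination (a * d - c * b) * c * e1 + (a ^ 2 + c ^ 2) * d * e2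
        + b * d * e3
    exact (mul_eq_zero.1 h5).resolve_left (pow_ne_zero 2 h3)
  refine ⟨e5, by linarith, by rw [e4, e3], ?_, ?_, ?_⟩
  · rw [e4]; positivity
  · linear_combination a * h2 + c * e5 + 2 * a * e4
  · linear_combination a * h1 + b * e4

variable {Ω : Set Total} {T X Y A B : Total → ℝ} {z : Total}

/-- The four directions transversal to the time axis along which the coefficient functions of a
point symmetry are constant. -/
def IsSpatial (e : Total) : Prop := e = eX ∨ e = eY ∨ e = eM ∨ e = eP

/-- The spatial Jacobian of the transformation of the independent variables. -/
def spatialJac (X Y : Total → ℝ) (z : Total) : ℝ :=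
  pd eX X z * pd eY Y z - pd eX Y z * pd eY X z

theorem contDiffAt_gradSq (hX : ContDiffAt ℝ ∞ X z) : ContDiffAt ℝ ∞ (gradSq X) z :=
  ((contDiffAt_pd hX eX).pow 2).add ((contDiffAt_pd hX eY).pow 2)

theorem contDiffAt_spatialJac (hX : ContDiffAt ℝ ∞ X z) (hY : ContDiffAt ℝ ∞ Y z) :
    ContDiffAt ℝ ∞ (spatialJac X Y) z :=
  ((contDiffAt_pd hX eX).mul (contDiffAt_pd hY eY)).sub
    ((contDiffAt_pd hY eX).mul (contDiffAt_pd hX eY))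

namespace FirstOrderOn

theorem rows (h : FirstOrderOn Ω T X Y A B) (hz : z ∈ Ω) :
    pd eX X z * pd eX Y z + pd eY X z * pd eY Y z = 0 ∧
      pd eX Y z ^ 2 + pd eY Y z ^ 2 = gradSq X z ∧ gradSq X z ^ 2 = spatialJac X Y z ^ 2 ∧
      0 < gradSq X z ∧ gradSq X z * pd eX X z = spatialJac X Y z * pd eY Y z ∧
      gradSq X z * pd eY X z = -(spatialJac X Y z * pd eX Y z) := by
  have f := h.first z hz
  exact conformal_rows f.conformal f.conformal_sq f.jac_ne

theorem Bp_ne (h : FirstOrderOn Ω T X Y A B) (hz : z ∈ Ω) : pd eP B z ≠ 0 := by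
  have f := h.first z hz
  intro h0
  have := f.Bp
  rw [h0, mul_zero] at this
  exact f.jac_ne this.symm

theorem Am_sq (h : FirstOrderOn Ω T X Y A B) (hz : z ∈ Ω) : pd eM A z ^ 2 = pd eP B z ^ 2 := by
  have f := h.first z hz
  have h1 := f.Am
  rw [← f.Bp, mul_pow, mul_pow] at h1
  exact mul_left_cancel₀ (pow_ne_zero 2 f.Tt_ne) h1

theorem Am_ne (h : FirstOrderOn Ω T X Y A B) (hz : z ∈ Ω) : pd eM A z ≠ 0 := by
  intro h0
  have h1 := h.Am_sq hz
  rw [h0] at h1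
  exact h.Bp_ne hz (pow_eq_zero_iff two_ne_zero |>.1 (by simpa using h1.symm))

theorem pd_Tt (h : FirstOrderOn Ω T X Y A B) {e : Total} (he : IsSpatial e) (hz : z ∈ Ω) :
    pd e (pd eT T) z = 0 := by
  rcases he with rfl | rfl | rfl | rfl
  · exact pd_pd_eq_zero h.isOpen h.smoothT (fun z hz => (h.first z hz).Tx) _ hz
  · exact pd_pd_eq_zero h.isOpen h.smoothT (fun z hz => (h.first z hz).Ty) _ hz
  · exact pd_pd_eq_zero h.isOpen h.smoothT (fun z hz => (h.first z hz).Tm) _ hz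
  · exact pd_pd_eq_zero h.isOpen h.smoothT (fun z hz => (h.first z hz).Tp) _ hz

/-- The x, y and ψ⁺ derivatives commute past ψ⁻ and hit the vanishing A_x, A_y, A_{ψ⁺}. The ψ⁻
derivative is transferred from B_{ψ⁺}, where B_{ψ⁻} = 0, by A_{ψ⁻}² = B_{ψ⁺}². -/
theorem pd_Am (h : FirstOrderOn Ω T X Y A B) {e : Total} (he : IsSpatial e) (hz : z ∈ Ω) :
    pd e (pd eM A) z = 0 := by
  rcases he with rfl | rfl | rfl | rfl
  · exact pd_pd_eq_zero h.isOpen h.smoothA (fun z hz => (h.first z hz).Ax) _ hz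
  · exact pd_pd_eq_zero h.isOpen h.smoothA (fun z hz => (h.first z hz).Ay) _ hz
  · exact pd_eq_zero_of_sq_eq h.isOpen (fun z hz => contDiffAt_pd (h.smoothA z hz) _)
      (fun z hz => contDiffAt_pd (h.smoothB z hz) _) (fun z hz => h.Am_sq hz) hz (h.Am_ne hz)
      (pd_pd_eq_zero h.isOpen h.smoothB (fun z hz => (h.first z hz).Bm) _ hz)
  · exact pd_pd_eq_zero h.isOpen h.smoothA (fun z hz => (h.first z hz).Ap) _ hz

theorem pd_Bp_of_pd_Am (h : FirstOrderOn Ω T X Y A B) {e : Total} (hz : z ∈ Ω)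
    (he : pd e (pd eM A) z = 0) : pd e (pd eP B) z = 0 :=
  pd_eq_zero_of_sq_eq h.isOpen (fun z hz => contDiffAt_pd (h.smoothB z hz) _)
    (fun z hz => contDiffAt_pd (h.smoothA z hz) _) (fun _ hz => (h.Am_sq hz).symm) hz
    (h.Bp_ne hz) he

theorem pd_Bp (h : FirstOrderOn Ω T X Y A B) {e : Total} (he : IsSpatial e) (hz : z ∈ Ω) :
    pd e (pd eP B) z = 0 :=
  h.pd_Bp_of_pd_Am hz (h.pd_Am he hz)

theorem pd_spatialJac (h : FirstOrderOn Ω T X Y A B) {e : Total} (he : IsSpatial e)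
    (hz : z ∈ Ω) : pd e (spatialJac X Y) z = 0 := by
  rw [← pd_eq_of_eqOn h.isOpen (f := fun z => pd eT T z * pd eP B z) (g := spatialJac X Y)
    (fun z hz => (h.first z hz).Bp) e hz,
    pd_mul (differentiableAt_of_smooth (contDiffAt_pd (h.smoothT z hz) _))
      (differentiableAt_of_smooth (contDiffAt_pd (h.smoothB z hz) _)), h.pd_Tt he hz,
    h.pd_Bp he hz]
  ring

/-- J = T_t B_{ψ⁺} has constant factors in these directions, and λ² = J². So the conformal factor
can vary only with time. -/
theorem pd_gradSq (h : FirstOrderOn Ω T X Y A B) {e : Total} (he : IsSpatial e)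
    (hz : z ∈ Ω) : pd e (gradSq X) z = 0 :=
  pd_eq_zero_of_sq_eq h.isOpen (fun z hz => contDiffAt_gradSq (h.smoothX z hz))
    (fun z hz => contDiffAt_spatialJac (h.smoothX z hz) (h.smoothY z hz))
    (fun _ hz => (h.rows hz).2.2.1) hz (h.rows hz).2.2.2.1.ne' (h.pd_spatialJac he hz)

theorem _root_.TwoLayer.isSpatial_eX : IsSpatial eX := Or.inl rfl
theorem _root_.TwoLayer.isSpatial_eY : IsSpatial eY := Or.inr (Or.inl rfl)
theorem _root_.TwoLayer.isSpatial_eM : IsSpatial eM := Or.inr (Or.inr (Or.inl rfl))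
theorem _root_.TwoLayer.isSpatial_eP : IsSpatial eP := Or.inr (Or.inr (Or.inr rfl))

/-- The derivatives of the conformality relations between the spatial gradients. -/
theorem pd_rows (h : FirstOrderOn Ω T X Y A B) {e : Total} (he : IsSpatial e) (hz : z ∈ Ω) :
    gradSq X z * pd e (pd eX X) z = spatialJac X Y z * pd e (pd eY Y) z ∧
      gradSq X z * pd e (pd eY X) z = -(spatialJac X Y z * pd e (pd eX Y) z) := by
  have dl := differentiableAt_of_smooth (contDiffAt_gradSq (h.smoothX z hz))
  have dj := differentiableAt_of_smooth (contDiffAt_spatialJac (h.smoothX z hz) (h.smoothY z hz))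
  have dX := fun e => differentiableAt_of_smooth (contDiffAt_pd (h.smoothX z hz) e)
  have dY := fun e => differentiableAt_of_smooth (contDiffAt_pd (h.smoothY z hz) e)
  have h1 := pd_eq_of_eqOn h.isOpen (f := fun z => gradSq X z * pd eX X z)
    (g := fun z => spatialJac X Y z * pd eY Y z) (fun z hz => (h.rows hz).2.2.2.2.1) e hz
  have h2 := pd_eq_of_eqOn h.isOpen (f := fun z => gradSq X z * pd eY X z)
    (g := fun z => (-1) * (spatialJac X Y z * pd eX Y z))
    (fun z hz => by rw [(h.rows hz).2.2.2.2.2]; ring) e hz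
  rw [pd_mul dl (dX _), pd_mul dj (dY _), h.pd_gradSq he hz, h.pd_spatialJac he hz] at h1
  rw [pd_const_mul _ (dj.fun_mul (dY _)), pd_mul dl (dX _), pd_mul dj (dY _), h.pd_gradSq he hz,
    h.pd_spatialJac he hz] at h2
  constructor <;> linarith

/-- The transformed space variables are harmonic. -/
theorem harmonic (h : FirstOrderOn Ω T X Y A B) (hz : z ∈ Ω) :
    pd eX (pd eX X) z + pd eY (pd eY X) z = 0 ∧ pd eX (pd eX Y) z + pd eY (pd eY Y) z = 0 := by
  -- Since λ and J are constant in space, λX_x = JY_y and λX_y = −JY_x are Cauchy–Riemann equations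
  -- with constant coefficients, and symmetry of mixed derivatives gives harmonicity.
  obtain ⟨x1, x2⟩ := h.pd_rows isSpatial_eX hz
  obtain ⟨y1, y2⟩ := h.pd_rows isSpatial_eY hz
  have hl := (h.rows hz).2.2.2.1.ne'
  have hj : spatialJac X Y z ≠ 0 := (h.first z hz).jac_ne
  have c1 : pd eX (pd eY Y) z = pd eY (pd eX Y) z := pd_comm (h.smoothY z hz)
  have c2 : pd eX (pd eY X) z = pd eY (pd eX X) z := pd_comm (h.smoothX z hz)
  constructor
  · refine (mul_eq_zero.1 (?_ : gradSq X z * _ = 0)).resolve_left hl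
    linear_combination x1 + y2 + spatialJac X Y z * c1
  · refine (mul_eq_zero.1 (?_ : spatialJac X Y z * _ = 0)).resolve_left hj
    linear_combination x2 - y1 - gradSq X z * c2

end FirstOrderOn

end FirstOrderOn

theorem IsPointSymmetry.firstOrderOn {F β : ℝ} {Ω : Set Total} {Φ : Total → Total}
    (hΩ : IsOpen Ω) (hsym : IsPointSymmetry F β Ω Φ) :
    FirstOrderOn Ω (fun z => (Φ z).1.1) (fun z => (Φ z).1.2.1) (fun z => (Φ z).1.2.2)
      (fun z => (Φ z).2.1) (fun z => (Φ z).2.2) := by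
  have hs : ∀ z ∈ Ω, ContDiffAt ℝ ∞ Φ z := fun z hz =>
    hsym.pointTransformation.smooth.contDiffAt (hΩ.mem_nhds hz)
  exact ⟨hΩ, fun z hz => (hs z hz).fst.fst, fun z hz => (hs z hz).fst.snd.fst,
    fun z hz => (hs z hz).fst.snd.snd, fun z hz => (hs z hz).snd.fst,
    fun z hz => (hs z hz).snd.snd, fun z hz => hsym.firstOrderAt hΩ hz⟩

/-! ### Laplacian and system under a conformal change of variables -/

section ChangeOfVariables

variable {τ ξ η v w : Base → ℝ} {p : Base}

theorem pd_comp (hv : DifferentiableAt ℝ v (τ p, ξ p, η p)) (hτ : DifferentiableAt ℝ τ p)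
    (hξ : DifferentiableAt ℝ ξ p) (hη : DifferentiableAt ℝ η p) (e : Base) :
    pd e (fun q => v (τ q, ξ q, η q)) p = Dt v (τ p, ξ p, η p) * pd e τ p
      + Dx v (τ p, ξ p, η p) * pd e ξ p + Dy v (τ p, ξ p, η p) * pd e η p := by
  have h1 := hτ.hasFDerivAt.prodMk (hξ.hasFDerivAt.prodMk hη.hasFDerivAt)
  have h2 : HasFDerivAt (fun q => v (τ q, ξ q, η q)) _ p :=
    HasFDerivAt.comp (f := fun q => (τ q, ξ q, η q)) p hv.hasFDerivAt h1
  rw [pd, h2.fderiv, ContinuousLinearMap.comp_apply, clm_base_apply]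
  simp only [smul_eq_mul, Dt, Dx, Dy, pd]
  change fderiv ℝ τ p e * _ + fderiv ℝ ξ p e * _ + fderiv ℝ η p e * _ = _
  ring

theorem pd_comp_eventually (hv : ContDiffAt ℝ ∞ v (τ p, ξ p, η p)) (hτ : ContDiffAt ℝ ∞ τ p)
    (hξ : ContDiffAt ℝ ∞ ξ p) (hη : ContDiffAt ℝ ∞ η p) (e : Base) :
    pd e (fun q => v (τ q, ξ q, η q)) =ᶠ[𝓝 p] fun q => Dt v (τ q, ξ q, η q) * pd e τ q
      + Dx v (τ q, ξ q, η q) * pd e ξ q + Dy v (τ q, ξ q, η q) * pd e η q := by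
  have hc : ContinuousAt (fun q => (τ q, ξ q, η q)) p :=
    hτ.continuousAt.prodMk (hξ.continuousAt.prodMk hη.continuousAt)
  filter_upwards [hc.eventually (eventually_differentiableAt hv), eventually_differentiableAt hτ,
    eventually_differentiableAt hξ, eventually_differentiableAt hη] with q h1 h2 h3 h4
  exact pd_comp h1 h2 h3 h4 e

theorem contDiffAt_comp (hv : ContDiffAt ℝ ∞ v (τ p, ξ p, η p)) (hτ : ContDiffAt ℝ ∞ τ p)
    (hξ : ContDiffAt ℝ ∞ ξ p) (hη : ContDiffAt ℝ ∞ η p) :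
    ContDiffAt ℝ ∞ (fun q => v (τ q, ξ q, η q)) p :=
  ContDiffAt.comp (f := fun q => (τ q, ξ q, η q)) p hv (hτ.prodMk (hξ.prodMk hη))

/-- The Laplacian under a change of variables that preserves time and is conformal with respect
to the space variables. -/
theorem lap_comp_eventually (hv : ContDiffAt ℝ ∞ v (τ p, ξ p, η p)) (hτ : ContDiffAt ℝ ∞ τ p)
    (hξ : ContDiffAt ℝ ∞ ξ p) (hη : ContDiffAt ℝ ∞ η p)
    (hw : ∀ᶠ q in 𝓝 p, v (τ q, ξ q, η q) = w q)
    (hτx : ∀ᶠ q in 𝓝 p, Dx τ q = 0) (hτy : ∀ᶠ q in 𝓝 p, Dy τ q = 0)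
    (hlξ : ∀ᶠ q in 𝓝 p, lap ξ q = 0) (hlη : ∀ᶠ q in 𝓝 p, lap η q = 0)
    (horth : ∀ᶠ q in 𝓝 p, Dx ξ q * Dx η q + Dy ξ q * Dy η q = 0)
    (hlen : ∀ᶠ q in 𝓝 p, Dx η q ^ 2 + Dy η q ^ 2 = Dx ξ q ^ 2 + Dy ξ q ^ 2) :
    ∀ᶠ q in 𝓝 p, lap w q = (Dx ξ q ^ 2 + Dy ξ q ^ 2) * lap v (τ q, ξ q, η q) := by
  have hvx : ContDiffAt ℝ ∞ (Dx v) (τ p, ξ p, η p) := contDiffAt_pd hv _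
  have hvy : ContDiffAt ℝ ∞ (Dy v) (τ p, ξ p, η p) := contDiffAt_pd hv _
  have second : ∀ e : Base, (∀ᶠ q in 𝓝 p, pd e τ q = 0) → ∀ᶠ q in 𝓝 p, pd e (pd e w) q =
      (Dx (Dx v) (τ q, ξ q, η q) * pd e ξ q + Dy (Dx v) (τ q, ξ q, η q) * pd e η q) * pd e ξ q
      + Dx v (τ q, ξ q, η q) * pd e (pd e ξ) q
      + ((Dx (Dy v) (τ q, ξ q, η q) * pd e ξ q + Dy (Dy v) (τ q, ξ q, η q) * pd e η q) * pd e η q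
      + Dy v (τ q, ξ q, η q) * pd e (pd e η) q) := by
    intro e he
    have h1 : pd e w =ᶠ[𝓝 p] fun q => Dx v (τ q, ξ q, η q) * pd e ξ q
        + Dy v (τ q, ξ q, η q) * pd e η q := by
      filter_upwards [pd_congr_eventually hw e, pd_comp_eventually hv hτ hξ hη e, he]
        with q a1 a2 a3
      rw [← a1, a2, a3]; ring
    filter_upwards [pd_congr_eventually h1 e, he, pd_comp_eventually hvx hτ hξ hη e,
      pd_comp_eventually hvy hτ hξ hη e,
      eventually_differentiableAt (contDiffAt_comp hvx hτ hξ hη),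
      eventually_differentiableAt (contDiffAt_comp hvy hτ hξ hη),
      eventually_differentiableAt (contDiffAt_pd hξ e),
      eventually_differentiableAt (contDiffAt_pd hη e)] with q a0 a1 a2 a3 d1 d2 d3 d4
    rw [a0, pd_add (d1.fun_mul d3) (d2.fun_mul d4), pd_mul d1 d3, pd_mul d2 d4, a2, a3, a1]
    ring
  have hc : ContinuousAt (fun q => (τ q, ξ q, η q)) p :=
    hτ.continuousAt.prodMk (hξ.continuousAt.prodMk hη.continuousAt)
  filter_upwards [second (0, 1, 0) hτx, second (0, 0, 1) hτy, hlξ, hlη, horth, hlen,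
    hc.eventually (pd_comm_eventually hv (0, 1, 0) (0, 0, 1))] with q sx sy a1 a2 a3 a4 cm
  simp only [pd_ex, pd_ey] at sx sy cm
  simp only [lap] at a1 a2 ⊢
  rw [sx, sy, cm]
  linear_combination Dx v (τ q, ξ q, η q) * a1 + Dy v (τ q, ξ q, η q) * a2
    + 2 * Dy (Dx v) (τ q, ξ q, η q) * a3 + Dy (Dy v) (τ q, ξ q, η q) * a4

/-- The system for the transformed functions in terms of their pullbacks `wm`, `wp` and of the
pullbacks `Pm`, `Pp` of their potential vorticities. -/
theorem systemAt_comp_iff {F β : ℝ} {vm vp wm wp Pm Pp : Base → ℝ}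
    (hvm : ContDiffAt ℝ ∞ vm (τ p, ξ p, η p)) (hvp : ContDiffAt ℝ ∞ vp (τ p, ξ p, η p))
    (hτ : ContDiffAt ℝ ∞ τ p) (hξ : ContDiffAt ℝ ∞ ξ p) (hη : ContDiffAt ℝ ∞ η p)
    (hwm : ∀ᶠ q in 𝓝 p, vm (τ q, ξ q, η q) = wm q) (hwp : ∀ᶠ q in 𝓝 p, vp (τ q, ξ q, η q) = wp q)
    (hPm : ∀ᶠ q in 𝓝 p, Qminus F vm (τ q, ξ q, η q) = Pm q)
    (hPp : ∀ᶠ q in 𝓝 p, Qplus β vp (τ q, ξ q, η q) = Pp q)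
    (hτx : Dx τ p = 0) (hτy : Dy τ p = 0) (hτt : Dt τ p ≠ 0)
    (hJ : Dx ξ p * Dy η p - Dx η p * Dy ξ p ≠ 0) :
    SystemAt F β vm vp (τ p, ξ p, η p) ↔
      (Dx ξ p * Dy η p - Dx η p * Dy ξ p) * Dt Pp p
        - (Dy η p * Dt ξ p - Dy ξ p * Dt η p) * Dx Pp p
        - (Dx ξ p * Dt η p - Dx η p * Dt ξ p) * Dy Pp p
        + 1 / 2 * Dt τ p * (bracket wp Pp p + bracket wm Pm p) = 0 ∧
      (Dx ξ p * Dy η p - Dx η p * Dy ξ p) * Dt Pm p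
        - (Dy η p * Dt ξ p - Dy ξ p * Dt η p) * Dx Pm p
        - (Dx ξ p * Dt η p - Dx η p * Dt ξ p) * Dy Pm p
        + 1 / 2 * Dt τ p * (bracket wp Pm p + bracket wm Pp p) = 0 := by
  have chain : ∀ {v w : Base → ℝ}, ContDiffAt ℝ ∞ v (τ p, ξ p, η p) →
      (∀ᶠ q in 𝓝 p, v (τ q, ξ q, η q) = w q) →
      Dt w p = Dt v (τ p, ξ p, η p) * Dt τ p + Dx v (τ p, ξ p, η p) * Dt ξ p
        + Dy v (τ p, ξ p, η p) * Dt η p ∧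
      Dx w p = Dx v (τ p, ξ p, η p) * Dx ξ p + Dy v (τ p, ξ p, η p) * Dx η p ∧
      Dy w p = Dx v (τ p, ξ p, η p) * Dy ξ p + Dy v (τ p, ξ p, η p) * Dy η p := by
    intro v w hv hw
    have h := fun e => (pd_congr hw e).symm.trans (pd_comp (differentiableAt_of_smooth hv)
      (differentiableAt_of_smooth hτ) (differentiableAt_of_smooth hξ)
      (differentiableAt_of_smooth hη) e)
    have hx := h (0, 1, 0)
    have hy := h (0, 0, 1)
    simp only [pd_ex, pd_ey, hτx, hτy, mul_zero, zero_add] at hx hy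
    exact ⟨h (1, 0, 0), hx, hy⟩
  have hQm : ContDiffAt ℝ ∞ (Qminus F vm) (τ p, ξ p, η p) :=
    (contDiffAt_lap hvm).sub (contDiffAt_const.mul hvm)
  have hQp : ContDiffAt ℝ ∞ (Qplus β vp) (τ p, ξ p, η p) :=
    (contDiffAt_lap hvp).add (by fun_prop)
  obtain ⟨-, mx, my⟩ := chain hvm hwm
  obtain ⟨-, px, py⟩ := chain hvp hwp
  obtain ⟨Mt, Mx, My⟩ := chain hQm hPm
  obtain ⟨Pt, Px, Py⟩ := chain hQp hPp
  -- Each pulled-back equation is the equation in the new variables multiplied by T_t J.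
  have hk := mul_ne_zero hτt hJ
  simp only [SystemAt, bracket, mx, my, px, py, Mt, Mx, My, Pt, Px, Py]
  constructor
  · rintro ⟨h1, h2⟩
    constructor
    · linear_combination (Dt τ p * (Dx ξ p * Dy η p - Dx η p * Dy ξ p)) * h1
    · linear_combination (Dt τ p * (Dx ξ p * Dy η p - Dx η p * Dy ξ p)) * h2
  · rintro ⟨h1, h2⟩
    constructor
    · refine (mul_eq_zero.1
        (?_ : (Dt τ p * (Dx ξ p * Dy η p - Dx η p * Dy ξ p)) * _ = 0)).resolve_left hk
      linear_combination h1
    · refine (mul_eq_zero.1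
        (?_ : (Dt τ p * (Dx ξ p * Dy η p - Dx η p * Dy ξ p)) * _ = 0)).resolve_left hk
      linear_combination h2

end ChangeOfVariables

/-! ### Total derivatives and Laplacians along a graph -/

section Pullback

variable {f : Total → ℝ} {um up : Base → ℝ} {p : Base}

/-- The total derivative of a function of the independent and dependent variables. -/
theorem pd_pullback (hf : DifferentiableAt ℝ f (p, (um p, up p))) (hm : DifferentiableAt ℝ um p)
    (hp : DifferentiableAt ℝ up p) (e : Base) :
    pd e (fun q => f (q, (um q, up q))) p = pd (e, 0) f (p, (um p, up p))
      + pd eM f (p, (um p, up p)) * pd e um p + pd eP f (p, (um p, up p)) * pd e up p := by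
  have h1 := (hasFDerivAt_id p).prodMk (hm.hasFDerivAt.prodMk hp.hasFDerivAt)
  have h2 : HasFDerivAt (fun q => f (q, (um q, up q))) _ p :=
    HasFDerivAt.comp (f := fun q => (q, (um q, up q))) p hf.hasFDerivAt h1
  have h3 : (((ContinuousLinearMap.id ℝ Base).prod
      ((fderiv ℝ um p).prod (fderiv ℝ up p))) e : Total) =
      (e, 0) + fderiv ℝ um p e • eM + fderiv ℝ up p e • eP := by
    simp [eM, eP]
  rw [pd, h2.fderiv, ContinuousLinearMap.comp_apply, h3, map_add, map_add, map_smul, map_smul]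
  simp only [pd, smul_eq_mul]
  ring

theorem contDiffAt_pullback (hf : ContDiffAt ℝ ∞ f (p, (um p, up p)))
    (hm : ContDiffAt ℝ ∞ um p) (hp : ContDiffAt ℝ ∞ up p) :
    ContDiffAt ℝ ∞ (fun q => f (q, (um q, up q))) p :=
  ContDiffAt.comp (f := fun q => (q, (um q, up q))) p hf (contDiffAt_id.prodMk (hm.prodMk hp))

end Pullback

section PullbackOn

variable {Ω : Set Total} {f : Total → ℝ} {um up : Base → ℝ} {p : Base}

theorem eventually_graph_mem (hΩ : IsOpen Ω) (hm : ContDiffAt ℝ ∞ um p)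
    (hp : ContDiffAt ℝ ∞ up p) (hz : (p, (um p, up p)) ∈ Ω) :
    ∀ᶠ q in 𝓝 p, (q, (um q, up q)) ∈ Ω := by
  have hc : ContinuousAt (fun q => ((q, (um q, up q)) : Total)) p :=
    continuousAt_id.prodMk (hm.continuousAt.prodMk hp.continuousAt)
  exact hc.eventually (hΩ.mem_nhds hz)

theorem pd_pullback_eventually (hΩ : IsOpen Ω) (hf : ∀ z ∈ Ω, ContDiffAt ℝ ∞ f z)
    (hm : ContDiffAt ℝ ∞ um p) (hp : ContDiffAt ℝ ∞ up p) (hz : (p, (um p, up p)) ∈ Ω)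
    (e : Base) :
    ∀ᶠ q in 𝓝 p, pd e (fun q => f (q, (um q, up q))) q = pd (e, 0) f (q, (um q, up q))
      + pd eM f (q, (um q, up q)) * pd e um q + pd eP f (q, (um q, up q)) * pd e up q := by
  filter_upwards [eventually_graph_mem hΩ hm hp hz, eventually_differentiableAt hm,
    eventually_differentiableAt hp] with q h1 h2 h3
  exact pd_pullback (differentiableAt_of_smooth (hf _ h1)) h2 h3 e

/-- The Laplacian of the pullback to a graph of a function whose fiber derivatives do not depend
on the space variables and on the fiber variables. -/
theorem lap_pullback_eventually (hΩ : IsOpen Ω) (hf : ∀ z ∈ Ω, ContDiffAt ℝ ∞ f z)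
    (hfm : ∀ e, IsSpatial e → ∀ z ∈ Ω, pd e (pd eM f) z = 0)
    (hfp : ∀ e, IsSpatial e → ∀ z ∈ Ω, pd e (pd eP f) z = 0)
    (hm : ContDiffAt ℝ ∞ um p) (hp : ContDiffAt ℝ ∞ up p) (hz : (p, (um p, up p)) ∈ Ω) :
    ∀ᶠ q in 𝓝 p, lap (fun q => f (q, (um q, up q))) q =
      pd eX (pd eX f) (q, (um q, up q)) + pd eY (pd eY f) (q, (um q, up q))
        + pd eM f (q, (um q, up q)) * lap um q + pd eP f (q, (um q, up q)) * lap up q := by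
  have second : ∀ e : Base, IsSpatial (e, 0) →
      ∀ᶠ q in 𝓝 p, pd e (pd e (fun q => f (q, (um q, up q)))) q =
        pd (e, 0) (pd (e, 0) f) (q, (um q, up q))
        + pd eM f (q, (um q, up q)) * pd e (pd e um) q
        + pd eP f (q, (um q, up q)) * pd e (pd e up) q := by
    intro e he
    have sm : ∀ d, ∀ z ∈ Ω, ContDiffAt ℝ ∞ (pd d f) z := fun d z hz => contDiffAt_pd (hf z hz) d
    filter_upwards [pd_congr_eventually (pd_pullback_eventually hΩ hf hm hp hz e) e,
      pd_pullback_eventually hΩ (sm (e, 0)) hm hp hz e,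
      pd_pullback_eventually hΩ (sm eM) hm hp hz e,
      pd_pullback_eventually hΩ (sm eP) hm hp hz e, eventually_graph_mem hΩ hm hp hz,
      eventually_differentiableAt (contDiffAt_pullback (sm (e, 0) _ hz) hm hp),
      eventually_differentiableAt (contDiffAt_pullback (sm eM _ hz) hm hp),
      eventually_differentiableAt (contDiffAt_pullback (sm eP _ hz) hm hp),
      eventually_differentiableAt (contDiffAt_pd hm e),
      eventually_differentiableAt (contDiffAt_pd hp e)] with q a0 a1 a2 a3 hq d1 d2 d3 d4 d5
    rw [a0, pd_add (d1.fun_add (d2.fun_mul d4)) (d3.fun_mul d5), pd_add d1 (d2.fun_mul d4),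
      pd_mul d2 d4, pd_mul d3 d5, a1, a2, a3, hfm _ he _ hq, hfp _ he _ hq,
      hfm _ isSpatial_eM _ hq, hfm _ isSpatial_eP _ hq, hfp _ isSpatial_eM _ hq,
      hfp _ isSpatial_eP _ hq, pd_comm (hf _ hq) (e := eM), pd_comm (hf _ hq) (e := eP),
      hfm _ he _ hq, hfp _ he _ hq]
    ring
  filter_upwards [second (0, 1, 0) isSpatial_eX, second (0, 0, 1) isSpatial_eY] with q hx hy
  simp only [pd_ex, pd_ey] at hx hy
  simp only [lap, hx, hy]
  simp only [eX, eY]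
  ring

end PullbackOn

/-! ### The transformed system written in the original variables -/

section TransformedSystem

variable {F β : ℝ} {Ω : Set Total} {T X Y A B : Total → ℝ} {um up vm vp : Base → ℝ} {p : Base}
  {z : Total}

/-- The coefficient of the Laplacian of `ψ⁻` in the pullback of the baroclinic potential
vorticity. -/
def coeffMinus (X A : Total → ℝ) (z : Total) : ℝ := pd eM A z / gradSq X z

/-- The coefficient of the Laplacian of `ψ⁺` in the pullback of the barotropic potential
vorticity. -/
def coeffPlus (X B : Total → ℝ) (z : Total) : ℝ := pd eP B z / gradSq X z

/-- The inhomogeneity in the pullback of the barotropic potential vorticity. -/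
def forcing (β : ℝ) (X Y B : Total → ℝ) (z : Total) : ℝ :=
  (pd eX (pd eX B) z + pd eY (pd eY B) z) / gradSq X z + 2 * β * Y z

namespace FirstOrderOn

theorem smooth_coeffMinus (h : FirstOrderOn Ω T X Y A B) (hz : z ∈ Ω) :
    ContDiffAt ℝ ∞ (coeffMinus X A) z :=
  (contDiffAt_pd (h.smoothA z hz) _).div (contDiffAt_gradSq (h.smoothX z hz))
    (h.rows hz).2.2.2.1.ne'

theorem smooth_coeffPlus (h : FirstOrderOn Ω T X Y A B) (hz : z ∈ Ω) :
    ContDiffAt ℝ ∞ (coeffPlus X B) z :=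
  (contDiffAt_pd (h.smoothB z hz) _).div (contDiffAt_gradSq (h.smoothX z hz))
    (h.rows hz).2.2.2.1.ne'

theorem smooth_forcing (h : FirstOrderOn Ω T X Y A B) (hz : z ∈ Ω) :
    ContDiffAt ℝ ∞ (forcing β X Y B) z := by
  have h1 := fun e => contDiffAt_pd (contDiffAt_pd (h.smoothB z hz) e) e
  exact (((h1 eX).add (h1 eY)).div (contDiffAt_gradSq (h.smoothX z hz))
    (h.rows hz).2.2.2.1.ne').add (contDiffAt_const.mul (h.smoothY z hz))

theorem differentiableAt_quotient (h : FirstOrderOn Ω T X Y A B) (hz : z ∈ Ω) {f : Total → ℝ}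
    (hf : DifferentiableAt ℝ f z) : DifferentiableAt ℝ (fun z => f z / gradSq X z) z := by
  simp only [div_eq_mul_inv]
  exact hf.fun_mul ((differentiableAt_of_smooth (contDiffAt_gradSq (h.smoothX z hz))).fun_inv
    (h.rows hz).2.2.2.1.ne')

theorem pd_quotient (h : FirstOrderOn Ω T X Y A B) (hz : z ∈ Ω) {f : Total → ℝ}
    (hf : DifferentiableAt ℝ f z) {e : Total} (he : IsSpatial e) (hfe : pd e f z = 0) :
    pd e (fun z => f z / gradSq X z) z = 0 := by
  have hl := (h.rows hz).2.2.2.1.ne'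
  have dl := differentiableAt_of_smooth (contDiffAt_gradSq (h.smoothX z hz))
  have h1 : pd e (fun z => f z / gradSq X z * gradSq X z) z = pd e f z := by
    refine pd_eq_of_eqOn h.isOpen (fun z hz => ?_) e hz
    exact div_mul_cancel₀ _ (h.rows hz).2.2.2.1.ne'
  rw [pd_mul (f := fun z => f z / gradSq X z) (h.differentiableAt_quotient hz hf) dl,
    h.pd_gradSq he hz, hfe,
    mul_zero, add_zero] at h1
  exact (mul_eq_zero.1 h1).resolve_right hl

theorem pd_coeffMinus (h : FirstOrderOn Ω T X Y A B) {e : Total} (he : IsSpatial e)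
    (hz : z ∈ Ω) : pd e (coeffMinus X A) z = 0 :=
  h.pd_quotient hz (differentiableAt_of_smooth (contDiffAt_pd (h.smoothA z hz) _)) he
    (h.pd_Am he hz)

theorem pd_coeffPlus (h : FirstOrderOn Ω T X Y A B) {e : Total} (he : IsSpatial e)
    (hz : z ∈ Ω) : pd e (coeffPlus X B) z = 0 :=
  h.pd_quotient hz (differentiableAt_of_smooth (contDiffAt_pd (h.smoothB z hz) _)) he
    (h.pd_Bp he hz)

/-- B_{ψ⁻} = 0 and B_{ψ⁺} is constant in space, so B_xx + B_yy has no fiber derivatives; neither has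
λ or Y. -/
theorem pd_forcing (h : FirstOrderOn Ω T X Y A B) {e : Total} (he : e = eM ∨ e = eP)
    (hz : z ∈ Ω) : pd e (forcing β X Y B) z = 0 := by
  have hs : IsSpatial e := Or.inr (Or.inr he)
  have sB := fun d z (hz : z ∈ Ω) => contDiffAt_pd (h.smoothB z hz) d
  have dB := fun d => differentiableAt_of_smooth (contDiffAt_pd (sB d z hz) d)
  have third : ∀ d, IsSpatial d → pd e (pd d (pd d B)) z = 0 := by
    intro d hd
    refine pd_pd_eq_zero h.isOpen (sB d) (fun z hz => ?_) d hz
    rw [pd_comm (h.smoothB z hz)]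
    rcases he with rfl | rfl
    · exact pd_eq_zero_of_eqOn_const h.isOpen (fun z hz => (h.first z hz).Bm) d hz
    · exact h.pd_Bp hd hz
  have hY : pd e Y z = 0 := by
    rcases he with rfl | rfl
    · exact (h.first z hz).Ym
    · exact (h.first z hz).Yp
  have dY := differentiableAt_of_smooth (h.smoothY z hz)
  change pd e (fun z => (pd eX (pd eX B) z + pd eY (pd eY B) z) / gradSq X z + 2 * β * Y z) z = 0
  rw [pd_add (h.differentiableAt_quotient hz ((dB eX).fun_add (dB eY))) (dY.const_mul _),
    pd_const_mul _ dY,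
    hY, h.pd_quotient hz (f := fun z => pd eX (pd eX B) z + pd eY (pd eY B) z)
      ((dB eX).fun_add (dB eY)) hs (by
      rw [pd_add (dB eX) (dB eY), third _ isSpatial_eX, third _ isSpatial_eY, add_zero])]
  ring

/-- The system for the transformed functions in terms of the original functions. -/
theorem systemAt_iff (h : FirstOrderOn Ω T X Y A B) (hm : ContDiffAt ℝ ∞ um p)
    (hp : ContDiffAt ℝ ∞ up p) (hz : z ∈ Ω) (hzp : z = (p, (um p, up p)))
    (hvm : ContDiffAt ℝ ∞ vm (T z, X z, Y z)) (hvp : ContDiffAt ℝ ∞ vp (T z, X z, Y z))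
    (hgm : ∀ᶠ q in 𝓝 p, vm (T (q, (um q, up q)), X (q, (um q, up q)), Y (q, (um q, up q))) =
      A (q, (um q, up q)))
    (hgp : ∀ᶠ q in 𝓝 p, vp (T (q, (um q, up q)), X (q, (um q, up q)), Y (q, (um q, up q))) =
      B (q, (um q, up q))) :
    SystemAt F β vm vp (T z, X z, Y z) ↔
      2 * pd eP B z * (pd eT (coeffPlus X B) z * lap up p + coeffPlus X B z * Dt (lap up) p
          + pd eT (forcing β X Y B) z
          + 1 / 2 * (Dx up p * (coeffPlus X B z * Dy (lap up) p + pd eY (forcing β X Y B) z)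
            - Dy up p * (coeffPlus X B z * Dx (lap up) p + pd eX (forcing β X Y B) z)))
        + pd eM A z * (Dx um p * (coeffMinus X A z * Dy (lap um) p - 2 * F * pd eM A z * Dy um p)
          - Dy um p * (coeffMinus X A z * Dx (lap um) p - 2 * F * pd eM A z * Dx um p)) = 0 ∧
      2 * pd eP B z * (pd eT (coeffMinus X A) z * lap um p + coeffMinus X A z * Dt (lap um) p
          - 2 * F * (pd eT A z + pd eM A z * Dt um p)
          + 1 / 2 * (Dx up p * (coeffMinus X A z * Dy (lap um) p - 2 * F * pd eM A z * Dy um p)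
            - Dy up p * (coeffMinus X A z * Dx (lap um) p - 2 * F * pd eM A z * Dx um p)))
        + pd eM A z * (Dx um p * (coeffPlus X B z * Dy (lap up) p + pd eY (forcing β X Y B) z)
          - Dy um p * (coeffPlus X B z * Dx (lap up) p + pd eX (forcing β X Y B) z)) = 0 := by
  subst hzp
  have graph := eventually_graph_mem h.isOpen hm hp hz
  have base : ∀ {f : Total → ℝ}, (∀ z ∈ Ω, ContDiffAt ℝ ∞ f z) → (∀ z ∈ Ω, pd eM f z = 0) →
      (∀ z ∈ Ω, pd eP f z = 0) → ∀ e : Base, ∀ᶠ q in 𝓝 p,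
        pd e (fun q => f (q, (um q, up q))) q = pd (e, 0) f (q, (um q, up q)) := by
    intro f hf h1 h2 e
    filter_upwards [graph, pd_pullback_eventually h.isOpen hf hm hp hz e] with q hq hd
    rw [hd, h1 _ hq, h2 _ hq]
    ring
  have dT := base h.smoothT (fun z hz => (h.first z hz).Tm) (fun z hz => (h.first z hz).Tp)
  have dX := base h.smoothX (fun z hz => (h.first z hz).Xm) (fun z hz => (h.first z hz).Xp)
  have dY := base h.smoothY (fun z hz => (h.first z hz).Ym) (fun z hz => (h.first z hz).Yp)
  have const : ∀ {f : Total → ℝ}, (∀ z ∈ Ω, f z = 0) → ∀ e, IsSpatial e → ∀ z ∈ Ω,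
      pd e f z = 0 := fun hf e _ z hz => pd_eq_zero_of_eqOn_const h.isOpen hf e hz
  have lX := lap_pullback_eventually h.isOpen h.smoothX (const fun z hz => (h.first z hz).Xm)
    (const fun z hz => (h.first z hz).Xp) hm hp hz
  have lY := lap_pullback_eventually h.isOpen h.smoothY (const fun z hz => (h.first z hz).Ym)
    (const fun z hz => (h.first z hz).Yp) hm hp hz
  have lA := lap_pullback_eventually h.isOpen h.smoothA (fun e he z hz => h.pd_Am he hz)
    (const fun z hz => (h.first z hz).Ap) hm hp hz
  have lB := lap_pullback_eventually h.isOpen h.smoothB (const fun z hz => (h.first z hz).Bm)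
    (fun e he z hz => h.pd_Bp he hz) hm hp hz
  have sT := contDiffAt_pullback (h.smoothT _ hz) hm hp
  have sX := contDiffAt_pullback (h.smoothX _ hz) hm hp
  have sY := contDiffAt_pullback (h.smoothY _ hz) hm hp
  have hτx : ∀ᶠ q in 𝓝 p, Dx (fun q => T (q, (um q, up q))) q = 0 := by
    filter_upwards [graph, dT (0, 1, 0)] with q hq hd
    exact hd.trans (h.first _ hq).Tx
  have hτy : ∀ᶠ q in 𝓝 p, Dy (fun q => T (q, (um q, up q))) q = 0 := by
    filter_upwards [graph, dT (0, 0, 1)] with q hq hd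
    exact hd.trans (h.first _ hq).Ty
  have Xx : ∀ᶠ q in 𝓝 p, Dx (fun q => X (q, (um q, up q))) q = pd eX X (q, (um q, up q)) :=
    dX (0, 1, 0)
  have Xy : ∀ᶠ q in 𝓝 p, Dy (fun q => X (q, (um q, up q))) q = pd eY X (q, (um q, up q)) :=
    dX (0, 0, 1)
  have Yx : ∀ᶠ q in 𝓝 p, Dx (fun q => Y (q, (um q, up q))) q = pd eX Y (q, (um q, up q)) :=
    dY (0, 1, 0)
  have Yy : ∀ᶠ q in 𝓝 p, Dy (fun q => Y (q, (um q, up q))) q = pd eY Y (q, (um q, up q)) :=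
    dY (0, 0, 1)
  have hlξ : ∀ᶠ q in 𝓝 p, lap (fun q => X (q, (um q, up q))) q = 0 := by
    filter_upwards [graph, lX] with q hq hd
    rw [hd, (h.harmonic hq).1, (h.first _ hq).Xm, (h.first _ hq).Xp]
    ring
  have hlη : ∀ᶠ q in 𝓝 p, lap (fun q => Y (q, (um q, up q))) q = 0 := by
    filter_upwards [graph, lY] with q hq hd
    rw [hd, (h.harmonic hq).2, (h.first _ hq).Ym, (h.first _ hq).Yp]
    ring
  have horth : ∀ᶠ q in 𝓝 p, Dx (fun q => X (q, (um q, up q))) q *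
      Dx (fun q => Y (q, (um q, up q))) q + Dy (fun q => X (q, (um q, up q))) q *
      Dy (fun q => Y (q, (um q, up q))) q = 0 := by
    filter_upwards [graph, Xx, Xy, Yx, Yy] with q hq a1 a2 a3 a4
    rw [a1, a2, a3, a4, (h.rows hq).1]
  have hlen : ∀ᶠ q in 𝓝 p, Dx (fun q => Y (q, (um q, up q))) q ^ 2 +
      Dy (fun q => Y (q, (um q, up q))) q ^ 2 = Dx (fun q => X (q, (um q, up q))) q ^ 2 +
      Dy (fun q => X (q, (um q, up q))) q ^ 2 := by
    filter_upwards [graph, Xx, Xy, Yx, Yy] with q hq a1 a2 a3 a4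
    rw [a1, a2, a3, a4, (h.rows hq).2.1]
    rfl
  have Lm := lap_comp_eventually hvm sT sX sY hgm hτx hτy hlξ hlη horth hlen
  have Lp := lap_comp_eventually hvp sT sX sY hgp hτx hτy hlξ hlη horth hlen
  -- Conformality multiplies the Laplacian by λ under pullback. A contributes no inhomogeneity
  -- because A_x = A_y = 0, in contrast to B, whose spatial Laplacian enters the forcing below.
  have hPm : ∀ᶠ q in 𝓝 p, Qminus F vm
      (T (q, (um q, up q)), X (q, (um q, up q)), Y (q, (um q, up q))) =
        coeffMinus X A (q, (um q, up q)) * lap um q - 2 * F * A (q, (um q, up q)) := by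
    filter_upwards [graph, Lm, lA, hgm, Xx, Xy] with q hq a1 a2 a3 a4 a5
    have hl := (h.rows hq).2.2.2.1.ne'
    rw [Qminus, a3, coeffMinus]
    rw [a2, a4, a5, pd_eq_zero_of_eqOn_const h.isOpen (fun z hz => (h.first z hz).Ax) _ hq,
      pd_eq_zero_of_eqOn_const h.isOpen (fun z hz => (h.first z hz).Ay) _ hq,
      (h.first _ hq).Ap] at a1
    congr 1
    rw [div_mul_eq_mul_div, eq_div_iff hl, gradSq]
    linarith
  have hPp : ∀ᶠ q in 𝓝 p, Qplus β vp
      (T (q, (um q, up q)), X (q, (um q, up q)), Y (q, (um q, up q))) =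
        coeffPlus X B (q, (um q, up q)) * lap up q + forcing β X Y B (q, (um q, up q)) := by
    filter_upwards [graph, Lp, lB, Xx, Xy] with q hq a1 a2 a4 a5
    have hl := (h.rows hq).2.2.2.1.ne'
    rw [Qplus, coeffPlus, forcing, ← add_assoc]
    rw [a2, a4, a5, (h.first _ hq).Bm] at a1
    congr 1
    rw [div_mul_eq_mul_div, ← add_div, eq_div_iff hl, gradSq]
    linarith
  have dm := differentiableAt_of_smooth hm
  have dp := differentiableAt_of_smooth hp
  have dlm := differentiableAt_of_smooth (contDiffAt_lap hm)
  have dlp := differentiableAt_of_smooth (contDiffAt_lap hp)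
  have dA := differentiableAt_of_smooth (h.smoothA _ hz)
  have pA := fun e => pd_pullback dA dm dp e
  have pB := fun e => pd_pullback (differentiableAt_of_smooth (h.smoothB _ hz)) dm dp e
  have dG := differentiableAt_of_smooth (h.smooth_coeffMinus hz)
  have dH := differentiableAt_of_smooth (h.smooth_coeffPlus hz)
  have dK := differentiableAt_of_smooth (h.smooth_forcing (β := β) hz)
  have jA := differentiableAt_of_smooth (contDiffAt_pullback (h.smoothA _ hz) hm hp)
  have jG := differentiableAt_of_smooth (contDiffAt_pullback (h.smooth_coeffMinus hz) hm hp)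
  have jH := differentiableAt_of_smooth (contDiffAt_pullback (h.smooth_coeffPlus hz) hm hp)
  have jK := differentiableAt_of_smooth
    (contDiffAt_pullback (h.smooth_forcing (β := β) hz) hm hp)
  have f := h.first _ hz
  have pPm : ∀ e : Base, pd e (fun q => coeffMinus X A (q, (um q, up q)) * lap um q
      - 2 * F * A (q, (um q, up q))) p = pd (e, 0) (coeffMinus X A) (p, (um p, up p)) * lap um p
        + coeffMinus X A (p, (um p, up p)) * pd e (lap um) p
        - 2 * F * (pd (e, 0) A (p, (um p, up p)) + pd eM A (p, (um p, up p)) * pd e um p) := by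
    intro e
    rw [pd_sub (jG.fun_mul dlm) (jA.const_mul _), pd_mul jG dlm, pd_const_mul _ jA, pA e,
      pd_pullback dG dm dp e, h.pd_coeffMinus isSpatial_eM hz, h.pd_coeffMinus isSpatial_eP hz,
      f.Ap]
    ring
  have pPp : ∀ e : Base, pd e (fun q => coeffPlus X B (q, (um q, up q)) * lap up q
      + forcing β X Y B (q, (um q, up q))) p =
        pd (e, 0) (coeffPlus X B) (p, (um p, up p)) * lap up p
        + coeffPlus X B (p, (um p, up p)) * pd e (lap up) p
        + pd (e, 0) (forcing β X Y B) (p, (um p, up p)) := by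
    intro e
    rw [pd_add (jH.fun_mul dlp) jK, pd_mul jH dlp, pd_pullback dH dm dp e,
      pd_pullback dK dm dp e, h.pd_coeffPlus isSpatial_eM hz, h.pd_coeffPlus isSpatial_eP hz,
      h.pd_forcing (Or.inl rfl) hz, h.pd_forcing (Or.inr rfl) hz]
    ring
  have Pmt := pPm (1, 0, 0)
  have Pmx := pPm (0, 1, 0)
  have Pmy := pPm (0, 0, 1)
  have Ppt := pPp (1, 0, 0)
  have Ppx := pPp (0, 1, 0)
  have Ppy := pPp (0, 0, 1)
  have Ax := pA (0, 1, 0)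
  have Ay := pA (0, 0, 1)
  have Bx := pB (0, 1, 0)
  have By := pB (0, 0, 1)
  have Tt := (dT (1, 0, 0)).self_of_nhds
  have Xt := (dX (1, 0, 0)).self_of_nhds
  have Yt := (dY (1, 0, 0)).self_of_nhds
  change _ = pd eX A _ + _ + _ at Ax
  change _ = pd eY A _ + _ + _ at Ay
  change _ = pd eX B _ + _ + _ at Bx
  change _ = pd eY B _ + _ + _ at By
  change _ = pd eT T _ at Tt
  change _ = pd eT X _ at Xt
  change _ = pd eT Y _ at Yt
  change _ = pd eT (coeffMinus X A) _ * _ + _ - 2 * F * (pd eT A _ + _) at Pmt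
  change _ = pd eX (coeffMinus X A) _ * _ + _ - 2 * F * (pd eX A _ + _) at Pmx
  change _ = pd eY (coeffMinus X A) _ * _ + _ - 2 * F * (pd eY A _ + _) at Pmy
  change _ = pd eT (coeffPlus X B) _ * _ + _ + pd eT (forcing β X Y B) _ at Ppt
  change _ = pd eX (coeffPlus X B) _ * _ + _ + pd eX (forcing β X Y B) _ at Ppx
  change _ = pd eY (coeffPlus X B) _ * _ + _ + pd eY (forcing β X Y B) _ at Ppy
  rw [f.Ax, f.Ap] at Ax
  rw [f.Ay, f.Ap] at Ay
  rw [f.Bm] at Bx By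
  rw [f.Ax, h.pd_coeffMinus isSpatial_eX hz] at Pmx
  rw [f.Ay, h.pd_coeffMinus isSpatial_eY hz] at Pmy
  rw [h.pd_coeffPlus isSpatial_eX hz] at Ppx
  rw [h.pd_coeffPlus isSpatial_eY hz] at Ppy
  simp only [pd_et, pd_ex, pd_ey] at Pmt Pmx Pmy Ppt Ppx Ppy Ax Ay Bx By Tt Xt Yt
  rw [systemAt_comp_iff hvm hvp sT sX sY hgm hgp hPm hPp hτx.self_of_nhds hτy.self_of_nhds
    (by rw [Tt]; exact f.Tt_ne)
    (by rw [Xx.self_of_nhds, Xy.self_of_nhds, Yx.self_of_nhds, Yy.self_of_nhds]; exact f.jac_ne)]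
  simp only [bracket, Tt, Xt, Yt, Xx.self_of_nhds, Xy.self_of_nhds, Yx.self_of_nhds,
    Yy.self_of_nhds, Pmt, Pmx, Pmy, Ppt, Ppx, Ppy, Ax, Ay, Bx, By]
  rw [← f.Bp]
  -- The convection terms caused by X_t and Y_t cancel against the B_x and B_y parts of the bracket
  -- with the new ψ⁺: this is the content of the first-order relations for B_x and B_y.
  have ht := f.Tt_ne
  have hBx := f.Bx
  have hBy := f.By
  constructor
  · rintro ⟨h1, h2⟩
    constructor
    · refine (mul_eq_zero.1 (?_ : pd eT T (p, (um p, up p)) * _ = 0)).resolve_left ht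
      linear_combination 2 * h1
        - (coeffPlus X B (p, (um p, up p)) * Dy (lap up) p
          + pd eY (forcing β X Y B) (p, (um p, up p))) * hBx
        + (coeffPlus X B (p, (um p, up p)) * Dx (lap up) p
          + pd eX (forcing β X Y B) (p, (um p, up p))) * hBy
    · refine (mul_eq_zero.1 (?_ : pd eT T (p, (um p, up p)) * _ = 0)).resolve_left ht
      linear_combination 2 * h2
        - (coeffMinus X A (p, (um p, up p)) * Dy (lap um) p
          - 2 * F * pd eM A (p, (um p, up p)) * Dy um p) * hBx
        + (coeffMinus X A (p, (um p, up p)) * Dx (lap um) p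
          - 2 * F * pd eM A (p, (um p, up p)) * Dx um p) * hBy
  · rintro ⟨h1, h2⟩
    constructor
    · linear_combination 1 / 2 * pd eT T (p, (um p, up p)) * h1
        + 1 / 2 * (coeffPlus X B (p, (um p, up p)) * Dy (lap up) p
          + pd eY (forcing β X Y B) (p, (um p, up p))) * hBx
        - 1 / 2 * (coeffPlus X B (p, (um p, up p)) * Dx (lap up) p
          + pd eX (forcing β X Y B) (p, (um p, up p))) * hBy
    · linear_combination 1 / 2 * pd eT T (p, (um p, up p)) * h2
        + 1 / 2 * (coeffMinus X A (p, (um p, up p)) * Dy (lap um) p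
          - 2 * F * pd eM A (p, (um p, up p)) * Dy um p) * hBx
        - 1 / 2 * (coeffMinus X A (p, (um p, up p)) * Dx (lap um) p
          - 2 * F * pd eM A (p, (um p, up p)) * Dx um p) * hBy

end FirstOrderOn

end TransformedSystem

/-! ### Conditions from the lower-order terms -/

section LowerOrder

variable {F β : ℝ} {Ω : Set Total} {Φ : Total → Total} {T X Y A B : Total → ℝ} {z : Total}

theorem fderiv_components {φ : Base → Base} {p : Base} (hφ : DifferentiableAt ℝ φ p) (e : Base) :
    fderiv ℝ φ p e = (pd e (fun q => (φ q).1) p, pd e (fun q => (φ q).2.1) p,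
      pd e (fun q => (φ q).2.2) p) := by
  have h := hφ.hasFDerivAt
  refine Prod.ext ?_ (Prod.ext ?_ ?_)
  · simp only [pd, h.fst.fderiv]; rfl
  · simp only [pd, h.snd.fst.fderiv]; rfl
  · simp only [pd, h.snd.snd.fderiv]; rfl

/-- The consequences of the invariance of the system for the lower-order terms, at an arbitrary
jet. -/
theorem IsPointSymmetry.jet_identity (hΩ : IsOpen Ω) (hsym : IsPointSymmetry F β Ω Φ)
    (hz : z ∈ Ω) (hT : T = fun z => (Φ z).1.1) (hX : X = fun z => (Φ z).1.2.1)
    (hY : Y = fun z => (Φ z).1.2.2) (hA : A = fun z => (Φ z).2.1) (hB : B = fun z => (Φ z).2.2)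
    (mt mx my px py a₄ b₄ : ℝ) :
    pd eT (coeffPlus X B) z * b₄ - coeffPlus X B z * β * px + pd eT (forcing β X Y B) z
      + 1 / 2 * (px * pd eY (forcing β X Y B) z - py * pd eX (forcing β X Y B) z) = 0 ∧
    2 * pd eP B z * (pd eT (coeffMinus X A) z * a₄
        + coeffMinus X A z * (2 * F * mt + F * (px * my - py * mx) - β * mx)
        - 2 * F * (pd eT A z + pd eM A z * mt) - F * pd eM A z * (px * my - py * mx))
      + pd eM A z * (mx * pd eY (forcing β X Y B) z - my * pd eX (forcing β X Y B) z) = 0 := by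
  have h : FirstOrderOn Ω T X Y A B := by
    rw [hT, hX, hY, hA, hB]; exact hsym.firstOrderOn hΩ
  obtain ⟨p, s⟩ := z
  -- The derivative ∂_tψ⁺ does not enter the system, so it is set to 0; the other first derivatives
  -- and the two Laplacians stay free.
  obtain ⟨um, up, hum, hup, hums, hups, hsys, hLm, hLp, hlm, hlp, hdm, hdp⟩ :=
    exists_jet F β p s (jetMap (mt, 0) (mx, px) (my, py)) a₄ b₄
  obtain rfl : s = (um p, up p) := Prod.ext hums.symm hups.symm
  have f := h.first _ hz
  have hΦ : ContDiffAt ℝ ∞ Φ (p, (um p, up p)) :=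
    hsym.pointTransformation.smooth.contDiffAt (hΩ.mem_nhds hz)
  have hu : ContDiffAt ℝ ∞ (fun q => (um q, up q)) p := (hum.prodMk hup).contDiffAt
  have hφ : DifferentiableAt ℝ (fun q => (Φ (q, (um q, up q))).1) p :=
    (contDiffAt_prolong hΦ hu).fst.differentiableAt (by simp)
  have dm := hum.differentiable (by simp) p
  have dp := hup.differentiable (by simp) p
  have hd : ∀ e, fderiv ℝ (fun q => (Φ (q, (um q, up q))).1) p e =
      (pd (e, 0) T (p, (um p, up p)), pd (e, 0) X (p, (um p, up p)),
        pd (e, 0) Y (p, (um p, up p))) := by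
    intro e
    have h1 := pd_pullback (differentiableAt_of_smooth (h.smoothT _ hz)) dm dp e
    have h2 := pd_pullback (differentiableAt_of_smooth (h.smoothX _ hz)) dm dp e
    have h3 := pd_pullback (differentiableAt_of_smooth (h.smoothY _ hz)) dm dp e
    rw [f.Tm, f.Tp, zero_mul, zero_mul, add_zero, add_zero] at h1
    rw [f.Xm, f.Xp, zero_mul, zero_mul, add_zero, add_zero] at h2
    rw [f.Ym, f.Yp, zero_mul, zero_mul, add_zero, add_zero] at h3
    rw [fderiv_components hφ, ← h1, ← h2, ← h3, hT, hX, hY]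
  obtain ⟨v, hv, ht⟩ := exists_transforms hΦ hu (det_ne_zero_of_jac (by
    rw [hd, hd, hd, jac_of_time_eq_zero f.Tx f.Ty]
    exact mul_ne_zero f.Tt_ne f.jac_ne))
  have key := hsym.preserves _ v p hu hz hv ht hsys
  have hpt : (Φ (p, (um p, up p))).1 = (T (p, (um p, up p)), X (p, (um p, up p)),
      Y (p, (um p, up p))) := by rw [hT, hX, hY]
  rw [hpt] at key hv
  rw [h.systemAt_iff hum.contDiffAt hup.contDiffAt hz rfl hv.fst hv.snd
    (ht.graph.mono fun q hq => by
      rw [hT, hX, hY, hA]; exact congrArg Prod.fst hq)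
    (ht.graph.mono fun q hq => by
      rw [hT, hX, hY, hB]; exact congrArg Prod.snd hq)] at key
  simp only [← pd_et, ← pd_ex, ← pd_ey, hLm, hLp, hlm, hlp, hdm, hdp, jetMap_apply] at key
  simp only [one_smul, zero_smul, add_zero, zero_add, mul_one, mul_zero] at key
  obtain ⟨k1, k2⟩ := key
  constructor
  · refine (mul_eq_zero.1 (?_ : 2 * pd eP B (p, (um p, up p)) * _ = 0)).resolve_left
      (mul_ne_zero two_ne_zero (h.Bp_ne hz))
    linear_combination k1
  · linear_combination k2

/-- The restrictions on the components of a point symmetry that follow from the invariance of the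
lower-order terms of the system. -/
theorem IsPointSymmetry.lower_order (hΩ : IsOpen Ω) (hsym : IsPointSymmetry F β Ω Φ)
    (hFβ : F * β ≠ 0)
    (hz : z ∈ Ω) (hT : T = fun z => (Φ z).1.1) (hX : X = fun z => (Φ z).1.2.1)
    (hY : Y = fun z => (Φ z).1.2.2) (hA : A = fun z => (Φ z).2.1) (hB : B = fun z => (Φ z).2.2) :
    pd eT A z = 0 ∧ gradSq X z = 1 ∧ pd eX (forcing β X Y B) z = 0 ∧
      pd eY (forcing β X Y B) z = 2 * β * pd eP B z ∧ pd eT (forcing β X Y B) z = 0 := by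
  have h : FirstOrderOn Ω T X Y A B := by
    rw [hT, hX, hY, hA, hB]; exact hsym.firstOrderOn hΩ
  have key := hsym.jet_identity hΩ hz hT hX hY hA hB
  have hF : F ≠ 0 := left_ne_zero_of_mul hFβ
  have hκ := h.Bp_ne hz
  have hα := h.Am_ne hz
  have hl := (h.rows hz).2.2.2.1.ne'
  -- Comparing coefficients of the free jet variables: the constant terms give A_t and the
  -- t-derivative of the forcing, `mt` gives λ = 1, and `mx`, `my` give the spatial gradient of the
  -- forcing. F is cancelled in the steps for A_t and λ.
  have k0 := key 0 0 0 0 0 0 0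
  have kt := (key 1 0 0 0 0 0 0).2
  have kx := (key 0 1 0 0 0 0 0).2
  have ky := (key 0 0 1 0 0 0 0).2
  have hAt : pd eT A z = 0 := by
    refine (mul_eq_zero.1 (?_ : F * pd eP B z * _ = 0)).resolve_left (mul_ne_zero hF hκ)
    linear_combination (-1 / 4) * k0.2
  have hG : coeffMinus X A z = pd eM A z := by
    refine sub_eq_zero.1 ((mul_eq_zero.1 (?_ : F * pd eP B z * _ = 0)).resolve_left
      (mul_ne_zero hF hκ))
    linear_combination 1 / 4 * (kt - k0.2)
  refine ⟨hAt, ?_, ?_, ?_, ?_⟩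
  · rw [coeffMinus, div_eq_iff hl] at hG
    exact mul_left_cancel₀ hα (by rw [← hG, mul_one])
  · refine (mul_eq_zero.1 (?_ : pd eM A z * _ = 0)).resolve_left hα
    linear_combination k0.2 - ky
  · refine mul_left_cancel₀ hα ?_
    rw [hG] at kx
    rw [hAt] at kx
    linear_combination kx
  · linear_combination k0.1

end LowerOrder

/-! ### Rigid motions, and the exclusion of rotations by the β-term -/

section Rigidity

variable {F β : ℝ} {Ω : Set Total} {Φ : Total → Total} {T X Y A B : Total → ℝ} {z : Total}

/-- A harmonic function whose gradient has constant length is affine. -/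
theorem hessian_eq_zero {f : Total → ℝ} (hΩ : IsOpen Ω) (hf : ∀ z ∈ Ω, ContDiffAt ℝ ∞ f z)
    (hgrad : ∀ z ∈ Ω, pd eX f z ^ 2 + pd eY f z ^ 2 = 1)
    (hharm : ∀ z ∈ Ω, pd eX (pd eX f) z + pd eY (pd eY f) z = 0) (hz : z ∈ Ω) :
    pd eX (pd eX f) z = 0 ∧ pd eX (pd eY f) z = 0 ∧ pd eY (pd eX f) z = 0 ∧
      pd eY (pd eY f) z = 0 := by
  have d := fun e => differentiableAt_of_smooth (contDiffAt_pd (hf z hz) e)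
  -- Differentiating |∇f|² = 1 shows that the spatial Hessian annihilates ∇f ≠ 0. A symmetric
  -- trace-free 2×2 matrix has determinant −(f_xx² + f_xy²), so a nontrivial kernel makes it zero.
  have h1 : ∀ e, pd e (fun z => pd eX f z * pd eX f z + pd eY f z * pd eY f z) z = 0 := fun e =>
    pd_eq_zero_of_eqOn_const hΩ (c := 1) (fun z hz => by rw [← hgrad z hz]; ring) e hz
  simp only [pd_add ((d eX).fun_mul (d eX)) ((d eY).fun_mul (d eY)), pd_mul (d eX) (d eX),
    pd_mul (d eY) (d eY)] at h1
  have hx := h1 eX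
  have hy := h1 eY
  have c : pd eY (pd eX f) z = pd eX (pd eY f) z := pd_comm (hf z hz)
  have hh := hharm z hz
  have hg := hgrad z hz
  rw [c] at hy ⊢
  have hyy : pd eY (pd eY f) z = -pd eX (pd eX f) z := by linarith
  rw [hyy] at hy ⊢
  have r1 : pd eX (pd eX f) z = 0 := by
    linear_combination (-pd eX (pd eX f) z) * hg + 1 / 2 * pd eX f z * hx
      - 1 / 2 * pd eY f z * hy
  have r2 : pd eX (pd eY f) z = 0 := by
    linear_combination (-pd eX (pd eY f) z) * hg + 1 / 2 * pd eY f z * hx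
      + 1 / 2 * pd eX f z * hy
  exact ⟨r1, r2, r2, by rw [r1, neg_zero]⟩

/-- Leibniz rule in the shape of the relations for T_t B_x and T_t B_y when one factor of each
product is constant along e. Applied twice, it reaches the third derivatives of B. -/
theorem pd_bilinear {f t a b c d : Total → ℝ} (hΩ : IsOpen Ω) {k : ℝ} {e : Total}
    (h : ∀ z ∈ Ω, t z * f z = k * (a z * b z - c z * d z)) (hz : z ∈ Ω)
    (ht : ContDiffAt ℝ ∞ t z) (hf : ContDiffAt ℝ ∞ f z) (ha : ContDiffAt ℝ ∞ a z)
    (hb : ContDiffAt ℝ ∞ b z) (hc : ContDiffAt ℝ ∞ c z) (hd : ContDiffAt ℝ ∞ d z)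
    (te : pd e t z = 0) (ae : pd e a z = 0) (ce : pd e c z = 0) :
    t z * pd e f z = k * (a z * pd e b z - c z * pd e d z) := by
  have h1 := pd_eq_of_eqOn hΩ (f := fun z => t z * f z)
    (g := fun z => k * (a z * b z - c z * d z)) h e hz
  have da := differentiableAt_of_smooth ha
  have db := differentiableAt_of_smooth hb
  have dc := differentiableAt_of_smooth hc
  have dd := differentiableAt_of_smooth hd
  rw [pd_mul (differentiableAt_of_smooth ht) (differentiableAt_of_smooth hf),
    pd_const_mul _ ((da.fun_mul db).fun_sub (dc.fun_mul dd)),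
    pd_sub (da.fun_mul db) (dc.fun_mul dd), pd_mul da db, pd_mul dc dd, te, ae, ce] at h1
  linarith

/-- The differential equations that determine the components of a point symmetry. -/
structure DeterminingEquations (T X Y A B : Total → ℝ) (z : Total) : Prop where
  Xy : pd eY X z = 0
  Yx : pd eX Y z = 0
  Yt : pd eT Y z = 0
  Yy : pd eY Y z = pd eP B z
  Tt : pd eT T z = pd eX X z
  Xx_sq : pd eX X z ^ 2 = 1
  Bp_sq : pd eP B z ^ 2 = 1
  Am_sq : pd eM A z ^ 2 = 1
  At : pd eT A z = 0
  Bx : pd eX B z = 0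
  By : pd eY B z = -2 * pd eX X z * pd eP B z * pd eT X z

/-- The third derivatives in the space variables of the new barotropic stream function vanish. -/
theorem FirstOrderOn.pd_lap_B (h : FirstOrderOn Ω T X Y A B)
    (hX : ∀ z ∈ Ω, pd eX X z ^ 2 + pd eY X z ^ 2 = 1) {e : Total} (he : e = eX ∨ e = eY)
    (hz : z ∈ Ω) : pd e (pd eX (pd eX B)) z = 0 ∧ pd e (pd eY (pd eY B)) z = 0 := by
  have hs : IsSpatial e := he.imp_right Or.inl
  have HX := fun z hz => hessian_eq_zero (z := z) h.isOpen h.smoothX hX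
    (fun z hz => (h.harmonic hz).1) hz
  have HY := fun z hz => hessian_eq_zero (z := z) h.isOpen h.smoothY
    (fun z hz => by rw [(h.rows hz).2.1]; exact hX z hz) (fun z hz => (h.harmonic hz).2) hz
  have sT := fun z hz => contDiffAt_pd (h.smoothT z hz) eT
  have sX := fun d z hz => contDiffAt_pd (h.smoothX z hz) d
  have sY := fun d z hz => contDiffAt_pd (h.smoothY z hz) d
  have sB := fun d z hz => contDiffAt_pd (h.smoothB z hz) d
  have mixed : ∀ {f : Total → ℝ} {d : Total}, (∀ z ∈ Ω, ContDiffAt ℝ ∞ f z) →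
      (∀ z ∈ Ω, pd e (pd d f) z = 0) → pd e (pd d (pd eT f)) z = 0 := by
    intro f d hf hd
    rw [pd_eq_of_eqOn h.isOpen (g := pd eT (pd d f)) (fun z hz => pd_comm (hf z hz)) e hz]
    exact pd_pd_eq_zero h.isOpen (fun z hz => contDiffAt_pd (hf z hz) d) hd eT hz
  have eXx : ∀ z ∈ Ω, pd e (pd eX X) z = 0 := by
    rcases he with rfl | rfl
    exacts [fun z hz => (HX z hz).1, fun z hz => (HX z hz).2.2.1]
  have eXy : ∀ z ∈ Ω, pd e (pd eY X) z = 0 := by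
    rcases he with rfl | rfl
    exacts [fun z hz => (HX z hz).2.1, fun z hz => (HX z hz).2.2.2]
  have eYx : ∀ z ∈ Ω, pd e (pd eX Y) z = 0 := by
    rcases he with rfl | rfl
    exacts [fun z hz => (HY z hz).1, fun z hz => (HY z hz).2.2.1]
  have eYy : ∀ z ∈ Ω, pd e (pd eY Y) z = 0 := by
    rcases he with rfl | rfl
    exacts [fun z hz => (HY z hz).2.1, fun z hz => (HY z hz).2.2.2]
  have hBxx : ∀ z ∈ Ω, pd eT T z * pd eX (pd eX B) z =
      2 * (pd eX X z * pd eX (pd eT Y) z - pd eX Y z * pd eX (pd eT X) z) := fun z hz =>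
    pd_bilinear h.isOpen (fun z hz => (h.first z hz).Bx) hz (sT z hz) (sB _ z hz) (sX _ z hz)
      (sY _ z hz) (sY _ z hz) (sX _ z hz) (h.pd_Tt isSpatial_eX hz) (HX z hz).1 (HY z hz).1
  have hByy : ∀ z ∈ Ω, pd eT T z * pd eY (pd eY B) z =
      -2 * (pd eY Y z * pd eY (pd eT X) z - pd eY X z * pd eY (pd eT Y) z) := fun z hz =>
    pd_bilinear h.isOpen (fun z hz => (h.first z hz).By) hz (sT z hz) (sB _ z hz) (sY _ z hz)
      (sX _ z hz) (sX _ z hz) (sY _ z hz) (h.pd_Tt isSpatial_eY hz) (HY z hz).2.2.2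
      (HX z hz).2.2.2
  -- After the second differentiation the right-hand sides contain only t-derivatives of spatial
  -- second derivatives of X and Y, which vanish by `mixed`.
  have r1 := pd_bilinear h.isOpen hBxx hz (sT z hz) (contDiffAt_pd (sB _ z hz) _) (sX _ z hz)
    (contDiffAt_pd (sY _ z hz) _) (sY _ z hz) (contDiffAt_pd (sX _ z hz) _) (h.pd_Tt hs hz)
    (eXx z hz) (eYx z hz)
  have r2 := pd_bilinear h.isOpen hByy hz (sT z hz) (contDiffAt_pd (sB _ z hz) _) (sY _ z hz)
    (contDiffAt_pd (sX _ z hz) _) (sX _ z hz) (contDiffAt_pd (sY _ z hz) _) (h.pd_Tt hs hz)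
    (eYy z hz) (eXy z hz)
  rw [mixed h.smoothX eXx, mixed h.smoothY eYx] at r1
  rw [mixed h.smoothX eXy, mixed h.smoothY eYy] at r2
  constructor
  · exact (mul_eq_zero.1 (r1.trans (by ring))).resolve_left (h.first z hz).Tt_ne
  · exact (mul_eq_zero.1 (r2.trans (by ring))).resolve_left (h.first z hz).Tt_ne

/-- With λ = 1 the forcing is ΔB + 2βY, and the spatial derivatives of ΔB vanish. Its known gradient
(0, 2βB_{ψ⁺}) then gives Y_x = 0 and Y_y = B_{ψ⁺}, since β ≠ 0; conformality yields X_y = 0 and X_x²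
= 1. -/
theorem FirstOrderOn.determiningEquations (h : FirstOrderOn Ω T X Y A B) (hβ : β ≠ 0)
    (hlow : ∀ z ∈ Ω, pd eT A z = 0 ∧ gradSq X z = 1 ∧ pd eX (forcing β X Y B) z = 0 ∧
      pd eY (forcing β X Y B) z = 2 * β * pd eP B z ∧ pd eT (forcing β X Y B) z = 0) :
    ∀ z ∈ Ω, DeterminingEquations T X Y A B z := by
  have hX : ∀ z ∈ Ω, pd eX X z ^ 2 + pd eY X z ^ 2 = 1 := fun z hz => (hlow z hz).2.1
  have sB := fun d z hz => contDiffAt_pd (contDiffAt_pd (h.smoothB z hz) d) d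
  have dB := fun d z hz => differentiableAt_of_smooth (sB d z hz)
  have dY := fun z hz => differentiableAt_of_smooth (h.smoothY z hz)
  have hK : ∀ z ∈ Ω, ∀ e, pd e (forcing β X Y B) z =
      pd e (pd eX (pd eX B)) z + pd e (pd eY (pd eY B)) z + 2 * β * pd e Y z := by
    intro z hz e
    rw [pd_eq_of_eqOn h.isOpen (g := fun z => pd eX (pd eX B) z + pd eY (pd eY B) z
      + 2 * β * Y z) (fun z hz => by rw [forcing, (hlow z hz).2.1, div_one]) e hz,
      pd_add ((dB eX z hz).fun_add (dB eY z hz)) ((dY z hz).const_mul _),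
      pd_add (dB eX z hz) (dB eY z hz), pd_const_mul _ (dY z hz)]
  have h2β : 2 * β ≠ 0 := mul_ne_zero two_ne_zero hβ
  have Yx : ∀ z ∈ Ω, pd eX Y z = 0 := by
    intro z hz
    have h1 := hK z hz eX
    rw [(hlow z hz).2.2.1, (h.pd_lap_B hX (Or.inl rfl) hz).1,
      (h.pd_lap_B hX (Or.inl rfl) hz).2] at h1
    exact (mul_eq_zero.1 (by linarith : 2 * β * pd eX Y z = 0)).resolve_left h2β
  have Yy : ∀ z ∈ Ω, pd eY Y z = pd eP B z := by
    intro z hz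
    have h1 := hK z hz eY
    rw [(hlow z hz).2.2.2.1, (h.pd_lap_B hX (Or.inr rfl) hz).1,
      (h.pd_lap_B hX (Or.inr rfl) hz).2] at h1
    exact mul_left_cancel₀ h2β (by linarith)
  have Bp_sq : ∀ z ∈ Ω, pd eP B z ^ 2 = 1 := by
    intro z hz
    have h1 := (h.rows hz).2.1
    rw [Yx z hz, Yy z hz, (hlow z hz).2.1] at h1
    linarith
  have Xy : ∀ z ∈ Ω, pd eY X z = 0 := by
    intro z hz
    have h1 := (h.rows hz).1
    rw [Yx z hz, Yy z hz, mul_zero, zero_add] at h1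
    exact (mul_eq_zero.1 h1).resolve_right (h.Bp_ne hz)
  have Xx_sq : ∀ z ∈ Ω, pd eX X z ^ 2 = 1 := by
    intro z hz
    have h1 := hX z hz
    rw [Xy z hz] at h1
    linarith
  have Tt : ∀ z ∈ Ω, pd eT T z = pd eX X z := by
    intro z hz
    have h1 := (h.first z hz).Bp
    rw [Yx z hz, Yy z hz, zero_mul, sub_zero] at h1
    exact mul_right_cancel₀ (h.Bp_ne hz) h1
  have Bx : ∀ z ∈ Ω, pd eX B z = 2 * pd eT Y z := by
    intro z hz
    have h1 := (h.first z hz).Bx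
    rw [Yx z hz, Tt z hz] at h1
    refine mul_left_cancel₀ (a := pd eX X z) ?_ (by linarith)
    rw [← Tt z hz]; exact (h.first z hz).Tt_ne
  have By : ∀ z ∈ Ω, pd eY B z = -2 * pd eX X z * pd eP B z * pd eT X z := by
    intro z hz
    have h1 := (h.first z hz).By
    rw [Xy z hz, Yy z hz, Tt z hz] at h1
    linear_combination pd eX X z * h1 - pd eY B z * Xx_sq z hz
  -- Both terms vanish because Y_tx = 0 and X_ty = 0. The forcing is therefore 2βY, and its
  -- vanishing t-derivative gives Y_t = 0.
  have lapB : ∀ z ∈ Ω, pd eX (pd eX B) z + pd eY (pd eY B) z = 0 := by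
    intro z hz
    have dT := fun d => differentiableAt_of_smooth (contDiffAt_pd (h.smoothY z hz) d)
    have dX := fun d => differentiableAt_of_smooth (contDiffAt_pd (h.smoothX z hz) d)
    have dP := differentiableAt_of_smooth (contDiffAt_pd (h.smoothB z hz) eP)
    rw [pd_eq_of_eqOn h.isOpen Bx eX hz, pd_eq_of_eqOn h.isOpen By eY hz,
      pd_const_mul _ (dT _), pd_pd_eq_zero h.isOpen h.smoothY Yx _ hz,
      pd_mul (((dX _).const_mul _).fun_mul dP) (dX _), pd_mul ((dX _).const_mul _) dP,
      pd_const_mul _ (dX _), pd_pd_eq_zero h.isOpen h.smoothX Xy _ hz,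
      pd_pd_eq_zero h.isOpen h.smoothX Xy _ hz, h.pd_Bp isSpatial_eY hz]
    ring
  have Yt : ∀ z ∈ Ω, pd eT Y z = 0 := by
    intro z hz
    have h1 := hK z hz eT
    rw [(hlow z hz).2.2.2.2, ← pd_add (dB eX z hz) (dB eY z hz),
      pd_eq_zero_of_eqOn_const h.isOpen lapB eT hz] at h1
    exact (mul_eq_zero.1 (by linarith : 2 * β * pd eT Y z = 0)).resolve_left h2β
  exact fun z hz => ⟨Xy z hz, Yx z hz, Yt z hz, Yy z hz, Tt z hz, Xx_sq z hz, Bp_sq z hz,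
    (h.Am_sq hz).trans (Bp_sq z hz), (hlow z hz).1, by rw [Bx z hz, Yt z hz, mul_zero], By z hz⟩

end Rigidity

/-! ### Integration of the determining equations -/

section Integration

variable {F β : ℝ} {Ω : Set Total} {Φ : Total → Total} {T X Y A B f : Total → ℝ} {z : Total}

theorem fderiv_eq_zero_of_pd (hT : pd eT f z = 0) (hX : pd eX f z = 0) (hY : pd eY f z = 0)
    (hM : pd eM f z = 0) (hP : pd eP f z = 0) : fderiv ℝ f z = 0 := by
  refine ContinuousLinearMap.ext fun e => ?_
  have h : fderiv ℝ f z (e.1, e.2) = e.1.1 • pd eT f z + e.1.2.1 • pd eX f z + e.1.2.2 • pd eY f z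
      + e.2.1 • pd eM f z + e.2.2 • pd eP f z := clm_total_apply _ _ _
  rw [hT, hX, hY, hM, hP] at h
  simpa using h

theorem exists_eq_const (hΩ : IsOpen Ω) (hconn : IsPreconnected Ω)
    (hf : ∀ z ∈ Ω, ContDiffAt ℝ ∞ f z) (hd : ∀ z ∈ Ω, fderiv ℝ f z = 0) :
    ∃ c, ∀ z ∈ Ω, f z = c :=
  hΩ.exists_is_const_of_fderiv_eq_zero hconn
    (fun z hz => (differentiableAt_of_smooth (hf z hz)).differentiableWithinAt) hd

theorem isOpen_times (hΩ : IsOpen Ω) : IsOpen (times Ω) :=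
  (isOpenMap_fst.comp isOpenMap_fst) Ω hΩ

/-- A smooth function with vanishing derivatives in all directions but the time is a smooth
function of time if the time slices are connected. -/
theorem exists_function_of_time (hΩ : IsOpen Ω)
    (hslice : ∀ t : ℝ, IsPreconnected {z : Total | z ∈ Ω ∧ z.1.1 = t})
    (hf : ∀ z ∈ Ω, ContDiffAt ℝ ∞ f z) (hd : ∀ e, IsSpatial e → ∀ z ∈ Ω, pd e f z = 0) :
    ∃ k : ℝ → ℝ, ContDiffOn ℝ ∞ k (times Ω) ∧
      ∀ z ∈ Ω, f z = k z.1.1 ∧ deriv k z.1.1 = pd eT f z := by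
  have const : ∀ z ∈ Ω, ∀ w ∈ Ω, z.1.1 = w.1.1 → f z = f w := by
    intro z hz w hw hzw
    set t := w.1.1 with ht
    set ι : (ℝ × ℝ) × Fiber → Total := fun a => ((t, a.1), a.2) with hι
    set π : Total → (ℝ × ℝ) × Fiber := fun z => (z.1.2, z.2) with hπ
    have hιc : Continuous ι := by fun_prop
    have hS : ι ⁻¹' Ω = π '' {z : Total | z ∈ Ω ∧ z.1.1 = t} := by
      ext a
      constructor
      · exact fun ha => ⟨ι a, ⟨ha, rfl⟩, rfl⟩
      · rintro ⟨b, ⟨hb, hbt⟩, rfl⟩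
        change ((t, b.1.2), b.2) ∈ Ω
        rw [← hbt]
        exact hb
    have hpre : IsPreconnected (ι ⁻¹' Ω) := by
      rw [hS]; exact (hslice t).image π (by fun_prop)
    have hder : ∀ a ∈ ι ⁻¹' Ω, HasFDerivAt (fun a => f (ι a)) (0 : (ℝ × ℝ) × Fiber →L[ℝ] ℝ) a := by
      intro a ha
      have h1 : HasFDerivAt ι (((0 : (ℝ × ℝ) × Fiber →L[ℝ] ℝ).prod
          (ContinuousLinearMap.fst ℝ (ℝ × ℝ) Fiber)).prod
          (ContinuousLinearMap.snd ℝ (ℝ × ℝ) Fiber)) a :=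
        ((hasFDerivAt_const t a).prodMk hasFDerivAt_fst).prodMk hasFDerivAt_snd
      have h2 := (differentiableAt_of_smooth (hf _ ha)).hasFDerivAt.comp a h1
      refine h2.congr_fderiv (ContinuousLinearMap.ext fun b => ?_)
      have h3 : fderiv ℝ f (ι a) ((0, b.1), b.2) = (0 : ℝ) • pd eT f (ι a) + b.1.1 • pd eX f (ι a)
        + b.1.2 • pd eY f (ι a) + b.2.1 • pd eM f (ι a) + b.2.2 • pd eP f (ι a) :=
        clm_total_apply _ _ _
      rw [hd _ isSpatial_eX _ ha, hd _ isSpatial_eY _ ha, hd _ isSpatial_eM _ ha,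
        hd _ isSpatial_eP _ ha] at h3
      simpa using h3
    have hz' : ι (π z) = z := by simp only [hι, hπ, ← hzw]
    have hw' : ι (π w) = w := rfl
    have := (hΩ.preimage hιc).is_const_of_fderiv_eq_zero hpre
      (fun a ha => (hder a ha).differentiableAt.differentiableWithinAt)
      (fun a ha => (hder a ha).fderiv) (x := π z) (y := π w) (by
        change ι (π z) ∈ Ω; rw [hz']; exact hz) hw
    simpa only [hz', hw'] using this
  classical
  -- On `times Ω` the choice of the point is immaterial by `const`; the value 0 elsewhere is never
  -- used.
  let k : ℝ → ℝ := fun t => if h : ∃ z ∈ Ω, z.1.1 = t then f h.choose else 0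
  have hk : ∀ z ∈ Ω, f z = k z.1.1 := by
    intro z hz
    have h : ∃ w ∈ Ω, w.1.1 = z.1.1 := ⟨z, hz, rfl⟩
    simp only [k, dif_pos h]
    exact const _ hz _ h.choose_spec.1 h.choose_spec.2.symm
  -- Ω is open, so the line through z along the time axis stays in Ω for nearby times. There k is f
  -- along that line, which gives its smoothness and its derivative.
  have line : ∀ z ∈ Ω, k =ᶠ[𝓝 z.1.1] fun t => f (z + (t - z.1.1) • eT) := by
    intro z hz
    have hc : ContinuousAt (fun t : ℝ => z + (t - z.1.1) • eT) z.1.1 := by fun_prop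
    have hev := hc.eventually (hΩ.mem_nhds (x := z + (z.1.1 - z.1.1) • eT) (by simpa using hz))
    filter_upwards [hev] with t ht
    rw [hk _ ht]
    simp [eT]
  refine ⟨k, ?_, fun z hz => ⟨hk z hz, ?_⟩⟩
  · rintro _ ⟨z, hz, rfl⟩
    refine ContDiffAt.contDiffWithinAt ((?_ : ContDiffAt ℝ ∞ _ _).congr_of_eventuallyEq
      (line z hz))
    refine ContDiffAt.comp (f := fun t : ℝ => z + (t - z.1.1) • eT) z.1.1 ?_ (by fun_prop)
    simpa using hf z hz
  · rw [(line z hz).deriv_eq]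
    have h1 : HasDerivAt (fun t : ℝ => z + (t - z.1.1) • eT) eT z.1.1 := by
      simpa using (((hasDerivAt_id z.1.1).sub_const z.1.1).smul_const eT).const_add z
    have h2 : HasFDerivAt f (fderiv ℝ f z) (z + (z.1.1 - z.1.1) • eT) := by
      simpa using (differentiableAt_of_smooth (hf z hz)).hasFDerivAt
    exact (h2.comp_hasDerivAt z.1.1 h1).deriv

theorem pd_linear (l : Total →L[ℝ] ℝ) (e : Total) : pd e (fun z => l z) z = l e := by
  rw [pd, l.hasFDerivAt.fderiv]

/-- The coordinate `t`. -/
def coordT : Total →L[ℝ] ℝ :=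
  (ContinuousLinearMap.fst ℝ ℝ (ℝ × ℝ)).comp (ContinuousLinearMap.fst ℝ Base Fiber)
/-- The coordinate `x`. -/
def coordX : Total →L[ℝ] ℝ :=
  ((ContinuousLinearMap.fst ℝ ℝ ℝ).comp (ContinuousLinearMap.snd ℝ ℝ (ℝ × ℝ))).comp
    (ContinuousLinearMap.fst ℝ Base Fiber)
/-- The coordinate `y`. -/
def coordY : Total →L[ℝ] ℝ :=
  ((ContinuousLinearMap.snd ℝ ℝ ℝ).comp (ContinuousLinearMap.snd ℝ ℝ (ℝ × ℝ))).comp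
    (ContinuousLinearMap.fst ℝ Base Fiber)
/-- The coordinate `ψ⁻`. -/
def coordM : Total →L[ℝ] ℝ :=
  (ContinuousLinearMap.fst ℝ ℝ ℝ).comp (ContinuousLinearMap.snd ℝ Base Fiber)
/-- The coordinate `ψ⁺`. -/
def coordP : Total →L[ℝ] ℝ :=
  (ContinuousLinearMap.snd ℝ ℝ ℝ).comp (ContinuousLinearMap.snd ℝ Base Fiber)

theorem coord_values :
    (coordT eT = 1 ∧ coordT eX = 0 ∧ coordT eY = 0 ∧ coordT eM = 0 ∧ coordT eP = 0) ∧
    (coordX eT = 0 ∧ coordX eX = 1 ∧ coordX eY = 0 ∧ coordX eM = 0 ∧ coordX eP = 0) ∧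
    (coordY eT = 0 ∧ coordY eX = 0 ∧ coordY eY = 1 ∧ coordY eM = 0 ∧ coordY eP = 0) ∧
    (coordM eT = 0 ∧ coordM eX = 0 ∧ coordM eY = 0 ∧ coordM eM = 1 ∧ coordM eP = 0) ∧
    (coordP eT = 0 ∧ coordP eX = 0 ∧ coordP eY = 0 ∧ coordP eM = 0 ∧ coordP eP = 1) :=
  ⟨⟨rfl, rfl, rfl, rfl, rfl⟩, ⟨rfl, rfl, rfl, rfl, rfl⟩, ⟨rfl, rfl, rfl, rfl, rfl⟩,
    ⟨rfl, rfl, rfl, rfl, rfl⟩, ⟨rfl, rfl, rfl, rfl, rfl⟩⟩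

theorem pd_sub_coord (hf : ContDiffAt ℝ ∞ f z) (c : ℝ) (l : Total →L[ℝ] ℝ) (e : Total) :
    pd e (fun z => f z - c * l z) z = pd e f z - c * l e := by
  have hl := l.differentiableAt (x := z)
  rw [pd_sub (differentiableAt_of_smooth hf) (hl.const_mul c), pd_const_mul c hl, pd_linear]

theorem smooth_sub_coord (hf : ContDiffAt ℝ ∞ f z) (c : ℝ) (l : Total →L[ℝ] ℝ) :
    ContDiffAt ℝ ∞ (fun z => f z - c * l z) z :=
  hf.sub (contDiffAt_const.mul l.contDiff.contDiffAt)

/-- A smooth solution of f² = 1 is locally constant, and connectedness makes it a single sign. On an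
empty set the choice 1 is arbitrary. -/
theorem exists_sign (hΩ : IsOpen Ω) (hconn : IsPreconnected Ω)
    (hf : ∀ z ∈ Ω, ContDiffAt ℝ ∞ f z) (hsq : ∀ z ∈ Ω, f z ^ 2 = 1) :
    ∃ ε : ℝ, (ε = 1 ∨ ε = -1) ∧ ∀ z ∈ Ω, f z = ε := by
  rcases Ω.eq_empty_or_nonempty with rfl | ⟨z₀, hz₀⟩
  · exact ⟨1, Or.inl rfl, fun z hz => hz.elim⟩
  have hd : ∀ z ∈ Ω, ∀ e, pd e f z = 0 := fun z hz e =>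
    pd_eq_zero_of_sq_eq hΩ hf (g := fun _ => 1) (fun _ _ => contDiffAt_const)
      (fun z hz => by rw [hsq z hz, one_pow]) hz
      (fun h0 => by simpa [h0] using hsq z hz) (pd_const 1)
  obtain ⟨c, hc⟩ := exists_eq_const hΩ hconn hf (fun z hz => ContinuousLinearMap.ext (hd z hz))
  exact ⟨c, sq_eq_one_iff.1 (by rw [← hc z₀ hz₀, hsq z₀ hz₀]), hc⟩

/-- Integration of the determining equations. -/
theorem FirstOrderOn.integrate (h : FirstOrderOn Ω T X Y A B) (hconn : IsPreconnected Ω)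
    (hslice : ∀ t : ℝ, IsPreconnected {z : Total | z ∈ Ω ∧ z.1.1 = t})
    (hdet : ∀ z ∈ Ω, DeterminingEquations T X Y A B z) :
    ∃ (ε₁ ε₂ ε₃ T₀ Y₀ Ψ₀ : ℝ) (f g : ℝ → ℝ),
      (ε₁ = 1 ∨ ε₁ = -1) ∧ (ε₂ = 1 ∨ ε₂ = -1) ∧ (ε₃ = 1 ∨ ε₃ = -1) ∧
      ContDiffOn ℝ ∞ f (times Ω) ∧ ContDiffOn ℝ ∞ g (times Ω) ∧
      ∀ z ∈ Ω, T z = ε₁ * z.1.1 + T₀ ∧ X z = ε₁ * z.1.2.1 + f z.1.1 ∧ Y z = ε₂ * z.1.2.2 + Y₀ ∧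
        A z = ε₃ * z.2.1 + Ψ₀ ∧
        B z = ε₂ * z.2.2 - 2 * ε₁ * ε₂ * deriv f z.1.1 * z.1.2.2 + g z.1.1 := by
  have hΩ := h.isOpen
  obtain ⟨ε₁, h1, hε₁⟩ := exists_sign hΩ hconn (fun z hz => contDiffAt_pd (h.smoothX z hz) eX)
    (fun z hz => (hdet z hz).Xx_sq)
  obtain ⟨ε₂, h2, hε₂⟩ := exists_sign hΩ hconn (fun z hz => contDiffAt_pd (h.smoothB z hz) eP)
    (fun z hz => (hdet z hz).Bp_sq)
  obtain ⟨ε₃, h3, hε₃⟩ := exists_sign hΩ hconn (fun z hz => contDiffAt_pd (h.smoothA z hz) eM)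
    (fun z hz => (hdet z hz).Am_sq)
  obtain ⟨T₀, hT₀⟩ := exists_eq_const hΩ hconn
    (fun z hz => smooth_sub_coord (h.smoothT z hz) ε₁ coordT) (fun z hz => by
      have f := h.first z hz
      apply fderiv_eq_zero_of_pd <;> rw [pd_sub_coord (h.smoothT z hz)] <;>
        simp [coord_values, f.Tx, f.Ty, f.Tm, f.Tp, (hdet z hz).Tt, hε₁ z hz])
  obtain ⟨Y₀, hY₀⟩ := exists_eq_const hΩ hconn
    (fun z hz => smooth_sub_coord (h.smoothY z hz) ε₂ coordY) (fun z hz => by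
      have f := h.first z hz
      apply fderiv_eq_zero_of_pd <;> rw [pd_sub_coord (h.smoothY z hz)] <;>
        simp [coord_values, (hdet z hz).Yx, (hdet z hz).Yt, (hdet z hz).Yy, f.Ym, f.Yp, hε₂ z hz])
  obtain ⟨Ψ₀, hΨ₀⟩ := exists_eq_const hΩ hconn
    (fun z hz => smooth_sub_coord (h.smoothA z hz) ε₃ coordM) (fun z hz => by
      have f := h.first z hz
      apply fderiv_eq_zero_of_pd <;> rw [pd_sub_coord (h.smoothA z hz)] <;>
        simp [coord_values, (hdet z hz).At, f.Ax, f.Ay, f.Ap, hε₃ z hz])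
  obtain ⟨f, hf, hXf⟩ := exists_function_of_time hΩ hslice
    (fun z hz => smooth_sub_coord (h.smoothX z hz) ε₁ coordX) (fun e he z hz => by
      have f := h.first z hz
      rw [pd_sub_coord (h.smoothX z hz)]
      rcases he with rfl | rfl | rfl | rfl <;>
        simp [coord_values, (hdet z hz).Xy, f.Xm, f.Xp, hε₁ z hz])
  have hXt : ∀ z ∈ Ω, deriv f z.1.1 = pd eT X z := by
    intro z hz
    rw [(hXf z hz).2, pd_sub_coord (h.smoothX z hz), coord_values.2.1.1]
    ring
  have sXt := fun z hz => contDiffAt_pd (h.smoothX z hz) eT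
  have sXty : ∀ z ∈ Ω, ContDiffAt ℝ ∞ (fun z => pd eT X z * coordY z) z := fun z hz =>
    (sXt z hz).mul coordY.contDiff.contDiffAt
  have sB := fun z hz => smooth_sub_coord (h.smoothB z hz) ε₂ coordP
  -- B_y = −2ε₁ε₂X_t and X_t depends on t alone, so adding 2ε₁ε₂X_t y and subtracting ε₂ψ⁺ removes
  -- all derivatives but the one in t. By `hXt`, X_t equals f'.
  obtain ⟨g, hg, hBg⟩ := exists_function_of_time hΩ hslice
    (f := fun z => B z - ε₂ * coordP z + 2 * ε₁ * ε₂ * (pd eT X z * coordY z))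
    (fun z hz => (sB z hz).add (contDiffAt_const.mul (sXty z hz)))
    (fun e he z hz => by
      have f := h.first z hz
      have hXte : pd e (pd eT X) z = 0 := by
        rcases he with rfl | rfl | rfl | rfl
        · rw [pd_comm (h.smoothX z hz)]
          exact pd_eq_zero_of_eqOn_const hΩ hε₁ _ hz
        · exact pd_pd_eq_zero hΩ h.smoothX (fun z hz => (hdet z hz).Xy) _ hz
        · exact pd_pd_eq_zero hΩ h.smoothX (fun z hz => (h.first z hz).Xm) _ hz
        · exact pd_pd_eq_zero hΩ h.smoothX (fun z hz => (h.first z hz).Xp) _ hz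
      have dXty := differentiableAt_of_smooth (sXty z hz)
      rw [pd_add (differentiableAt_of_smooth (sB z hz)) (dXty.const_mul _),
        pd_const_mul _ dXty, pd_sub_coord (h.smoothB z hz),
        pd_mul (differentiableAt_of_smooth (sXt z hz)) coordY.differentiableAt, hXte, pd_linear]
      rcases he with rfl | rfl | rfl | rfl <;>
        simp [coord_values, (hdet z hz).Bx, (hdet z hz).By, f.Bm, hε₁ z hz, hε₂ z hz])
  refine ⟨ε₁, ε₂, ε₃, T₀, Y₀, Ψ₀, f, g, h1, h2, h3, hf, hg, fun z hz => ⟨?_, ?_, ?_, ?_, ?_⟩⟩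
  · change T z = ε₁ * coordT z + T₀
    linear_combination hT₀ z hz
  · change X z = ε₁ * coordX z + f z.1.1
    linear_combination (hXf z hz).1
  · change Y z = ε₂ * coordY z + Y₀
    linear_combination hY₀ z hz
  · change A z = ε₃ * coordM z + Ψ₀
    linear_combination hΨ₀ z hz
  · have h4 := (hBg z hz).1
    rw [hXt z hz]
    change B z = ε₂ * coordP z - 2 * ε₁ * ε₂ * pd eT X z * coordY z + g z.1.1
    linear_combination h4

end Integration

/-! ### The maps of the stated form are symmetries -/

section Converse

variable {F β ε₁ ε₂ ε₃ T₀ Y₀ Ψ₀ : ℝ} {f g : ℝ → ℝ} {Ω : Set Total} {Φ : Total → Total}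
  {T X Y A B : Total → ℝ} {z : Total}

/-- The components of the maps in the symmetry pseudogroup. -/
structure HasSymmetryForm (ε₁ ε₂ ε₃ T₀ Y₀ Ψ₀ : ℝ) (f g : ℝ → ℝ) (T X Y A B : Total → ℝ)
    (z : Total) : Prop where
  T_eq : T z = ε₁ * coordT z + T₀
  X_eq : X z = ε₁ * coordX z + f (coordT z)
  Y_eq : Y z = ε₂ * coordY z + Y₀
  A_eq : A z = ε₃ * coordM z + Ψ₀
  B_eq : B z = ε₂ * coordP z + (-2 * ε₁ * ε₂) * (deriv f (coordT z) * coordY z) + g (coordT z)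

theorem contDiffAt_comp_coordT {k : ℝ → ℝ} (hk : ContDiffAt ℝ ∞ k (coordT z)) :
    ContDiffAt ℝ ∞ (fun z => k (coordT z)) z :=
  ContDiffAt.comp z hk coordT.contDiff.contDiffAt

theorem pd_comp_coordT {k : ℝ → ℝ} (hk : ContDiffAt ℝ ∞ k (coordT z)) (e : Total) :
    pd e (fun z => k (coordT z)) z = deriv k (coordT z) * coordT e := by
  have h := (hk.differentiableAt (by simp)).hasDerivAt.comp_hasFDerivAt z coordT.hasFDerivAt
  have h' : HasFDerivAt (fun z => k (coordT z)) (deriv k (coordT z) • coordT) z := h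
  rw [pd, h'.fderiv]
  rfl

theorem pd_affine (c c' : ℝ) (l : Total →L[ℝ] ℝ) (e : Total) :
    pd e (fun z => c * l z + c') z = c * l e := by
  rw [pd_add (l.differentiableAt.const_mul c) (differentiableAt_const c'),
    pd_const_mul c l.differentiableAt, pd_linear, pd_const, add_zero]

theorem contDiffAt_deriv (hf : ContDiffAt ℝ ∞ f (coordT z)) :
    ContDiffAt ℝ ∞ (deriv f) (coordT z) := contDiffAt_pd hf 1

theorem contDiffAt_shear (hf : ContDiffAt ℝ ∞ f (coordT z)) :
    ContDiffAt ℝ ∞ (fun z => deriv f (coordT z) * coordY z) z :=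
  (contDiffAt_comp_coordT (contDiffAt_deriv hf)).mul coordY.contDiff.contDiffAt

/-- The first derivatives of the components. -/
theorem pd_of_hasSymmetryForm (hΩ : IsOpen Ω) (hf : ContDiffAt ℝ ∞ f (coordT z))
    (hg : ContDiffAt ℝ ∞ g (coordT z))
    (h : ∀ z ∈ Ω, HasSymmetryForm ε₁ ε₂ ε₃ T₀ Y₀ Ψ₀ f g T X Y A B z) (hz : z ∈ Ω) (e : Total) :
    pd e T z = ε₁ * coordT e ∧ pd e X z = ε₁ * coordX e + deriv f (coordT z) * coordT e ∧
      pd e Y z = ε₂ * coordY e ∧ pd e A z = ε₃ * coordM e ∧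
      pd e B z = ε₂ * coordP e + (-2 * ε₁ * ε₂) * (deriv (deriv f) (coordT z) * coordT e * coordY z
        + deriv f (coordT z) * coordY e) + deriv g (coordT z) * coordT e := by
  have cf := contDiffAt_comp_coordT hf
  have cg := contDiffAt_comp_coordT hg
  have cd := contDiffAt_comp_coordT (contDiffAt_deriv hf)
  have df := differentiableAt_of_smooth cf
  have dg := differentiableAt_of_smooth cg
  have dd := differentiableAt_of_smooth cd
  have ds := differentiableAt_of_smooth (contDiffAt_shear hf)
  refine ⟨?_, ?_, ?_, ?_, ?_⟩
  · rw [pd_eq_of_eqOn hΩ (fun z hz => (h z hz).T_eq) e hz, pd_affine]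
  · rw [pd_eq_of_eqOn hΩ (fun z hz => (h z hz).X_eq) e hz,
      pd_add (coordX.differentiableAt.const_mul _) df, pd_const_mul _ coordX.differentiableAt,
      pd_linear, pd_comp_coordT hf]
  · rw [pd_eq_of_eqOn hΩ (fun z hz => (h z hz).Y_eq) e hz, pd_affine]
  · rw [pd_eq_of_eqOn hΩ (fun z hz => (h z hz).A_eq) e hz, pd_affine]
  · rw [pd_eq_of_eqOn hΩ (fun z hz => (h z hz).B_eq) e hz,
      pd_add ((coordP.differentiableAt.const_mul _).fun_add (ds.const_mul _)) dg,
      pd_add (coordP.differentiableAt.const_mul _) (ds.const_mul _),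
      pd_const_mul _ coordP.differentiableAt, pd_linear, pd_comp_coordT hg, pd_const_mul _ ds,
      pd_mul dd coordY.differentiableAt, pd_linear, pd_comp_coordT (contDiffAt_deriv hf)]

/-- This makes `FirstOrderOn.systemAt_iff` applicable to the explicit maps, so that invariance is
checked by substituting constants for its coefficients. -/
theorem firstOrderOn_of_hasSymmetryForm (hΩ : IsOpen Ω) (h1 : ε₁ ^ 2 = 1) (h2 : ε₂ ^ 2 = 1)
    (h3 : ε₃ ^ 2 = 1) (hf : ∀ z ∈ Ω, ContDiffAt ℝ ∞ f (coordT z))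
    (hg : ∀ z ∈ Ω, ContDiffAt ℝ ∞ g (coordT z))
    (h : ∀ z ∈ Ω, HasSymmetryForm ε₁ ε₂ ε₃ T₀ Y₀ Ψ₀ f g T X Y A B z) :
    FirstOrderOn Ω T X Y A B := by
  have sm : ∀ {k l : Total → ℝ}, (∀ z ∈ Ω, k z = l z) → ∀ z ∈ Ω, ContDiffAt ℝ ∞ l z →
      ContDiffAt ℝ ∞ k z := fun hkl z hz hl =>
    hl.congr_of_eventuallyEq (by filter_upwards [hΩ.mem_nhds hz] with q hq using hkl q hq)
  have lin : ∀ (c : ℝ) (l : Total →L[ℝ] ℝ) (z : Total), ContDiffAt ℝ ∞ (fun z => c * l z) z :=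
    fun c l z => contDiffAt_const.mul l.contDiff.contDiffAt
  refine ⟨hΩ, fun z hz => ?_, fun z hz => ?_, fun z hz => ?_, fun z hz => ?_, fun z hz => ?_,
    fun z hz => ?_⟩
  · exact sm (fun z hz => (h z hz).T_eq) z hz ((lin _ _ _).add contDiffAt_const)
  · exact sm (fun z hz => (h z hz).X_eq) z hz ((lin _ _ _).add (contDiffAt_comp_coordT (hf z hz)))
  · exact sm (fun z hz => (h z hz).Y_eq) z hz ((lin _ _ _).add contDiffAt_const)
  · exact sm (fun z hz => (h z hz).A_eq) z hz ((lin _ _ _).add contDiffAt_const)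
  · exact sm (fun z hz => (h z hz).B_eq) z hz (((lin _ _ _).add
      (contDiffAt_const.mul (contDiffAt_shear (hf z hz)))).add (contDiffAt_comp_coordT (hg z hz)))
  · have d := pd_of_hasSymmetryForm hΩ (hf z hz) (hg z hz) h hz
    have e1 : ε₁ ≠ 0 := by rintro rfl; norm_num at h1
    have e2 : ε₂ ≠ 0 := by rintro rfl; norm_num at h2
    constructor <;> simp only [(d _).1, (d _).2.1, (d _).2.2.1, (d _).2.2.2.1, (d _).2.2.2.2,
      coord_values, mul_zero, mul_one, add_zero, zero_add, zero_mul, sub_zero]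
    · rw [h1, h2]; ring
    · exact e1
    · exact mul_ne_zero e1 e2
    · rw [mul_pow, mul_pow, h2, h3]
    · linear_combination (-2 * ε₂ * deriv f (coordT z)) * h1

/-- The maps in the symmetry pseudogroup are point symmetries of the system. -/
theorem isPointSymmetry_of_hasSymmetryForm (hΩ : IsOpen Ω) (h1 : ε₁ ^ 2 = 1) (h2 : ε₂ ^ 2 = 1)
    (h3 : ε₃ ^ 2 = 1) (hf : ∀ z ∈ Ω, ContDiffAt ℝ ∞ f (coordT z))
    (hg : ∀ z ∈ Ω, ContDiffAt ℝ ∞ g (coordT z))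
    (h : ∀ z ∈ Ω, HasSymmetryForm ε₁ ε₂ ε₃ T₀ Y₀ Ψ₀ f g (fun z => (Φ z).1.1)
      (fun z => (Φ z).1.2.1) (fun z => (Φ z).1.2.2) (fun z => (Φ z).2.1) (fun z => (Φ z).2.2) z) :
    IsPointSymmetry F β Ω Φ := by
  have H := firstOrderOn_of_hasSymmetryForm hΩ h1 h2 h3 hf hg h
  have e1 : ε₁ ≠ 0 := by rintro rfl; norm_num at h1
  have e2 : ε₂ ≠ 0 := by rintro rfl; norm_num at h2
  have e3 : ε₃ ≠ 0 := by rintro rfl; norm_num at h3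
  have hs : ∀ z ∈ Ω, ContDiffAt ℝ ∞ Φ z := fun z hz =>
    ((H.smoothT z hz).prodMk ((H.smoothX z hz).prodMk (H.smoothY z hz))).prodMk
      ((H.smoothA z hz).prodMk (H.smoothB z hz))
  have D := fun z hz => pd_of_hasSymmetryForm hΩ (hf z hz) (hg z hz) h hz
  refine ⟨⟨fun z hz => (hs z hz).contDiffWithinAt, fun z hz => ?_⟩, ?_⟩
  · refine det_ne_zero_of_injective fun e he => ?_
    have c := pd_components ((hs z hz).differentiableAt (by simp)) e
    have d := D z hz e
    rw [he] at c
    have t0 : coordT e = 0 := (mul_eq_zero.1 (d.1.symm.trans c.1)).resolve_left e1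
    have m0 : coordM e = 0 := (mul_eq_zero.1 (d.2.2.2.1.symm.trans c.2.2.2.1)).resolve_left e3
    have y0 : coordY e = 0 := (mul_eq_zero.1 (d.2.2.1.symm.trans c.2.2.1)).resolve_left e2
    have hx := d.2.1.symm.trans c.2.1
    have hp := d.2.2.2.2.symm.trans c.2.2.2.2
    rw [t0, mul_zero, add_zero] at hx
    rw [t0, y0] at hp
    have x0 : coordX e = 0 := (mul_eq_zero.1 hx).resolve_left e1
    have p0 : coordP e = 0 := (mul_eq_zero.1 (by simpa using hp)).resolve_left e2
    exact Prod.ext (Prod.ext t0 (Prod.ext x0 y0)) (Prod.ext m0 p0)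
  · intro u v p hu hz hv ht hsys
    have hgrad : ∀ z ∈ Ω, gradSq (fun z => (Φ z).1.2.1) z = 1 := by
      intro z hz
      simp only [gradSq, (D z hz _).2.1, coord_values]
      linear_combination h1
    have hG : ∀ z ∈ Ω, coeffMinus (fun z => (Φ z).1.2.1) (fun z => (Φ z).2.1) z = ε₃ := by
      intro z hz
      rw [coeffMinus, hgrad z hz, (D z hz _).2.2.2.1, coord_values.2.2.2.1.2.2.2.1]
      ring
    have hH : ∀ z ∈ Ω, coeffPlus (fun z => (Φ z).1.2.1) (fun z => (Φ z).2.2) z = ε₂ := by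
      intro z hz
      rw [coeffPlus, hgrad z hz, (D z hz _).2.2.2.2]
      simp [coord_values]
    -- B is affine in x and y at fixed time, so ΔB = 0 and the forcing is 2βY.
    have hK : ∀ z ∈ Ω, forcing β (fun z => (Φ z).1.2.1) (fun z => (Φ z).1.2.2)
        (fun z => (Φ z).2.2) z = (2 * β * ε₂) * coordY z + 2 * β * Y₀ := by
      intro z hz
      have hY : (Φ z).1.2.2 = ε₂ * coordY z + Y₀ := (h z hz).Y_eq
      have hx : ∀ z ∈ Ω, pd eX (fun z => (Φ z).2.2) z = 0 := by
        intro z hz; rw [(D z hz _).2.2.2.2]; simp [coord_values]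
      have hy : ∀ z ∈ Ω, pd eY (fun z => (Φ z).2.2) z =
          (-2 * ε₁ * ε₂) * deriv f (coordT z) := by
        intro z hz; rw [(D z hz _).2.2.2.2]; simp [coord_values]
      have cd := contDiffAt_deriv (hf z hz)
      rw [forcing, hgrad z hz, hY, pd_eq_zero_of_eqOn_const hΩ hx eX hz,
        pd_eq_of_eqOn hΩ hy eY hz,
        pd_const_mul _ (differentiableAt_of_smooth (contDiffAt_comp_coordT cd)),
        pd_comp_coordT cd, coord_values.1.2.2.1]
      ring
    have K : ∀ e, pd e (forcing β (fun z => (Φ z).1.2.1) (fun z => (Φ z).1.2.2)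
        (fun z => (Φ z).2.2)) (p, u p) = 2 * β * ε₂ * coordY e := fun e => by
      rw [pd_eq_of_eqOn hΩ hK e hz, pd_affine]
    have hum : ContDiffAt ℝ ∞ (fun q => (u q).1) p := hu.fst
    have hup : ContDiffAt ℝ ∞ (fun q => (u q).2) p := hu.snd
    have hvm : ContDiffAt ℝ ∞ (fun q => (v q).1) (Φ (p, u p)).1 := hv.fst
    have hvp : ContDiffAt ℝ ∞ (fun q => (v q).2) (Φ (p, u p)).1 := hv.snd
    refine (H.systemAt_iff hum hup hz rfl hvm hvp
      (ht.graph.mono fun q hq => congrArg Prod.fst hq)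
      (ht.graph.mono fun q hq => congrArg Prod.snd hq)).2 ?_
    rw [systemAt_iff hum hup] at hsys
    obtain ⟨s1, s2⟩ := hsys
    rw [hG _ hz, hH _ hz, K, K, K, pd_eq_zero_of_eqOn_const hΩ hG eT hz,
      pd_eq_zero_of_eqOn_const hΩ hH eT hz, (D _ hz _).2.2.2.1, (D _ hz _).2.2.2.1,
      (D _ hz _).2.2.2.2]
    simp only [coord_values, mul_zero, mul_one, add_zero, zero_add, zero_mul]
    -- Modulo ε₂² = ε₃² = 1, the transformed equations are the original ones multiplied by 2 and by
    -- 2ε₂ε₃.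
    constructor
    · linear_combination 2 * s1 + 2 * (Dt (lap (fun q => (u q).2)) p
        + 1 / 2 * (Dx (fun q => (u q).2) p * (Dy (lap (fun q => (u q).2)) p + 2 * β)
          - Dy (fun q => (u q).2) p * Dx (lap (fun q => (u q).2)) p)) * h2
        + (Dx (fun q => (u q).1) p * Dy (lap (fun q => (u q).1)) p
          - Dy (fun q => (u q).1) p * Dx (lap (fun q => (u q).1)) p) * h3
    · linear_combination 2 * ε₂ * ε₃ * s2

end Converse

end TwoLayer

end

/-! ### The classification of the point symmetries -/

theorem theorem1 (F β : ℝ) (hFβ : F * β ≠ 0)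
    (Ω : Set TwoLayer.Total) (hopen : IsOpen Ω) (hconn : IsPreconnected Ω)
    (hslice : ∀ t : ℝ, IsPreconnected {z : TwoLayer.Total | z ∈ Ω ∧ z.1.1 = t})
    (Φ : TwoLayer.Total → TwoLayer.Total) :
    TwoLayer.IsPointSymmetry F β Ω Φ ↔
      ∃ (ε₁ ε₂ ε₃ T₀ Y₀ Ψ₀ : ℝ) (f g : ℝ → ℝ),
        (ε₁ = 1 ∨ ε₁ = -1) ∧ (ε₂ = 1 ∨ ε₂ = -1) ∧ (ε₃ = 1 ∨ ε₃ = -1) ∧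
        ContDiffOn ℝ ∞ f (TwoLayer.times Ω) ∧ ContDiffOn ℝ ∞ g (TwoLayer.times Ω) ∧
        ∀ t x y ψm ψp : ℝ, ((t, x, y), (ψm, ψp)) ∈ Ω →
          Φ ((t, x, y), (ψm, ψp)) =
            ((ε₁ * t + T₀, ε₁ * x + f t, ε₂ * y + Y₀),
              (ε₃ * ψm + Ψ₀, ε₂ * ψp - 2 * ε₁ * ε₂ * deriv f t * y + g t)) := by
  constructor
  · intro hsym
    have h := hsym.firstOrderOn hopen
    obtain ⟨ε₁, ε₂, ε₃, T₀, Y₀, Ψ₀, f, g, h1, h2, h3, hf, hg, hz⟩ := h.integrate hconn hslice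
      (h.determiningEquations (right_ne_zero_of_mul hFβ) fun z hz =>
        hsym.lower_order hopen hFβ hz rfl rfl rfl rfl rfl)
    refine ⟨ε₁, ε₂, ε₃, T₀, Y₀, Ψ₀, f, g, h1, h2, h3, hf, hg, fun t x y ψm ψp hmem => ?_⟩
    obtain ⟨hT, hX, hY, hA, hB⟩ := hz _ hmem
    exact Prod.ext (Prod.ext hT (Prod.ext hX hY)) (Prod.ext hA hB)
  · rintro ⟨ε₁, ε₂, ε₃, T₀, Y₀, Ψ₀, f, g, h1, h2, h3, hf, hg, hz⟩
    have smooth : ∀ {k : ℝ → ℝ}, ContDiffOn ℝ ∞ k (TwoLayer.times Ω) →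
        ∀ z ∈ Ω, ContDiffAt ℝ ∞ k (TwoLayer.coordT z) := fun hk z hz =>
      hk.contDiffAt ((TwoLayer.isOpen_times hopen).mem_nhds ⟨z, hz, rfl⟩)
    refine TwoLayer.isPointSymmetry_of_hasSymmetryForm (T₀ := T₀) (Y₀ := Y₀) (Ψ₀ := Ψ₀) hopen
      (sq_eq_one_iff.2 h1) (sq_eq_one_iff.2 h2) (sq_eq_one_iff.2 h3) (smooth hf) (smooth hg)
      fun z hmem => ?_
    have hΦ := hz z.1.1 z.1.2.1 z.1.2.2 z.2.1 z.2.2 hmem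
    refine ⟨congrArg (fun w => w.1.1) hΦ, congrArg (fun w => w.1.2.1) hΦ,
      congrArg (fun w => w.1.2.2) hΦ, congrArg (fun w => w.2.1) hΦ, ?_⟩
    have hB : (Φ z).2.2 = ε₂ * TwoLayer.coordP z - 2 * ε₁ * ε₂ * deriv f (TwoLayer.coordT z)
      * TwoLayer.coordY z + g (TwoLayer.coordT z) := congrArg (fun w => w.2.2) hΦ
    linear_combination hB
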